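/- **Model.** $n$ identical devices share one channel; time is divided into synchronized slots. In each slot every device that has not terminated chooses to transmit a message, to listen, or to stay idle. Transmitting and listening cost one unit of energy each, idling is free; computation is free and messages may be arbitrarily large. The channel state of a slot is *silence* if no device transmits, the message $m$ if exactly one device transmits $m$, and *noise* if at least two devices transmit. A listener receives the channel state in Strong-CD and Receiver-CD; in Sender-CD and No-CD it also receives it, except that noise is heard as silence. A transmitter receives the same signal as a listener in Strong-CD and in Sender-CD, and no signal in Receiver-CD and No-CD. A randomized algorithm is one program, independent of $n$, run by all devices; all devices begin in the same state, know neither $n$ nor any IDs, know the collision-detection model, and draw private independent random choices. *Approximate Counting* (with factor $C$): all devices terminate and output the same integer $\tilde n$ with $n/C\le\tilde n\le Cn$. *Leader Election*: all devices terminate after the same slot, exactly one designates itself leader and all others designate themselves followers, and in this last slot the leader transmits a message while every follower listens. $\log^* n$ is the number of times $\log_2$ must be applied to $n$ to reach a value at most $1$. **Theorem.** There is an absolute constant $C$ such that for each of the four models and every real $c>0$ there are a randomized algorithm and functions $T,E:\mathbb N\to\mathbb N$ with - $T(n)=n^{o(1)}$, - $E(n)=O(\log^* n)$ if the model is Sender-CD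 or No-CD, - $E(n)=O(\log(\log^* n))$ if the model is Strong-CD or Receiver-CD, such that for every $n\ge 1$ (every $n>1$ in No-CD), when $n$ devices run the algorithm, with probability at least $1-1/(n+1)^{c}$ all of them terminate within $T(n)$ slots, each device spends at most $E(n)$ units of energy, and both Approximate Counting with factor $C$ and Leader Election are solved. -/

import Mathlib

open Filter Asymptotics Topology

namespace RadioNetwork

/-- The four collision-detection models. -/
inductive CDModel
  | strongCD
  | senderCD
  | receiverCD
  | noCD

/-- What a device does in one time slot; `M` is the message space. -/
inductive Action (M : Type)
  | idle
  | listen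
  | transmit (m : M)

/-- What can be heard on the channel: silence, noise, or a message. -/
inductive Signal (M : Type)
  | silence
  | noise
  | message (m : M)

/-- Transmitting and listening each cost one unit of energy, idling is free. -/
def Action.cost {M : Type} : Action M → ℕ
  | .idle => 0
  | .listen => 1
  | .transmit _ => 1

/-- The message sent by an action, if any. -/
def Action.sent {M : Type} : Action M → Option M
  | .transmit m => some m
  | _ => none

/-- The state of the channel in a slot in which the devices perform the actions `a`:
silence if nobody transmits, the message if exactly one device transmits,
noise if at least two devices transmit. -/
def channel {M : Type} {n : ℕ} (a : Fin n → Action M) : Signal M :=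
  match (List.ofFn a).filterMap Action.sent with
  | [] => .silence
  | [m] => .message m
  | _ => .noise

/-- Without collision detection, noise is indistinguishable from silence. -/
def Signal.mute {M : Type} : Signal M → Signal M
  | .noise => .silence
  | s => s

/-- The signal that a device receives after performing the given action, when the channel is in
the state `s` (`none`: no signal is received). -/
def feedback {M : Type} (s : Signal M) : CDModel → Action M → Option (Signal M)
  | _, .idle => none
  | .strongCD, .listen => some s
  | .strongCD, .transmit _ => some s
  | .senderCD, .listen => some s.mute
  | .senderCD, .transmit _ => some s.mute
  | .receiverCD, .listen => some s
  | .receiverCD, .transmit _ => none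
  | .noCD, .listen => some s.mute
  | .noCD, .transmit _ => none

/-- The final designation of a device in leader election. -/
inductive Role
  | leader
  | follower

/-- The output of a device: an estimate of the number of devices, and a role. -/
structure Output where
  estimate : ℕ
  role : Role

/-- A randomized algorithm: the common program of all devices, which does not depend on the
number of devices. All devices begin in the state `start`. A device whose state `q` satisfies
`output q = some o` has terminated with output `o`. Any other device draws, at the beginning of
each slot, an action and an intermediate state with its private randomness from the distribution
`act q`, and after the slot updates the intermediate state with the signal it received. -/
structure Algorithm where
  State : Type
  Msg : Type
  start : State
  output : State → Option Output
  act : State → PMF (Action Msg × State)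
  update : State → Option (Signal Msg) → State

/-- A device during an execution: its state, the number of slots for which it has been running,
the energy it has spent, and the action it performed in its last slot (`idle` before the first
slot). -/
structure Device (A : Algorithm) where
  state : A.State
  elapsed : ℕ
  energy : ℕ
  lastAction : Action A.Msg

/-- The joint distribution of independent draws from `p 0, …, p (n - 1)`. -/
noncomputable def indep {α : Type} : {n : ℕ} → (Fin n → PMF α) → PMF (Fin n → α)
  | 0, _ => PMF.pure Fin.elim0
  | _ + 1, p => (p 0).bind fun a => (indep (fun i => p i.succ)).map fun f => Fin.cons a f

/-- The random choice of a device for the next slot; a terminated device stays idle. -/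
noncomputable def Device.draw {A : Algorithm} (d : Device A) : PMF (Action A.Msg × A.State) :=
  match A.output d.state with
  | some _ => PMF.pure (.idle, d.state)
  | none => A.act d.state

/-- A device after a slot with random choice `x` and channel state `s`; a terminated device does
not change any more. -/
def Device.advance {A : Algorithm} (cd : CDModel) (s : Signal A.Msg) (d : Device A)
    (x : Action A.Msg × A.State) : Device A :=
  match A.output d.state with
  | some _ => d
  | none =>
    { state := A.update x.2 (feedback s cd x.1)
      elapsed := d.elapsed + 1
      energy := d.energy + x.1.cost
      lastAction := x.1 }

/-- One slot of the network: independent choices, then feedback from the common channel. -/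
noncomputable def slot (A : Algorithm) (cd : CDModel) {n : ℕ} (D : Fin n → Device A) :
    PMF (Fin n → Device A) :=
  (indep fun v => (D v).draw).map fun x =>
    fun v => (D v).advance cd (channel fun w => (x w).1) (x v)

/-- The distribution of the configuration of `n` devices running `A` after `t` slots. -/
noncomputable def run (A : Algorithm) (cd : CDModel) (n : ℕ) : ℕ → PMF (Fin n → Device A)
  | 0 => PMF.pure fun _ => ⟨A.start, 0, 0, .idle⟩
  | t + 1 => (run A cd n t).bind (slot A cd)

/-- All devices have terminated and agree on an estimate of the number `n` of devices which is
correct up to the factor `C`. -/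
def SolvesCounting {A : Algorithm} {n : ℕ} (C : ℝ) (D : Fin n → Device A) : Prop :=
  ∃ m : ℕ, (∀ v, ∃ o, A.output (D v).state = some o ∧ o.estimate = m) ∧
    (n : ℝ) ≤ C * m ∧ (m : ℝ) ≤ C * n

/-- All devices have terminated after the same slot, exactly one of them as leader and all others
as followers, and in this last slot the leader sent a message while all followers listened. -/
def SolvesLeaderElection {A : Algorithm} {n : ℕ} (D : Fin n → Device A) : Prop :=
  ∃ l : Fin n,
    (∃ o, A.output (D l).state = some o ∧ o.role = Role.leader) ∧
    (∃ m, (D l).lastAction = Action.transmit m) ∧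
    ∀ v, v ≠ l →
      (∃ o, A.output (D v).state = some o ∧ o.role = Role.follower) ∧
      (D v).lastAction = Action.listen ∧ (D v).elapsed = (D l).elapsed

/-- The probability that `n` devices running `A` all terminate within `T` slots, each having spent
at most `E` units of energy, and solve both approximate counting (up to the factor `C`) and
leader election. -/
noncomputable def successProb (A : Algorithm) (cd : CDModel) (C : ℝ) (n T E : ℕ) : ℝ :=
  ((run A cd n T).toOuterMeasure
    {D | SolvesCounting C D ∧ SolvesLeaderElection D ∧ ∀ v, (D v).energy ≤ E}).toReal

/-- `T(n) = n^{o(1)}`. -/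
def IsSubpolynomial (T : ℕ → ℕ) : Prop :=
  ∃ g : ℕ → ℝ, Tendsto g atTop (𝓝 0) ∧ ∀ᶠ n : ℕ in atTop, (T n : ℝ) ≤ (n : ℝ) ^ g n

/-- The iterated logarithm: how often `log₂` has to be applied to `n` to obtain a value `≤ 1`. -/
noncomputable def logStar (n : ℕ) : ℕ :=
  sInf {k : ℕ | (Real.logb 2)^[k] (n : ℝ) ≤ 1}

end RadioNetwork

/-! The size of the network is guessed in stages with parameters `d 0 < d 1 < …`. Stage `i` is
designed for networks with `n ≤ 2 ^ d i`, takes time polynomial in `d i`, and costs a device only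
`O(1)` energy. The parameters satisfy `d (i + 1) = 2 ^ √(d i)` (`param_succ`). This growth is still
that of a tower, so the first stage `I` with `n ≤ 2 ^ d I` satisfies `I ≤ log* n`
(`finalStage_le_logStar`). It is also slow enough that `n > 2 ^ d (I - 1)` makes every fixed power
of `d I` equal to `n ^ o(1)` (`isSubpolynomial_time`). Running all stages up to `I` costs `O(log*
n)` energy. If listeners can tell noise from silence, an unbounded binary search ends at most two
stages below `I` after `O(log I)` one-slot probes, in which every device transmits with probability
`2 ^ (-d m)` (`doubling_search`).

A stage is cheap because its work is distributed. Each device draws one of `numRoles d` roles, a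
number polynomial in `d`, and Chernoff's bound fills all roles evenly (`avg_not_balanced_le`). A
role is either to be a candidate in one round or to relay the public state (whether a leader exists,
and a counter of successes) from one round to the next. In a round at scale `k` the candidates
transmit with probability `2 ^ (-k)`. The informed relays learn whether there was a single candidate
and broadcast the updated state with transmission probabilities running through the powers of two.
Whatever their number, some slot then has a single transmitter with probability at least `1 / 8`,
and independent columns of relays amplify this (`Alive.avg_not_alive_le`). After enough successes at
the current scale, a single candidate that happens to listen in a successful broadcast slot becomes
the leader and says so in the last slot of the round (`Alive.avg_elected_ge`). There is never a
second leader, and this safety is deterministic (`leadOK_after`). Chance only decides whether a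
leader appears and at which scale. Single candidates are frequent at a scale that matches the number
of candidates and very rare at scales off by a large constant factor, so the scale of the election,
multiplied by the number of roles, is an estimate of `n`.

Networks with `n ≤ 2 ^ d 0` are too small to fill the roles. They are handled by a routine in which
all devices take part, affordable because `d 0` does not depend on `n`; a three-slot handshake lets
the leader learn of its success in every model. A lone device, which can never complete the
handshake, is recognized beforehand except in No-CD.

In every epoch a device draws one number and is deterministic afterwards. A failure probability is
therefore an average, over a box of draws, of the failure probabilities after the epoch
(`FailLE.epoch`). Bounds are propagated by potentials that do not increase on average. Two of them,
`upperPot` and `lowerPot`, are Chernoff bounds in the form of supermartingales. Since probabilities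
never exceed `1`, a potential need only be controlled where it is below `1`; undesired states simply
receive a value of at least `1`. -/

namespace RadioNetwork

open Finset

/-! ### Averages over boxes -/

/-- The box `∏ v, {0, …, N v - 1}`. -/
def box {ι : Type} [Fintype ι] [DecidableEq ι] (N : ι → ℕ) : Finset (ι → ℕ) :=
  Fintype.piFinset fun v => range (N v)

/-- The average of a function over the box `∏ v, {0, …, N v - 1}`. -/
noncomputable def avg {ι : Type} [Fintype ι] [DecidableEq ι] (N : ι → ℕ) (f : (ι → ℕ) → ℝ) : ℝ :=
  (∑ x ∈ box N, f x) / ∏ v, (N v : ℝ)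

/-! ### Independent draws -/

theorem indep_apply {α : Type} : ∀ {n : ℕ} (p : Fin n → PMF α) (x : Fin n → α),
    indep p x = ∏ i, p i (x i)
  | 0, p, x => by
    have : x = Fin.elim0 := Subsingleton.elim _ _
    subst this
    simp [indep]
  | n + 1, p, x => by
    classical
    rw [indep, PMF.bind_apply, Fin.prod_univ_succ]
    rw [tsum_eq_single (x 0)]
    · rw [PMF.map_apply, tsum_eq_single (fun i : Fin n => x i.succ)]
      · rw [if_pos, indep_apply]
        exact (Fin.cons_self_tail x).symm
      · intro y hy
        rw [if_neg]
        intro h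
        apply hy
        funext i
        rw [h]
        simp
    · intro a ha
      rw [PMF.map_apply]
      simp only [mul_eq_zero, ENNReal.tsum_eq_zero]
      right
      intro y
      rw [if_neg]
      intro h
      apply ha
      rw [h]
      simp

theorem indep_map {α β : Type} : ∀ {n : ℕ} (p : Fin n → PMF α) (g : Fin n → α → β),
    indep (fun v => (p v).map (g v)) = (indep p).map fun x v => g v (x v)
  | 0, p, g => by
    simp only [indep, PMF.pure_map]
    congr 1
    exact Subsingleton.elim _ _
  | n + 1, p, g => by
    simp only [indep]
    rw [indep_map (fun i : Fin n => p i.succ) (fun i => g i.succ), PMF.map_bind, PMF.bind_map]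
    congr 1
    funext a
    simp only [Function.comp, PMF.map_comp]
    congr 1
    funext y
    funext i
    refine Fin.cases ?_ (fun j => ?_) i <;> simp

theorem indep_pure {α : Type} {n : ℕ} (x : Fin n → α) :
    indep (fun v => PMF.pure (x v)) = PMF.pure x := by
  classical
  ext y
  rw [indep_apply]
  simp only [PMF.pure_apply]
  by_cases h : y = x
  · simp [h]
  · rw [if_neg h]
    obtain ⟨i, hi⟩ := Function.ne_iff.mp h
    exact Finset.prod_eq_zero (Finset.mem_univ i) (by simp [hi])

/-- The uniform distribution on `{0, …, N - 1}` (for `N ≠ 0`). -/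
noncomputable def unif (N : ℕ) : PMF ℕ :=
  if h : 0 < N then PMF.uniformOfFinset (range N) (Finset.nonempty_range_iff.2 h.ne') else PMF.pure 0

theorem unif_apply {N : ℕ} (h : 0 < N) (k : ℕ) :
    unif N k = if k < N then (N : ENNReal)⁻¹ else 0 := by
  rw [unif, dif_pos h, PMF.uniformOfFinset_apply]
  simp

/-- The passage from expectations in `ENNReal` to finite real averages; the later estimates are all
about `avg`. -/
theorem tsum_indep_unif {n : ℕ} (N : Fin n → ℕ) (hN : ∀ v, 0 < N v)
    (g : (Fin n → ℕ) → ENNReal) (f : (Fin n → ℕ) → ℝ)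
    (hf : ∀ x ∈ box N, g x ≤ ENNReal.ofReal (f x)) (hf0 : ∀ x ∈ box N, 0 ≤ f x) :
    ∑' x, indep (fun v => unif (N v)) x * g x ≤ ENNReal.ofReal (avg N f) := by
  have hP : (0 : ℝ) < ∏ v, (N v : ℝ) := Finset.prod_pos fun v _ => by exact_mod_cast hN v
  rw [tsum_eq_sum (s := box N)]
  · have h1 : ∀ x ∈ box N, indep (fun v => unif (N v)) x * g x
        ≤ ENNReal.ofReal (f x / ∏ v, (N v : ℝ)) := by
      intro x hx
      have : indep (fun v => unif (N v)) x = ENNReal.ofReal ((∏ v, (N v : ℝ))⁻¹) := by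
        rw [indep_apply, ENNReal.ofReal_inv_of_pos hP, ENNReal.ofReal_prod_of_nonneg (by simp),
          ENNReal.prod_inv_distrib]
        · refine Finset.prod_congr rfl fun v _ => ?_
          have hv := Fintype.mem_piFinset.1 hx v
          rw [unif_apply (hN v), if_pos (Finset.mem_range.1 hv)]
          simp
        · intro i _ j _ _
          left
          simpa using (hN i).ne'
      rw [this, div_eq_inv_mul, ENNReal.ofReal_mul (inv_nonneg.2 hP.le)]
      gcongr
      exact hf x hx
    refine (Finset.sum_le_sum h1).trans ?_
    rw [← ENNReal.ofReal_sum_of_nonneg (fun x hx => div_nonneg (hf0 x hx) hP.le), avg,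
      Finset.sum_div]
  · intro x hx
    have : ∃ v, ¬ x v < N v := by
      by_contra hcon
      push Not at hcon
      exact hx (Fintype.mem_piFinset.2 fun v => Finset.mem_range.2 (hcon v))
    obtain ⟨v, hv⟩ := this
    rw [indep_apply, Finset.prod_eq_zero (Finset.mem_univ v), zero_mul]
    rw [unif_apply (hN v), if_neg hv]

/-! ### Executions from arbitrary configurations -/

/-- The distribution of the configuration `t` slots after the configuration `D`. -/
noncomputable def evolve (A : Algorithm) (cd : CDModel) {n : ℕ} (D : Fin n → Device A) :
    ℕ → PMF (Fin n → Device A)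
  | 0 => PMF.pure D
  | t + 1 => (evolve A cd D t).bind (slot A cd)

theorem run_eq_evolve (A : Algorithm) (cd : CDModel) (n t : ℕ) :
    run A cd n t = evolve A cd (fun _ : Fin n => ⟨A.start, 0, 0, .idle⟩) t := by
  induction t with
  | zero => rfl
  | succ t ih => rw [run, evolve, ih]

/-- `evolve` appends slots at the end, whereas the analysis of an epoch conditions on the first
slot. The two orders agree by associativity of `bind`. -/
theorem evolve_succ' (A : Algorithm) (cd : CDModel) {n : ℕ} (D : Fin n → Device A) (t : ℕ) :
    evolve A cd D (t + 1) = (slot A cd D).bind fun D' => evolve A cd D' t := by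
  induction t with
  | zero =>
    rw [evolve, evolve, PMF.pure_bind]
    exact (PMF.bind_pure _).symm
  | succ t ih =>
    rw [evolve, ih, PMF.bind_bind]
    rfl

theorem slot_terminated (A : Algorithm) (cd : CDModel) {n : ℕ} (D : Fin n → Device A)
    (h : ∀ v, ∃ o, A.output (D v).state = some o) : slot A cd D = PMF.pure D := by
  choose o ho using h
  have h1 : (fun v => (D v).draw) = fun v => PMF.pure ((.idle : Action A.Msg), (D v).state) := by
    funext v
    simp [Device.draw, ho v]
  rw [slot, h1, indep_pure, PMF.pure_map]
  congr 1
  funext v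
  simp [Device.advance, ho v]

/-- Terminated devices are frozen, so a time bound exceeding the actual running time does no harm.
-/
theorem evolve_terminated (A : Algorithm) (cd : CDModel) {n : ℕ} (D : Fin n → Device A)
    (h : ∀ v, ∃ o, A.output (D v).state = some o) (t : ℕ) : evolve A cd D t = PMF.pure D := by
  induction t with
  | zero => rfl
  | succ t ih => rw [evolve, ih, PMF.pure_bind, slot_terminated A cd D h]

theorem slot_of_draw_map {A : Algorithm} (cd : CDModel) {n : ℕ} (D : Fin n → Device A)
    (p : Fin n → PMF ℕ) (g : Fin n → ℕ → Action A.Msg × A.State)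
    (h : ∀ v, (D v).draw = (p v).map (g v)) :
    slot A cd D = (indep p).map fun x v =>
      (D v).advance cd (channel fun w => (g w (x w)).1) (g v (x v)) := by
  rw [slot, funext h, indep_map, PMF.map_comp]
  rfl

theorem slot_of_draw_pure {A : Algorithm} (cd : CDModel) {n : ℕ} (D : Fin n → Device A)
    (g : Fin n → Action A.Msg × A.State) (h : ∀ v, (D v).draw = PMF.pure (g v)) :
    slot A cd D = PMF.pure fun v =>
      (D v).advance cd (channel fun w => (g w).1) (g v) := by
  rw [slot, funext h, indep_pure, PMF.pure_map]

/-! ### Algorithms that work in epochs -/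

/-- What a device receives in a slot. -/
abbrev Obs (M : Type) := Option (Signal M)

/-- A program organized in epochs: a device with memory `m` draws a number `x < size m`, then acts
for `len m` slots deterministically, depending on `m`, `x` and what it received in this epoch, and
ends up with a new memory or an output. -/
structure Protocol where
  Mem : Type
  Msg : Type
  start : Mem
  size : Mem → ℕ
  len : Mem → ℕ
  act : Mem → ℕ → List (Obs Msg) → Action Msg
  fin : Mem → ℕ → List (Obs Msg) → Mem ⊕ Output

/-- The states of a device running a protocol. -/
inductive Protocol.St (P : Protocol)
  | ready (m : P.Mem)
  | busy (m : P.Mem) (x : ℕ) (obs : List (Obs P.Msg))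
  | done (o : Output)

/-- The state after receiving `obs` in an epoch. -/
def Protocol.next (P : Protocol) (m : P.Mem) (x : ℕ) (obs : List (Obs P.Msg)) : P.St :=
  if obs.length < P.len m then .busy m x obs
  else match P.fin m x obs with
    | .inl m' => .ready m'
    | .inr o => .done o

/-- The algorithm given by a protocol. -/
noncomputable def Protocol.alg (P : Protocol) : Algorithm where
  State := P.St
  Msg := P.Msg
  start := .ready P.start
  output
    | .done o => some o
    | _ => none
  act
    | .ready m => (unif (P.size m)).map fun x => (P.act m x [], .busy m x [])
    | .busy m x obs => PMF.pure (P.act m x obs, .busy m x obs)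
    | .done o => PMF.pure (.idle, .done o)
  update
    | .busy m x obs, fb => P.next m x (obs ++ [fb])
    | s, _ => s

variable {P : Protocol} {n : ℕ}

/-- What the devices have received after `t` slots in which they performed the actions `a`. -/
def obsOf {M : Type} (cd : CDModel) (a : ℕ → Fin n → Action M) (t : ℕ) (v : Fin n) :
    List (Obs M) :=
  (List.range t).map fun s => feedback (channel (a s)) cd (a s v)

/-- `a` are the actions of devices with memories `m` and draws `x` in an epoch of `L` slots. -/
def Consistent (P : Protocol) (cd : CDModel) (m : Fin n → P.Mem) (x : Fin n → ℕ) (L : ℕ)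
    (a : ℕ → Fin n → Action P.Msg) : Prop :=
  ∀ t < L, ∀ v, P.act (m v) (x v) (obsOf cd a t v) = a t v

/-- The devices after the first `t` slots of an epoch. -/
def midDev (P : Protocol) (cd : CDModel) (m : Fin n → P.Mem) (x : Fin n → ℕ)
    (a : ℕ → Fin n → Action P.Msg) (D : Fin n → Device P.alg) (t : ℕ) :
    Fin n → Device P.alg := fun v =>
  { state := P.next (m v) (x v) (obsOf cd a t v)
    elapsed := (D v).elapsed + t
    energy := (D v).energy + ∑ s ∈ range t, (a s v).cost
    lastAction := a (t - 1) v }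

theorem midDev_state_of_inl {cd : CDModel} {m : Fin n → P.Mem} {x : Fin n → ℕ}
    {a : ℕ → Fin n → Action P.Msg} {D : Fin n → Device P.alg} {L : ℕ} {v : Fin n} {m' : P.Mem}
    (hL : P.len (m v) ≤ L) (h : P.fin (m v) (x v) (obsOf cd a L v) = .inl m') :
    (midDev P cd m x a D L v).state = (.ready m' : P.St) := by
  change P.next (m v) (x v) (obsOf cd a L v) = _
  rw [Protocol.next, if_neg, h]
  simpa [obsOf] using hL

theorem midDev_state_of_inr {cd : CDModel} {m : Fin n → P.Mem} {x : Fin n → ℕ}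
    {a : ℕ → Fin n → Action P.Msg} {D : Fin n → Device P.alg} {L : ℕ} {v : Fin n} {o : Output}
    (hL : P.len (m v) ≤ L) (h : P.fin (m v) (x v) (obsOf cd a L v) = .inr o) :
    (midDev P cd m x a D L v).state = (.done o : P.St) := by
  change P.next (m v) (x v) (obsOf cd a L v) = _
  rw [Protocol.next, if_neg, h]
  simpa [obsOf] using hL

/-- The canonical trace of an epoch. -/
def traceOf (P : Protocol) (cd : CDModel) (m : Fin n → P.Mem) (x : Fin n → ℕ) :
    ℕ → Fin n → List (Obs P.Msg)
  | 0 => fun _ => []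
  | t + 1 => fun v => traceOf P cd m x t v ++
      [feedback (channel fun w => P.act (m w) (x w) (traceOf P cd m x t w)) cd
        (P.act (m v) (x v) (traceOf P cd m x t v))]

/-- The canonical actions of an epoch. -/
def actsOf (P : Protocol) (cd : CDModel) (m : Fin n → P.Mem) (x : Fin n → ℕ)
    (t : ℕ) (v : Fin n) : Action P.Msg := P.act (m v) (x v) (traceOf P cd m x t v)

theorem obsOf_succ {M : Type} (cd : CDModel) (a : ℕ → Fin n → Action M) (t : ℕ) (v : Fin n) :
    obsOf cd a (t + 1) v = obsOf cd a t v ++ [feedback (channel (a t)) cd (a t v)] := by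
  simp [obsOf, List.range_succ]

theorem length_obsOf {M : Type} (cd : CDModel) (a : ℕ → Fin n → Action M) (t : ℕ) (v : Fin n) :
    (obsOf cd a t v).length = t := by simp [obsOf]

theorem obsOf_actsOf (cd : CDModel) (m : Fin n → P.Mem) (x : Fin n → ℕ) (t : ℕ) :
    obsOf cd (actsOf P cd m x) t = traceOf P cd m x t := by
  induction t with
  | zero => rfl
  | succ t ih =>
    funext v
    rw [obsOf_succ, ih]
    rfl

/-- Actions and observations determine each other slot by slot, so an epoch has only one consistent
history. An analysis may thus supply its own closed form of the actions and merely check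
`Consistent`. -/
theorem Consistent.eq_actsOf {cd : CDModel} {m : Fin n → P.Mem} {x : Fin n → ℕ} {L : ℕ}
    {a : ℕ → Fin n → Action P.Msg} (h : Consistent P cd m x L a) :
    ∀ t ≤ L, obsOf cd a t = traceOf P cd m x t ∧ ∀ s < t, a s = actsOf P cd m x s := by
  intro t
  induction t with
  | zero => intro _; exact ⟨rfl, by simp⟩
  | succ t ih =>
    intro ht
    obtain ⟨h1, h2⟩ := ih (by omega)
    have h3 : a t = actsOf P cd m x t := by
      funext v
      rw [← h t (by omega) v, h1]
      rfl
    refine ⟨?_, ?_⟩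
    · funext v
      rw [obsOf_succ, h1, h3]
      rfl
    · intro s hs
      rcases Nat.lt_succ_iff_lt_or_eq.1 hs with hs | rfl
      · exact h2 s hs
      · exact h3

/-- Positivity of `L` matters because `lastAction` reads slot `L - 1`, about which consistency says
nothing when `L = 0`. -/
theorem Consistent.midDev_eq {cd : CDModel} {m : Fin n → P.Mem} {x : Fin n → ℕ} {L : ℕ}
    {a : ℕ → Fin n → Action P.Msg} (h : Consistent P cd m x L a) (hL : 0 < L)
    (D : Fin n → Device P.alg) :
    midDev P cd m x (actsOf P cd m x) D L = midDev P cd m x a D L := by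
  obtain ⟨h1, h2⟩ := h.eq_actsOf L le_rfl
  funext v
  simp only [midDev]
  rw [h1, obsOf_actsOf, h2 (L - 1) (by omega)]
  congr 2
  exact Finset.sum_congr rfl fun s hs => by rw [h2 s (Finset.mem_range.1 hs)]

theorem draw_ready (d : Device P.alg) {m : P.Mem} (h : d.state = .ready m) :
    d.draw = (unif (P.size m)).map fun x => (P.act m x [], (.busy m x [] : P.St)) := by
  rw [Device.draw, h]
  rfl

theorem draw_busy (d : Device P.alg) {m : P.Mem} {x : ℕ} {obs : List (Obs P.Msg)}
    (h : d.state = .busy m x obs) :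
    d.draw = PMF.pure (P.act m x obs, (.busy m x obs : P.St)) := by
  rw [Device.draw, h]
  rfl

theorem advance_ready (cd : CDModel) (s : Signal P.Msg) (d : Device P.alg) {m : P.Mem}
    (h : d.state = .ready m) (x : ℕ) (b : Action P.Msg) :
    d.advance cd s (b, (.busy m x [] : P.St)) =
      ⟨P.next m x [feedback s cd b], d.elapsed + 1, d.energy + b.cost, b⟩ := by
  obtain ⟨q, e, en, l⟩ := d
  obtain rfl : q = _ := h
  rfl

theorem advance_busy (cd : CDModel) (s : Signal P.Msg) (d : Device P.alg) {m : P.Mem} {x : ℕ}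
    {obs : List (Obs P.Msg)} (h : d.state = .busy m x obs) (b : Action P.Msg) :
    d.advance cd s (b, (.busy m x obs : P.St)) =
      ⟨P.next m x (obs ++ [feedback s cd b]), d.elapsed + 1, d.energy + b.cost, b⟩ := by
  obtain ⟨q, e, en, l⟩ := d
  obtain rfl : q = _ := h
  rfl

theorem slot_ready (cd : CDModel) (m : Fin n → P.Mem) (D : Fin n → Device P.alg)
    (hD : ∀ v, (D v).state = .ready (m v)) :
    slot P.alg cd D = (indep fun v => unif (P.size (m v))).map fun x =>
      midDev P cd m x (actsOf P cd m x) D 1 := by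
  rw [slot_of_draw_map cd D _ _ fun v => draw_ready (D v) (hD v)]
  congr 1
  funext x v
  exact (advance_ready cd _ (D v) (hD v) _ _).trans (by
    simp [midDev, obsOf, actsOf, traceOf]
    rfl)

theorem slot_midDev (cd : CDModel) (m : Fin n → P.Mem) (x : Fin n → ℕ)
    (D : Fin n → Device P.alg) (t : ℕ) (ht : ∀ v, t < P.len (m v)) :
    slot P.alg cd (midDev P cd m x (actsOf P cd m x) D t) =
      PMF.pure (midDev P cd m x (actsOf P cd m x) D (t + 1)) := by
  have hn : ∀ v, (midDev P cd m x (actsOf P cd m x) D t v).state =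
      (.busy (m v) (x v) (traceOf P cd m x t v) : P.St) := by
    intro v
    change P.next _ _ _ = _
    rw [Protocol.next, if_pos, obsOf_actsOf]
    rw [length_obsOf]
    exact ht v
  rw [slot_of_draw_pure cd _ _ fun v => draw_busy _ (hn v)]
  congr 1
  funext v
  refine (advance_busy cd _ _ (hn v) _).trans ?_
  simp only [midDev, obsOf_actsOf, Finset.sum_range_succ, add_assoc, Nat.add_sub_cancel]
  rfl

theorem evolve_midDev (cd : CDModel) (m : Fin n → P.Mem) (x : Fin n → ℕ)
    (D : Fin n → Device P.alg) (L : ℕ) (hL : ∀ v, P.len (m v) = L) (T k t : ℕ) (h : t + k = L) :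
    evolve P.alg cd (midDev P cd m x (actsOf P cd m x) D t) (k + T) =
      evolve P.alg cd (midDev P cd m x (actsOf P cd m x) D L) T := by
  induction k generalizing t with
  | zero =>
    have : t = L := by omega
    subst this
    simp
  | succ k ih =>
    rw [show k + 1 + T = (k + T) + 1 by ring, evolve_succ', slot_midDev _ _ _ _ _
      (fun v => by rw [hL]; omega), PMF.pure_bind]
    exact ih (t + 1) (by omega)

/-- All randomness of an epoch is drawn in its first slot; the remaining slots are deterministic and
collapse to `midDev`. -/
theorem evolve_epoch (cd : CDModel) (m : Fin n → P.Mem) (D : Fin n → Device P.alg)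
    (hD : ∀ v, (D v).state = .ready (m v)) (L : ℕ) (hL : ∀ v, P.len (m v) = L) (hL0 : 0 < L)
    (T : ℕ) :
    evolve P.alg cd D (L + T) = (indep fun v => unif (P.size (m v))).bind fun x =>
      evolve P.alg cd (midDev P cd m x (actsOf P cd m x) D L) T := by
  obtain ⟨k, rfl⟩ : ∃ k, L = k + 1 := ⟨L - 1, by omega⟩
  rw [show k + 1 + T = (k + T) + 1 by ring, evolve_succ', slot_ready cd m D hD, PMF.bind_map]
  congr 1
  funext x
  exact evolve_midDev cd m x D (k + 1) hL T k 1 (by omega)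

/-- From the configuration `D`, the configuration after `T` slots is outside `G` with probability
at most `ε`. -/
def FailLE (P : Protocol) (cd : CDModel) (G : Set (Fin n → Device P.alg))
    (D : Fin n → Device P.alg) (T : ℕ) (ε : ℝ) : Prop :=
  (evolve P.alg cd D T).toOuterMeasure Gᶜ ≤ ENNReal.ofReal ε

theorem FailLE.mono {cd : CDModel} {G : Set (Fin n → Device P.alg)} {D : Fin n → Device P.alg}
    {T : ℕ} {ε ε' : ℝ} (h : FailLE P cd G D T ε) (hε : ε ≤ ε') : FailLE P cd G D T ε' :=
  le_trans h (ENNReal.ofReal_le_ofReal hε)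

theorem toOuterMeasure_le_one {α : Type} (p : PMF α) (s : Set α) :
    p.toOuterMeasure s ≤ 1 := by
  rw [PMF.toOuterMeasure_apply, ← p.tsum_coe]
  exact ENNReal.tsum_le_tsum fun a => Set.indicator_le_self _ _ _

/-- This trivial bound is what allows potentials to be analysed only where they are below `1`. -/
theorem FailLE.of_one_le {cd : CDModel} {G : Set (Fin n → Device P.alg)}
    {D : Fin n → Device P.alg} {T : ℕ} {ε : ℝ} (h : 1 ≤ ε) : FailLE P cd G D T ε :=
  (toOuterMeasure_le_one _ _).trans (by simpa using ENNReal.ofReal_le_ofReal h)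

theorem FailLE.of_done {cd : CDModel} {G : Set (Fin n → Device P.alg)}
    {D : Fin n → Device P.alg} {T : ℕ} {ε : ℝ}
    (h : ∀ v, ∃ o, (D v).state = .done o) (hG : D ∈ G) : FailLE P cd G D T ε := by
  rw [FailLE, evolve_terminated]
  · rw [PMF.toOuterMeasure_pure_apply, if_neg (by simpa using hG)]
    exact zero_le
  · intro v
    obtain ⟨o, ho⟩ := h v
    exact ⟨o, by rw [ho]; rfl⟩

/-- The law of total probability over the draws of one epoch; every probabilistic step of the
protocol goes through it. -/
theorem FailLE.epoch {cd : CDModel} {G : Set (Fin n → Device P.alg)} {D : Fin n → Device P.alg}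
    {T : ℕ} (m : Fin n → P.Mem) (hD : ∀ v, (D v).state = .ready (m v)) {L : ℕ}
    (hL : ∀ v, P.len (m v) = L) (hL0 : 0 < L) (hsize : ∀ v, 0 < P.size (m v)) (hT : L ≤ T)
    (f : (Fin n → ℕ) → ℝ) (hf0 : ∀ x ∈ box (fun v => P.size (m v)), 0 ≤ f x)
    (a : (Fin n → ℕ) → ℕ → Fin n → Action P.Msg)
    (ha : ∀ x ∈ box (fun v => P.size (m v)), Consistent P cd m x L (a x))
    (h : ∀ x ∈ box (fun v => P.size (m v)), FailLE P cd G (midDev P cd m x (a x) D L) (T - L) (f x)) :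
    FailLE P cd G D T (avg (fun v => P.size (m v)) f) := by
  obtain ⟨T', rfl⟩ := Nat.exists_eq_add_of_le hT
  rw [FailLE, evolve_epoch cd m D hD L hL hL0, PMF.toOuterMeasure_bind_apply]
  refine tsum_indep_unif _ hsize _ f (fun x hx => ?_) hf0
  have := h x hx
  rw [Nat.add_sub_cancel_left] at this
  rw [(ha x hx).midDev_eq hL0 D]
  exact this

theorem successProb_ge {C : ℝ} {T E : ℕ} {cd : CDModel} {ε : ℝ}
    (h : FailLE P cd {D : Fin n → Device P.alg | SolvesCounting C D ∧ SolvesLeaderElection D ∧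
      ∀ v, (D v).energy ≤ E} (fun _ => ⟨.ready P.start, 0, 0, .idle⟩) T ε) (hε : 0 ≤ ε) :
    1 - ε ≤ successProb P.alg cd C n T E := by
  rw [successProb, run_eq_evolve]
  rw [FailLE] at h
  change _ ≤ (PMF.toOuterMeasure (evolve P.alg cd (fun _ => ⟨.ready P.start, 0, 0, .idle⟩) T)
    _).toReal
  set p := evolve P.alg cd (fun _ : Fin n => ⟨.ready P.start, 0, 0, .idle⟩) T
  set G := {D : Fin n → Device P.alg | SolvesCounting C D ∧ SolvesLeaderElection D ∧
      ∀ v, (D v).energy ≤ E}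
  have h1 : (1 : ENNReal) ≤ p.toOuterMeasure G + p.toOuterMeasure Gᶜ := by
    calc (1 : ENNReal) = p.toOuterMeasure (G ∪ Gᶜ) := by
          rw [Set.union_compl_self]
          symm
          rw [PMF.toOuterMeasure_apply_eq_one_iff]
          exact Set.subset_univ _
      _ ≤ _ := MeasureTheory.measure_union_le _ _
  have h2 : (1 : ENNReal) ≤ p.toOuterMeasure G + ENNReal.ofReal ε := h1.trans (by gcongr)
  have h3 := toOuterMeasure_le_one p G
  have h4 : p.toOuterMeasure G ≠ ⊤ := ne_top_of_le_ne_top (by simp) h3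
  have h5 := ENNReal.toReal_mono (by simp [h4]) h2
  rw [ENNReal.toReal_add h4 (by simp), ENNReal.toReal_ofReal hε] at h5
  simp only [ENNReal.toReal_one] at h5
  linarith

theorem prod_pos_of_pos {ι : Type} [Fintype ι] {N : ι → ℕ} (hN : ∀ v, 0 < N v) :
    (0 : ℝ) < ∏ v, (N v : ℝ) :=
  Finset.prod_pos fun v _ => by exact_mod_cast hN v

/-! ### Averages over boxes: linearity, independence, unique occurrences -/

section Average

variable {ι : Type} [Fintype ι] [DecidableEq ι] {N : ι → ℕ}

theorem mem_box {x : ι → ℕ} : x ∈ box N ↔ ∀ v, x v < N v := by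
  simp [box, Fintype.mem_piFinset]

theorem avg_add (f g : (ι → ℕ) → ℝ) : avg N (fun x => f x + g x) = avg N f + avg N g := by
  simp only [avg, Finset.sum_add_distrib, add_div]

theorem avg_sum {κ : Type} (s : Finset κ) (f : κ → (ι → ℕ) → ℝ) :
    avg N (fun x => ∑ i ∈ s, f i x) = ∑ i ∈ s, avg N (f i) := by
  simp only [avg]
  rw [Finset.sum_comm, Finset.sum_div]

theorem avg_mul_left (c : ℝ) (f : (ι → ℕ) → ℝ) : avg N (fun x => c * f x) = c * avg N f := by
  simp only [avg, ← Finset.mul_sum, mul_div_assoc]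

theorem avg_mono {f g : (ι → ℕ) → ℝ} (h : ∀ x ∈ box N, f x ≤ g x) : avg N f ≤ avg N g := by
  simp only [avg]
  gcongr with x hx
  exact h x hx

theorem avg_congr {f g : (ι → ℕ) → ℝ} (h : ∀ x ∈ box N, f x = g x) : avg N f = avg N g := by
  simp only [avg]
  rw [Finset.sum_congr rfl h]

theorem avg_const (hN : ∀ v, 0 < N v) (c : ℝ) : avg N (fun _ => c) = c := by
  have h := prod_pos_of_pos hN
  simp only [avg, Finset.sum_const, box, Fintype.card_piFinset, card_range, nsmul_eq_mul]
  push_cast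
  field_simp

theorem avg_nonneg {f : (ι → ℕ) → ℝ} (h : ∀ x ∈ box N, 0 ≤ f x) : 0 ≤ avg N f :=
  div_nonneg (Finset.sum_nonneg h) (Finset.prod_nonneg fun _ _ => by positivity)

theorem avg_prod (f : ι → ℕ → ℝ) :
    avg N (fun x => ∏ v, f v (x v)) = ∏ v, ((∑ k ∈ range (N v), f v k) / N v) := by
  rw [avg, Finset.prod_div_distrib, Finset.prod_univ_sum]
  rfl

/-- Functions of disjoint sets of coordinates are independent. -/
theorem avg_mul_of_disjoint (hN : ∀ v, 0 < N v) (S : Finset ι) (F G : (ι → ℕ) → ℝ)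
    (hF : ∀ x y : ι → ℕ, (∀ v ∈ S, x v = y v) → F x = F y)
    (hG : ∀ x y : ι → ℕ, (∀ v ∉ S, x v = y v) → G x = G y) :
    avg N (fun x => F x * G x) = avg N F * avg N G := by
  have hP := prod_pos_of_pos hN
  have key : (∑ x ∈ box N, F x) * (∑ y ∈ box N, G y) =
      (∏ v, (N v : ℝ)) * ∑ x ∈ box N, F x * G x := by
    have hc : (∏ v, (N v : ℝ)) = ((box N).card : ℝ) := by
      simp [box, Fintype.card_piFinset]
    rw [hc, ← nsmul_eq_mul, ← Finset.sum_const, Finset.sum_mul_sum, Finset.sum_comm,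
      ← Finset.sum_product', ← Finset.sum_product']
    -- The bijection exchanges the coordinates in `S` between the two points and is its own inverse.
    -- `F` sees only these coordinates and `G` only the others.
    refine Finset.sum_nbij' (fun p => (S.piecewise p.1 p.2, S.piecewise p.2 p.1))
      (fun p => (S.piecewise p.1 p.2, S.piecewise p.2 p.1)) ?_ ?_ ?_ ?_ ?_
    · rintro ⟨x, y⟩ h
      simp only [Finset.mem_product, mem_box] at h ⊢
      constructor <;> intro v <;> by_cases hv : v ∈ S <;> simp [hv, h.1 v, h.2 v]
    · rintro ⟨x, y⟩ h
      simp only [Finset.mem_product, mem_box] at h ⊢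
      constructor <;> intro v <;> by_cases hv : v ∈ S <;> simp [hv, h.1 v, h.2 v]
    · rintro ⟨x, y⟩ _
      ext v <;> by_cases hv : v ∈ S <;> simp [hv]
    · rintro ⟨x, y⟩ _
      ext v <;> by_cases hv : v ∈ S <;> simp [hv]
    · rintro ⟨x, y⟩ _
      simp only
      rw [hF y (S.piecewise y x) fun v hv => by simp [hv],
        hG x (S.piecewise y x) fun v hv => by simp [hv]]
      
  simp only [avg]
  rw [div_mul_div_comm, key]
  field_simp

theorem avg_prod_of_disjoint {κ : Type} [DecidableEq κ] (hN : ∀ v, 0 < N v) (A : Finset κ)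
    (S : κ → Finset ι) (hS : ∀ i ∈ A, ∀ j ∈ A, i ≠ j → Disjoint (S i) (S j))
    (F : κ → (ι → ℕ) → ℝ)
    (hF : ∀ i ∈ A, ∀ x y : ι → ℕ, (∀ v ∈ S i, x v = y v) → F i x = F i y) :
    avg N (fun x => ∏ i ∈ A, F i x) = ∏ i ∈ A, avg N (F i) := by
  induction A using Finset.induction_on with
  | empty => simpa using avg_const hN 1
  | insert a A ha ih =>
    simp only [Finset.prod_insert ha]
    rw [avg_mul_of_disjoint hN (S a) (F a) _ (hF a (by simp)), ih]
    · exact fun i hi j hj => hS i (by simp [hi]) j (by simp [hj])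
    · exact fun i hi => hF i (by simp [hi])
    · intro x y h
      refine Finset.prod_congr rfl fun i hi => hF i (by simp [hi]) x y fun v hv => h v ?_
      have hd := hS a (by simp) i (by simp [hi]) (by rintro rfl; exact ha hi)
      exact fun hva => Finset.disjoint_left.1 hd hva hv

open Classical in
/-- The probability that exactly one coordinate in `S` lies in `A`, and that this one lies in
`B ⊆ A`. -/
theorem avg_unique (hN : ∀ v, 0 < N v) (S : Finset ι) {M : ℕ} (hM : ∀ v ∈ S, N v = M)
    (B A : Finset ℕ) (hBA : B ⊆ A) (hA : A ⊆ range M) :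
    avg N (fun x => if ∃ v ∈ S, x v ∈ B ∧ ∀ u ∈ S, u ≠ v → x u ∉ A then 1 else 0) =
      S.card * ((B.card / M : ℝ) * (1 - A.card / M : ℝ) ^ (S.card - 1)) := by
  -- Since `B ⊆ A`, at most one `v` can be the witness. The indicator is therefore a sum over `v` of
  -- products of one-coordinate factors, to which `avg_prod` applies.
  have h1 : ∀ x : ι → ℕ, (if ∃ v ∈ S, x v ∈ B ∧ ∀ u ∈ S, u ≠ v → x u ∉ A then (1 : ℝ) else 0) =
      ∑ v ∈ S, ∏ u, (if u = v then (if x u ∈ B then 1 else 0)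
        else if u ∈ S then (if x u ∈ A then 0 else 1) else 1) := by
    intro x
    have hz : ∀ v ∈ S, ¬ (x v ∈ B ∧ ∀ u ∈ S, u ≠ v → x u ∉ A) →
        ∏ u, (if u = v then (if x u ∈ B then (1 : ℝ) else 0)
        else if u ∈ S then (if x u ∈ A then 0 else 1) else 1) = 0 := by
      intro v _ h
      by_cases hv : x v ∈ B
      · simp only [hv, true_and] at h
        push Not at h
        obtain ⟨u, hu, huv, hua⟩ := h
        exact Finset.prod_eq_zero (Finset.mem_univ u) (by simp [huv, hu, hua])
      · exact Finset.prod_eq_zero (Finset.mem_univ v) (by simp [hv])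
    split_ifs with h
    · obtain ⟨v, hv, hvB, hu⟩ := h
      rw [Finset.sum_eq_single_of_mem v hv]
      · symm
        refine Finset.prod_eq_one fun u _ => ?_
        by_cases huv : u = v
        · subst huv; simp [hvB]
        · by_cases huS : u ∈ S
          · simp [huv, huS, hu u huS huv]
          · simp [huv, huS]
      · intro w hw hwv
        refine hz w hw fun hc => ?_
        exact hc.2 v hv (Ne.symm hwv) (hBA hvB)
    · symm
      refine Finset.sum_eq_zero fun v hv => hz v hv fun hc => h ⟨v, hv, hc.1, hc.2⟩
  simp only [h1]
  rw [avg_sum, ← nsmul_eq_mul, ← Finset.sum_const]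
  refine Finset.sum_congr rfl fun v hv => ?_
  rw [avg_prod (fun u k => if u = v then (if k ∈ B then (1 : ℝ) else 0)
        else if u ∈ S then (if k ∈ A then 0 else 1) else 1)]
  have hM0 : (0 : ℝ) < M := by
    have := hN v
    rw [hM v hv] at this
    exact_mod_cast this
  have hcard : ∀ C : Finset ℕ, C ⊆ range M →
      (∑ k ∈ range M, if k ∈ C then (1 : ℝ) else 0) = C.card := by
    intro C hC
    rw [Finset.sum_ite_mem, Finset.inter_eq_right.2 hC]
    simp
  have hcard' : (∑ k ∈ range M, if k ∈ A then (0 : ℝ) else 1) = M - A.card := by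
    have : ∀ k, (if k ∈ A then (0 : ℝ) else 1) = 1 - if k ∈ A then 1 else 0 := by
      intro k; split_ifs <;> simp
    simp only [this, Finset.sum_sub_distrib, hcard A hA]
    simp
  have h2 : ∀ u, (∑ k ∈ range (N u), (if u = v then (if k ∈ B then (1 : ℝ) else 0)
        else if u ∈ S then (if k ∈ A then 0 else 1) else 1)) / N u =
      if u = v then (B.card / M : ℝ) else if u ∈ S then (1 - A.card / M : ℝ) else 1 := by
    intro u
    by_cases huv : u = v
    · subst huv
      simp only [if_true, hM u hv]
      rw [hcard B (hBA.trans hA)]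
    · by_cases huS : u ∈ S
      · simp only [huv, huS, if_true, if_false, hM u huS]
        rw [hcard', sub_div, div_self hM0.ne']
      · simp only [huv, huS, if_false]
        have := hN u
        simp only [Finset.sum_const, card_range, nsmul_eq_mul, mul_one]
        exact div_self (by exact_mod_cast this.ne')
  simp only [h2]
  rw [← Finset.mul_prod_erase _ _ (Finset.mem_univ v), if_pos rfl]
  congr 1
  rw [← Finset.card_erase_of_mem hv, ← Finset.prod_const]
  rw [← Finset.prod_subset (s₁ := S.erase v) (s₂ := univ.erase v)]
  · refine Finset.prod_congr rfl fun u hu => ?_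
    simp [(Finset.mem_erase.1 hu).1, (Finset.mem_erase.1 hu).2]
  · exact Finset.erase_subset_erase _ (Finset.subset_univ _)
  · intro u hu hu'
    simp only [Finset.mem_erase, Finset.mem_univ, and_true] at hu hu'
    simp [hu, show u ∉ S from fun h => hu' ⟨hu, h⟩]

open Classical in
/-- The probability that exactly one coordinate is `0` and exactly one is `1`. -/
theorem avg_unique_pair {M : ℕ} (hM : 2 ≤ M) :
    avg (fun _ : ι => M) (fun x => if ∃ u v, u ≠ v ∧ x u = 0 ∧ x v = 1 ∧
        ∀ w, w ≠ u → w ≠ v → 2 ≤ x w then 1 else 0) =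
      (Fintype.card ι : ℝ) * (Fintype.card ι - 1) *
        ((1 / M : ℝ) ^ 2 * (1 - 2 / M : ℝ) ^ (Fintype.card ι - 2)) := by
  have h1 : ∀ x : ι → ℕ, (if ∃ u v, u ≠ v ∧ x u = 0 ∧ x v = 1 ∧
        ∀ w, w ≠ u → w ≠ v → 2 ≤ x w then (1 : ℝ) else 0) =
      ∑ p ∈ (univ : Finset ι).offDiag, ∏ w, (if w = p.1 then (if x w = 0 then 1 else 0)
        else if w = p.2 then (if x w = 1 then 1 else 0) else if 2 ≤ x w then 1 else 0) := by
    intro x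
    have hz : ∀ p ∈ (univ : Finset ι).offDiag, ¬ (x p.1 = 0 ∧ x p.2 = 1 ∧
        ∀ w, w ≠ p.1 → w ≠ p.2 → 2 ≤ x w) →
        ∏ w, (if w = p.1 then (if x w = 0 then (1 : ℝ) else 0)
        else if w = p.2 then (if x w = 1 then 1 else 0) else if 2 ≤ x w then 1 else 0) = 0 := by
      rintro ⟨u, v⟩ hp h
      simp only [mem_offDiag, mem_univ, true_and] at hp h ⊢
      by_cases hu : x u = 0
      · by_cases hv : x v = 1
        · simp only [hu, hv, true_and] at h
          push Not at h
          obtain ⟨w, hw1, hw2, hw3⟩ := h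
          exact Finset.prod_eq_zero (Finset.mem_univ w) (by simp [hw1, hw2, hw3])
        · exact Finset.prod_eq_zero (Finset.mem_univ v) (by simp [hv, Ne.symm hp])
      · exact Finset.prod_eq_zero (Finset.mem_univ u) (by simp [hu])
    split_ifs with h
    · obtain ⟨u, v, huv, hu, hv, hw⟩ := h
      rw [Finset.sum_eq_single_of_mem (u, v) (by simp [huv])]
      · symm
        refine Finset.prod_eq_one fun w _ => ?_
        by_cases hwu : w = u
        · subst hwu; simp [hu]
        · by_cases hwv : w = v
          · subst hwv; simp [hwu, hv]
          · simp [hwu, hwv, hw w hwu hwv]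
      · rintro ⟨u', v'⟩ hp hne
        refine hz _ hp fun hc => hne ?_
        simp only at hc
        have e1 : u = u' := by
          by_contra hh
          by_cases h2 : u = v'
          · subst h2; omega
          · have := hc.2.2 u hh h2; omega
        have e2 : v = v' := by
          by_contra hh
          by_cases h2 : v = u'
          · subst h2; omega
          · have := hc.2.2 v h2 hh; omega
        rw [e1, e2]
    · symm
      refine Finset.sum_eq_zero fun p hp => hz p hp fun hc => h ⟨p.1, p.2, ?_, hc⟩
      simpa using hp
  have hM0 : (0 : ℝ) < M := by exact_mod_cast (by omega : 0 < M)
  simp only [h1]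
  rw [avg_sum]
  have h3 : ∀ p ∈ (univ : Finset ι).offDiag,
      avg (fun _ : ι => M) (fun x => ∏ w, (if w = p.1 then (if x w = 0 then (1 : ℝ) else 0)
        else if w = p.2 then (if x w = 1 then 1 else 0) else if 2 ≤ x w then 1 else 0)) =
      (1 / M : ℝ) ^ 2 * (1 - 2 / M : ℝ) ^ (Fintype.card ι - 2) := by
    rintro ⟨u, v⟩ hp
    simp only [mem_offDiag, mem_univ, true_and] at hp
    rw [avg_prod (fun w k => if w = u then (if k = 0 then (1 : ℝ) else 0)
        else if w = v then (if k = 1 then 1 else 0) else if 2 ≤ k then 1 else 0)]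
    have hs : ∀ w, (∑ k ∈ range M, (if w = u then (if k = 0 then (1 : ℝ) else 0)
        else if w = v then (if k = 1 then 1 else 0) else if 2 ≤ k then 1 else 0)) / M =
        if w = u then (1 / M : ℝ) else if w = v then (1 / M : ℝ) else (1 - 2 / M : ℝ) := by
      intro w
      by_cases hwu : w = u
      · simp only [hwu, if_true, Finset.sum_ite_eq', mem_range]
        rw [if_pos (by omega)]
      · by_cases hwv : w = v
        · subst hwv
          simp only [hwu, if_true, if_false, Finset.sum_ite_eq', mem_range]
          rw [if_pos (by omega)]
        · simp only [hwu, hwv, if_false]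
          obtain ⟨M', rfl⟩ := Nat.exists_eq_add_of_le hM
          rw [Finset.sum_range_add, Finset.sum_range_succ, Finset.sum_range_one]
          simp
          have h5 : (2 : ℝ) + M' ≠ 0 := by positivity
          field_simp
          try ring
    simp only [hs]
    rw [← Finset.mul_prod_erase _ _ (Finset.mem_univ u), if_pos rfl,
      ← Finset.mul_prod_erase _ _ (Finset.mem_erase.2 ⟨Ne.symm hp, Finset.mem_univ v⟩),
      if_neg (Ne.symm hp), if_pos rfl, sq, mul_assoc]
    congr 2
    rw [Finset.prod_congr rfl (g := fun _ => (1 - 2 / M : ℝ))]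
    · rw [Finset.prod_const, Finset.card_erase_of_mem, Finset.card_erase_of_mem, Finset.card_univ]
      · rfl
      · simp
      · simp [Ne.symm hp]
    · intro w hw
      simp only [Finset.mem_erase] at hw
      simp [hw.1, hw.2.1]
  rw [Finset.sum_congr rfl h3, Finset.sum_const, Finset.offDiag_card, nsmul_eq_mul,
    Finset.card_univ, Nat.cast_sub (Nat.le_mul_self _)]
  push_cast
  ring

/-- Union bound. -/
theorem avg_exists_le {κ : Type} (s : Finset κ) (p : κ → (ι → ℕ) → Prop)
    [∀ x, Decidable (∃ i ∈ s, p i x)] [∀ i x, Decidable (p i x)] :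
    avg N (fun x => if ∃ i ∈ s, p i x then 1 else 0) ≤
      ∑ i ∈ s, avg N (fun x => if p i x then 1 else 0) := by
  rw [← avg_sum]
  refine avg_mono fun x _ => ?_
  split_ifs with h
  · obtain ⟨i, hi, hp⟩ := h
    refine le_trans ?_ (Finset.single_le_sum (fun j _ => ?_) hi)
    · simp [hp]
    · split_ifs <;> simp
  · exact Finset.sum_nonneg fun j _ => by split_ifs <;> simp

end Average

/-! ### The channel -/

section Channel

variable {M : Type} {n : ℕ}

/-- The message received in a slot, if any. -/
def heard : Obs M → Option M
  | some (.message m) => some m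
  | _ => none

/-- Whether something other than silence was received. -/
def nonsilent : Obs M → Bool
  | some .silence => false
  | some _ => true
  | none => false

/-- A listener receives messages identically in all four models, which differ for it only in the
treatment of noise. Trials and stages use nothing but messages, so their analysis is uniform in
`cd`. -/
theorem heard_feedback_listen (s : Signal M) (cd : CDModel) :
    heard (feedback s cd .listen) = heard (some s) := by
  cases cd <;> cases s <;> rfl

theorem filterMap_ofFn (a : Fin n → Action M) :
    (List.ofFn a).filterMap Action.sent = (List.finRange n).filterMap fun v => (a v).sent := by
  rw [List.ofFn_eq_map, List.filterMap_map]
  rfl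

theorem filterMap_finRange_eq_nil {a : Fin n → Action M} {l : List (Fin n)}
    (h : ∀ v ∈ l, (a v).sent = none) : l.filterMap (fun v => (a v).sent) = [] := by
  rwa [List.filterMap_eq_nil_iff]

theorem channel_of_unique {a : Fin n → Action M} {m : M} (v : Fin n) (hv : (a v).sent = some m)
    (h : ∀ u, u ≠ v → (a u).sent = none) : channel a = .message m := by
  obtain ⟨l₁, l₂, hl⟩ := List.append_of_mem (List.mem_finRange v)
  have hnd := List.nodup_finRange n
  rw [hl] at hnd
  have h1 : v ∉ l₁ := fun hc => by
    have := List.nodup_append.1 hnd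
    exact this.2.2 v hc v (by simp) rfl
  have h2 : v ∉ l₂ := (List.nodup_cons.1 (List.nodup_append.1 hnd).2.1).1
  rw [channel, filterMap_ofFn, hl, List.filterMap_append, List.filterMap_cons, hv,
    filterMap_finRange_eq_nil (l := l₁) fun u hu => h u (by rintro rfl; exact h1 hu),
    filterMap_finRange_eq_nil (l := l₂) fun u hu => h u (by rintro rfl; exact h2 hu)]
  rfl

theorem channel_of_silence {a : Fin n → Action M} (h : ∀ u, (a u).sent = none) :
    channel a = .silence := by
  rw [channel, filterMap_ofFn, filterMap_finRange_eq_nil fun u _ => h u]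

theorem channel_of_two {a : Fin n → Action M} {u v : Fin n} (huv : u ≠ v)
    (hu : (a u).sent ≠ none) (hv : (a v).sent ≠ none) : channel a = .noise := by
  rw [channel, filterMap_ofFn]
  obtain ⟨l₁, l₂, hl⟩ := List.append_of_mem (List.mem_finRange v)
  obtain ⟨mv, hmv⟩ := Option.ne_none_iff_exists'.1 hv
  obtain ⟨mu, hmu⟩ := Option.ne_none_iff_exists'.1 hu
  have hmem : u ∈ l₁ ∨ u ∈ l₂ := by
    have := List.mem_finRange u
    rw [hl] at this
    simp only [List.mem_append, List.mem_cons] at this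
    tauto
  have hlen : 2 ≤ ((List.finRange n).filterMap fun v => (a v).sent).length := by
    rw [hl, List.filterMap_append, List.filterMap_cons, hmv]
    simp only [List.length_append, List.length_cons]
    rcases hmem with h | h
    · have : 0 < (l₁.filterMap fun v => (a v).sent).length :=
        List.length_pos_of_mem (List.mem_filterMap.2 ⟨u, h, hmu⟩)
      omega
    · have : 0 < (l₂.filterMap fun v => (a v).sent).length :=
        List.length_pos_of_mem (List.mem_filterMap.2 ⟨u, h, hmu⟩)
      omega
  revert hlen
  generalize ((List.finRange n).filterMap fun v => (a v).sent) = l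
  intro hlen
  match l, hlen with
  | _ :: _ :: _, _ => rfl

open Classical in
theorem heard_channel {a : Fin n → Action M} {p : Fin n → Prop} {m : M}
    (h1 : ∀ v, p v → a v = .transmit m) (h2 : ∀ v, ¬ p v → (a v).sent = none) :
    heard (some (channel a)) = if ∃! v, p v then some m else none := by
  split_ifs with h
  · obtain ⟨v, hv, hu⟩ := h
    rw [channel_of_unique (m := m) v (by rw [h1 v hv]; rfl)
      fun u huv => h2 u fun hpu => huv (hu u hpu)]
    rfl
  · by_cases he : ∃ v, p v
    · obtain ⟨v, hv⟩ := he
      have : ∃ u, u ≠ v ∧ p u := by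
        by_contra hcon
        push Not at hcon
        exact h ⟨v, hv, fun u hu => by by_contra huv; exact hcon u huv hu⟩
      obtain ⟨u, huv, hu⟩ := this
      rw [channel_of_two huv (by rw [h1 u hu]; simp [Action.sent])
        (by rw [h1 v hv]; simp [Action.sent])]
      rfl
    · push Not at he
      rw [channel_of_silence fun u => h2 u (he u)]
      rfl

theorem channel_eq_silence_iff {a : Fin n → Action M} :
    channel a = .silence ↔ ∀ v, (a v).sent = none := by
  refine ⟨fun h v => ?_, channel_of_silence⟩
  by_contra hv
  obtain ⟨m, hm⟩ := Option.ne_none_iff_exists'.1 hv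
  by_cases hu : ∃ u, u ≠ v ∧ (a u).sent ≠ none
  · obtain ⟨u, huv, hu⟩ := hu
    rw [channel_of_two huv hu hv] at h
    simp at h
  · push Not at hu
    rw [channel_of_unique v hm hu] at h
    simp at h

theorem obsOf_getD (cd : CDModel) (a : ℕ → Fin n → Action M) {t s : ℕ} (h : s < t) (v : Fin n) :
    (obsOf cd a t v).getD s none = feedback (channel (a s)) cd (a s v) := by
  simp [obsOf, List.getD_eq_getElem?_getD, h]

theorem sum_cost_le (a : ℕ → Action M) (L : ℕ) (A : Finset ℕ) (h : ∀ t, t ∉ A → a t = .idle) :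
    ∑ t ∈ range L, (a t).cost ≤ A.card := by
  calc ∑ t ∈ range L, (a t).cost ≤ ∑ t ∈ range L, if t ∈ A then 1 else 0 := by
        refine Finset.sum_le_sum fun t _ => ?_
        split_ifs with ht
        · cases a t <;> simp [Action.cost]
        · rw [h t ht]; simp [Action.cost]
    _ = ((range L) ∩ A).card := by rw [Finset.sum_ite_mem]; simp
    _ ≤ A.card := Finset.card_le_card Finset.inter_subset_right

theorem sum_cost_le_length (a : ℕ → Action M) (L : ℕ) : ∑ t ∈ range L, (a t).cost ≤ L := by
  calc ∑ t ∈ range L, (a t).cost ≤ ∑ t ∈ range L, 1 :=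
        Finset.sum_le_sum fun t _ => by cases a t <;> simp [Action.cost]
    _ = L := by simp

end Channel

/-! ### The protocol -/

/-- The number of successes at a scale that makes an estimate acceptable. -/
def threshold (d : ℕ) : ℕ := d ^ 2

/-- The number of trials per scale while the network is assumed to be small. -/
def smallTrials (d : ℕ) : ℕ := 1024 * d ^ 2

/-- The number of counting rounds per scale. -/
def countRounds (d : ℕ) : ℕ := 128 * d ^ 2

/-- The number of independent attempts at a broadcast. -/
def attempts (d : ℕ) : ℕ := 8 * d ^ 2

/-- The number of slots of a broadcast. -/
def blockLen (d : ℕ) : ℕ := (d + 1) * attempts d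

/-- The number of rounds per scale. -/
def scaleRounds (d : ℕ) : ℕ := countRounds d + 256 * blockLen d * d ^ 2

/-- The number of rounds of a stage. -/
def numRounds (d : ℕ) : ℕ := (d + 1) * scaleRounds d

/-- The number of roles in a stage. -/
def numRoles (d : ℕ) : ℕ := numRounds d + numRounds d * blockLen d * attempts d

/-- A device is a candidate for leadership in one round, or it carries the public information from
one round to the next. -/
inductive Duty
  | cand (j : ℕ)
  | relay (j l w : ℕ)

/-- The role with a given number. -/
def decodeDuty (d r : ℕ) : Duty :=
  if r < numRounds d then .cand r
  else .relay ((r - numRounds d) / attempts d / blockLen d)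
    ((r - numRounds d) / attempts d % blockLen d) ((r - numRounds d) % attempts d)

/-- The memory of a device between epochs. -/
inductive Mem
  | solo
  | soloEnd (h : Bool)
  | small (j c : ℕ)
  | search (lo hi : ℕ)
  | pick (i : ℕ)
  | round (i j : ℕ) (r : Duty) (info : Option (Bool × ℕ)) (lead : Option ℕ)
  | announce (i : ℕ) (lead : Option ℕ)

/-- Messages: during a round, whether there was a single candidate, whether there is a leader, and
the number of successes at the current scale. -/
abbrev Msg := Bool × Bool × ℕ

/-- A message without content. -/
def beep : Action Msg := .transmit (false, false, 0)

/-- The message received in slot `s` of the epoch. -/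
def got (obs : List (Obs Msg)) (s : ℕ) : Option Msg := heard (obs.getD s none)

theorem got_obsOf {n : ℕ} {cd : CDModel} {a : ℕ → Fin n → Action Msg} {t s : ℕ} {v : Fin n}
    (h : s < t) (hl : a s v = .listen) :
    got (obsOf cd a t v) s = heard (some (channel (a s))) := by
  rw [got, obsOf_getD cd a h, hl, heard_feedback_listen]

/-- The next number to be tested in a doubling and binary search. -/
def probe (lo hi : ℕ) : ℕ := if hi = 0 then 2 * lo + 1 else (lo + hi) / 2

/-- The number of successes at the current scale after round `j`. -/
def newCount (d j : ℕ) (sg : Bool) (c : ℕ) : ℕ :=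
  (if j % scaleRounds d = 0 then 0 else c) +
    if sg = true ∧ j % scaleRounds d < countRounds d then 1 else 0

/-- Whether a candidate that received the given message becomes the leader. -/
def leads (d j : ℕ) : Option Msg → Bool
  | some (sg, f, c) => sg && !f &&
      decide (countRounds d ≤ j % scaleRounds d ∧ threshold d ≤ c)
  | none => false

/-- The actions in round `j`. -/
def roundAct (d j : ℕ) (r : Duty) (info : Option (Bool × ℕ)) (x : ℕ) (obs : List (Obs Msg)) :
    Action Msg :=
  match r, info with
  | .cand j', _ =>
    if j' = j ∧ x < blockLen d then
      if obs.length = 0 then beep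
      else if obs.length = blockLen d + 1 then
        if leads d j (got obs (1 + x)) then beep else .idle
      else if obs.length = 1 + x then .listen else .idle
    else .idle
  | .relay _ _ w, some (f, c) =>
    if obs.length = 0 then .listen
    else if x ≠ 0 ∧ Nat.log 2 x ≤ d ∧ obs.length = 1 + (Nat.log 2 x * attempts d + w) then
      .transmit ((got obs 0).isSome, f, newCount d j (got obs 0).isSome c)
    else .idle
  | .relay j' l _, none =>
    if j' = j + 1 then
      if obs.length = 1 + l then .listen
      else if obs.length = blockLen d + 1 ∧ (got obs (1 + l)).isSome then .listen
      else .idle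
    else .idle

/-- The leadership after round `j`. -/
def roundLead (d j : ℕ) (r : Duty) (lead : Option ℕ) (x : ℕ) (obs : List (Obs Msg)) : Option ℕ :=
  match r with
  | .cand j' =>
    if j' = j ∧ x < blockLen d ∧ leads d j (got obs (1 + x)) then some (d - j / scaleRounds d)
    else lead
  | _ => lead

/-- The information of a device after round `j`. -/
def roundInfo (d j : ℕ) (r : Duty) (obs : List (Obs Msg)) : Option (Bool × ℕ) :=
  match r with
  | .relay j' l _ =>
    if j' = j + 1 then
      (got obs (1 + l)).map fun q => (q.2.1 || (got obs (blockLen d + 1)).isSome, q.2.2)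
    else none
  | _ => none

/-- The next memory after round `j`. -/
def roundNext (d i j : ℕ) (r : Duty) (info : Option (Bool × ℕ)) (lead : Option ℕ) : Mem :=
  if j + 1 < numRounds d then .round i (j + 1) r info lead else .announce i lead

/-- The memory after the search for a small network. -/
def afterSmall : CDModel → Mem
  | .strongCD | .receiverCD => .search 0 0
  | _ => .pick 0

/-- Actions while the network is assumed to be small. -/
def smallAct (x : ℕ) (obs : List (Obs Msg)) : Action Msg :=
  if obs.length = 0 then
    if x = 0 then beep else if x = 1 then .listen else .idle
  else if obs.length = 1 then
    if x = 0 then .listen else if x = 1 ∧ (got obs 0).isSome then beep else .idle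
  else if x = 0 ∧ (got obs 1).isSome then beep else .listen

/-- The number of successes at the current scale before trial `j`. -/
def smallCount (d j c : ℕ) : ℕ := if j % smallTrials d = 0 then 0 else c

/-- The memory or output after trial `j`. -/
def smallFin (d : ℕ) (cd : CDModel) (j c x : ℕ) (obs : List (Obs Msg)) : Mem ⊕ Output :=
  if (x = 0 ∧ (got obs 1).isSome) ∨ (got obs 2).isSome then
    if threshold d ≤ smallCount d j c + 1 then
      .inr ⟨2 ^ (d - j / smallTrials d),
        if x = 0 ∧ (got obs 1).isSome then .leader else .follower⟩
    else if j + 1 < (d + 1) * smallTrials d then .inl (.small (j + 1) (smallCount d j c + 1))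
    else .inl (afterSmall cd)
  else if j + 1 < (d + 1) * smallTrials d then .inl (.small (j + 1) (smallCount d j c))
  else .inl (afterSmall cd)

/-- The number of possible draws of a device with the given memory. -/
def drawSize (d : ℕ → ℕ) (N : ℕ) (cd : CDModel) : Mem → ℕ
  | .solo => match cd with
    | .senderCD => 1
    | _ => N
  | .soloEnd _ => 1
  | .small j _ => 2 ^ (d 0 - j / smallTrials (d 0) + 3)
  | .search lo hi => 2 ^ d (probe lo hi)
  | .pick i => numRoles (d i)
  | .round i j (.cand j') _ _ =>
    if j' = j then 2 ^ (d i - j / scaleRounds (d i)) * blockLen (d i) else 1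
  | .round i _ (.relay _ _ _) info _ => if info.isSome then 2 ^ (d i + 2) else 1
  | .announce _ _ => 1

/-- The number of slots of the epoch of a device with the given memory. -/
def epochLen (d : ℕ → ℕ) (N : ℕ) (cd : CDModel) : Mem → ℕ
  | .solo => match cd with
    | .senderCD => 1
    | _ => N
  | .soloEnd _ => 1
  | .small _ _ => 3
  | .search _ _ => 1
  | .pick _ => 1
  | .round i _ _ _ _ => blockLen (d i) + 2
  | .announce _ _ => 1

/-- The action of a device with the given memory, draw, and observations. -/
def epochAct (d : ℕ → ℕ) (cd : CDModel) : Mem → ℕ → List (Obs Msg) → Action Msg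
  | .solo, x, obs => match cd with
    | .senderCD => beep
    | _ => if obs.length = x then beep else .listen
  | .soloEnd h, _, _ => if h then .idle else beep
  | .small _ _, x, obs => smallAct x obs
  | .search _ _, x, _ => if x = 0 then beep else .listen
  | .pick _, _, _ => .idle
  | .round i j r info _, x, obs => roundAct (d i) j r info x obs
  | .announce i (some k), _, _ => .transmit (false, false, numRoles (d i) * 2 ^ k)
  | .announce _ none, _, _ => .listen

/-- The memory or output of a device after an epoch. -/
def epochFin (d : ℕ → ℕ) (N : ℕ) (cd : CDModel) : Mem → ℕ → List (Obs Msg) → Mem ⊕ Output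
  | .solo, x, obs => match cd with
    | .senderCD => if (got obs 0).isSome then .inr ⟨1, .leader⟩ else .inl (.small 0 0)
    | _ => .inl (.soloEnd
      ((List.range N).any fun t => t != x && nonsilent (obs.getD t none)))
  | .soloEnd h, _, _ => if h then .inl (.small 0 0) else .inr ⟨1, .leader⟩
  | .small j c, x, obs => smallFin (d 0) cd j c x obs
  | .search lo hi, x, obs =>
    if x = 0 ∨ nonsilent (obs.getD 0 none) = true then
      if hi = probe lo hi + 1 then .inl (.pick (probe lo hi))
      else .inl (.search (probe lo hi) hi)
    else if probe lo hi = lo + 1 then .inl (.pick lo) else .inl (.search lo (probe lo hi))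
  | .pick i, x, _ => .inl (.round i 0 (decodeDuty (d i) x)
      (match decodeDuty (d i) x with
        | .relay 0 _ _ => some (false, 0)
        | _ => none) none)
  | .round i j r _ lead, x, obs =>
    .inl (roundNext (d i) i j r (roundInfo (d i) j r obs) (roundLead (d i) j r lead x obs))
  | .announce i (some k), _, _ => .inr ⟨numRoles (d i) * 2 ^ k, .leader⟩
  | .announce i none, _, obs => match got obs 0 with
    | some q => .inr ⟨q.2.2, .follower⟩
    | none => .inl (.pick (i + 1))

/-- The protocol with stage parameters `d 0, d 1, …`; `N` controls the test for a single device. -/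
def protocol (d : ℕ → ℕ) (N : ℕ) (cd : CDModel) : Protocol where
  Mem := Mem
  Msg := Msg
  start := match cd with
    | .noCD => .small 0 0
    | _ => .solo
  size := drawSize d N cd
  len := epochLen d N cd
  act := epochAct d cd
  fin := epochFin d N cd

/-! ### Epochs in which all devices share the same memory -/

section Common

variable {n : ℕ} {d : ℕ → ℕ} {N : ℕ} {cd : CDModel}

/-- The configurations in which all devices have memory `m` and spent at most `e` energy. -/
structure Conf (d : ℕ → ℕ) (N : ℕ) (cd : CDModel) (m : Mem) (e : ℕ)
    (D : Fin n → Device (protocol d N cd).alg) : Prop where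
  state : ∀ v, (D v).state = .ready m
  elapsed : ∀ v w, (D v).elapsed = (D w).elapsed
  energy : ∀ v, (D v).energy ≤ e

/-- The configurations in which both problems are solved, with energy at most `E`. -/
def goodSet (P : Protocol) (n : ℕ) (C : ℝ) (E : ℕ) : Set (Fin n → Device P.alg) :=
  {D | SolvesCounting C D ∧ SolvesLeaderElection D ∧ ∀ v, (D v).energy ≤ E}

/-- The outputs `o` with last actions `b` solve both problems. -/
def Solved (C : ℝ) (o : Fin n → Output) (b : Fin n → Action Msg) : Prop :=
  ∃ (k : ℕ) (l : Fin n), (∀ v, (o v).estimate = k) ∧ (n : ℝ) ≤ C * k ∧ (k : ℝ) ≤ C * n ∧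
    (o l).role = .leader ∧ (∃ q, b l = .transmit q) ∧
    ∀ v, v ≠ l → (o v).role = .follower ∧ b v = .listen

theorem fail_of_solved {m : Fin n → Mem} {x : Fin n → ℕ} {L E : ℕ} {C : ℝ}
    {D : Fin n → Device (protocol d N cd).alg} (hD : ∀ v w, (D v).elapsed = (D w).elapsed)
    (hL : ∀ v, epochLen d N cd (m v) = L) (a : ℕ → Fin n → Action Msg) (o : Fin n → Output)
    (hfin : ∀ v, epochFin d N cd (m v) (x v) (obsOf cd a L v) = .inr (o v))
    (hE : ∀ v, (D v).energy + ∑ s ∈ Finset.range L, (a s v).cost ≤ E)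
    (ho : Solved C o (a (L - 1))) (T : ℕ) (ε : ℝ) :
    FailLE (protocol d N cd) cd (goodSet (protocol d N cd) n C E)
      (midDev (protocol d N cd) cd m x a D L) T ε := by
  obtain ⟨k, l, h1, h2, h3, h4, h5, h6⟩ := ho
  have hs : ∀ v, (midDev (protocol d N cd) cd m x a D L v).state = .done (o v) := fun v =>
    midDev_state_of_inr (hL v).le (hfin v)
  refine FailLE.of_done (fun v => ⟨_, hs v⟩) ⟨⟨k, fun v => ⟨o v, ?_, h1 v⟩, h2, h3⟩,
    ⟨l, ⟨o l, ?_, h4⟩, h5, fun v hv => ⟨⟨o v, ?_, (h6 v hv).1⟩, (h6 v hv).2,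
      congrArg (· + L) (hD v l)⟩⟩, hE⟩ <;> rw [hs] <;> rfl

/-- Each outcome of the draws falls into one of three cases: the bound is vacuous, all devices pass
to a common memory, or all terminate with a correct solution. Energy is bounded crudely by the
length of the epoch, which is affordable outside the stages. -/
theorem Conf.fail_epoch {m : Mem} {e L M E T : ℕ} {C : ℝ}
    {D : Fin n → Device (protocol d N cd).alg} (h : Conf d N cd m e D)
    (hL : epochLen d N cd m = L) (hL0 : 0 < L) (hM : drawSize d N cd m = M) (hM0 : 0 < M)
    (hT : L ≤ T) (f : (Fin n → ℕ) → ℝ) (hf : ∀ x, (∀ v, x v < M) → 0 ≤ f x)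
    (a : (Fin n → ℕ) → ℕ → Fin n → Action Msg)
    (ha : ∀ x, (∀ v, x v < M) → ∀ t < L, ∀ v,
      epochAct d cd m (x v) (obsOf cd (a x) t v) = a x t v)
    (hx : ∀ x, (∀ v, x v < M) → 1 ≤ f x ∨
      (∃ m', (∀ v, epochFin d N cd m (x v) (obsOf cd (a x) L v) = .inl m') ∧
        ∀ D', Conf d N cd m' (e + L) D' →
          FailLE (protocol d N cd) cd (goodSet (protocol d N cd) n C E) D' (T - L) (f x)) ∨
      (∃ o : Fin n → Output, (∀ v, epochFin d N cd m (x v) (obsOf cd (a x) L v) = .inr (o v)) ∧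
        Solved C o (a x (L - 1)) ∧ e + L ≤ E)) :
    FailLE (protocol d N cd) cd (goodSet (protocol d N cd) n C E) D T (avg (fun _ => M) f) := by
  subst hM
  have hbox : ∀ x ∈ box (fun _ : Fin n => drawSize d N cd m), ∀ v, x v < drawSize d N cd m :=
    fun x hx => mem_box.1 hx
  refine FailLE.epoch (P := protocol d N cd) (fun _ => m) h.state (L := L) (fun _ => hL) hL0
    (fun _ => hM0) hT f (fun x hx => hf x (hbox x hx)) a
    (fun x hx => ha x (hbox x hx)) (fun x hxb => ?_)
  rcases hx x (hbox x hxb) with h1 | ⟨m', hm', h1⟩ | ⟨o, ho, h1, h2⟩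
  · exact FailLE.of_one_le h1
  · exact h1 _ ⟨fun v => midDev_state_of_inl hL.le (hm' v),
      fun v w => congrArg (· + L) (h.elapsed v w),
      fun v => Nat.add_le_add (h.energy v) (sum_cost_le_length _ L)⟩
  · exact fail_of_solved h.elapsed (fun _ => hL) (a x) o ho
      (fun v => (Nat.add_le_add (h.energy v) (sum_cost_le_length _ L)).trans h2) h1 _ _

end Common

/-! ### Potentials for sequences of trials -/

/-- An upper bound for the probability that `c` successes become `m` in the trials `w, …, W - 1`,
when each trial succeeds with probability at most `y / (4 * σ)`. -/
noncomputable def upperPot (σ : ℕ) (y : ℝ) (m W w c : ℕ) : ℝ :=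
  (1 + 1 / (2 * σ)) ^ (W - w) * (y / 2) ^ (m - c)

/-- An upper bound for the probability that `c` successes do not become `m` in the trials
`w, …, W - 1`, when each trial succeeds with probability at least `q`. -/
noncomputable def lowerPot (q : ℝ) (m W w c : ℕ) : ℝ :=
  2 ^ m * (1 / 2) ^ c * (1 - q / 2) ^ (W - w)

theorem upperPot_nonneg {σ : ℕ} {y : ℝ} (hy : 0 ≤ y) (m W w c : ℕ) :
    0 ≤ upperPot σ y m W w c := by
  unfold upperPot
  positivity

theorem lowerPot_nonneg {q : ℝ} (hq : q ≤ 1) (m W w c : ℕ) : 0 ≤ lowerPot q m W w c := by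
  unfold lowerPot
  have : 0 ≤ 1 - q / 2 := by linarith
  positivity

theorem one_le_upperPot {σ : ℕ} {y : ℝ} {m c : ℕ} (h : m ≤ c) (W w : ℕ) :
    1 ≤ upperPot σ y m W w c := by
  rw [upperPot, Nat.sub_eq_zero_of_le h, pow_zero, mul_one]
  exact one_le_pow₀ (by simp)

theorem one_le_lowerPot {q : ℝ} {m c : ℕ} (h : c ≤ m) (W : ℕ) :
    1 ≤ lowerPot q m W W c := by
  rw [lowerPot, Nat.sub_self, pow_zero, mul_one]
  obtain ⟨k, rfl⟩ := Nat.exists_eq_add_of_le h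
  rw [pow_add, mul_comm ((2 : ℝ) ^ c), mul_assoc, ← mul_pow]
  norm_num
  exact one_le_pow₀ (by norm_num)

/-- A success multiplies `(y / 2) ^ (m - c)` by at most `2 / y`. Its mean therefore grows by a
factor of at most `1 + q * (2 / y) ≤ 1 + 1 / (2 * σ)`, which the loss of one power in the first
factor compensates. For `c ≥ m` the second factor stays `1`. -/
theorem upperPot_step {σ : ℕ} {y q : ℝ} {m W w c : ℕ} (hσ : 0 < σ) (hy : 0 < y)
    (hq : q ≤ y / (4 * σ)) (hq0 : 0 ≤ q) (hw : w < W) :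
    q * upperPot σ y m W (w + 1) (c + 1) + (1 - q) * upperPot σ y m W (w + 1) c ≤
      upperPot σ y m W w c := by
  have hσ' : (0 : ℝ) < σ := by exact_mod_cast hσ
  obtain ⟨k, hk⟩ : ∃ k, W - w = k + 1 := ⟨W - w - 1, by omega⟩
  have hk' : W - (w + 1) = k := by omega
  simp only [upperPot, hk, hk']
  have hpow : (0 : ℝ) < (1 + 1 / (2 * σ)) ^ k := by positivity
  rw [pow_succ]
  by_cases hc : c < m
  · obtain ⟨l, hl⟩ : ∃ l, m - c = l + 1 := ⟨m - c - 1, by omega⟩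
    have hl' : m - (c + 1) = l := by omega
    rw [hl, hl', pow_succ]
    have h1 : q ≤ 1 / (2 * σ) * (y / 2) := by
      refine hq.trans (le_of_eq ?_)
      field_simp
      norm_num
    have h2 : (0 : ℝ) < (y / 2) ^ l := by positivity
    have h3 : (0 : ℝ) < (1 + 1 / (2 * σ)) ^ k * (y / 2) ^ l := by positivity
    have h4 : 0 ≤ q * (y / 2) := by positivity
    nlinarith
  · have e1 : m - c = 0 := by omega
    have e2 : m - (c + 1) = 0 := by omega
    rw [e1, e2]
    have : (0 : ℝ) < 1 / (2 * σ) := by positivity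
    nlinarith

/-- Over `σ * m` trials the compensating factor is at most `exp (m / 2) ≤ 2 ^ m`, which cancels the
`2` in `y / 2`. -/
theorem upperPot_zero_le {σ : ℕ} {y : ℝ} (hσ : 0 < σ) (hy : 0 < y) (m : ℕ) :
    upperPot σ y m (σ * m) 0 0 ≤ y ^ m := by
  have hσ' : (0 : ℝ) < σ := by exact_mod_cast hσ
  rw [upperPot, Nat.sub_zero, Nat.sub_zero, pow_mul, ← mul_pow]
  refine pow_le_pow_left₀ (by positivity) ?_ m
  have h1 : (1 + 1 / (2 * σ) : ℝ) ^ σ ≤ Real.exp (1 / 2) := by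
    calc (1 + 1 / (2 * σ) : ℝ) ^ σ ≤ (Real.exp (1 / (2 * σ))) ^ σ := by
          refine pow_le_pow_left₀ (by positivity) ?_ σ
          have := Real.add_one_le_exp (1 / (2 * σ) : ℝ)
          linarith
      _ = Real.exp (1 / 2) := by
          rw [← Real.exp_nat_mul]
          congr 1
          field_simp
  have h2 : Real.exp (1 / 2) ≤ 2 := by
    have h3 : Real.exp (1 / 2) * Real.exp (1 / 2) = Real.exp 1 := by
      rw [← Real.exp_add]; norm_num
    have h4 := Real.exp_one_lt_d9
    nlinarith [Real.exp_pos (1 / 2)]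
  nlinarith

/-- Every success halves the potential, so a trial multiplies its mean by `1 - q' / 2 ≤ 1 - q / 2`.
-/
theorem lowerPot_step {q q' : ℝ} {m W w c : ℕ} (hq : q ≤ q') (hq1 : q ≤ 1) (hw : w < W) :
    q' * lowerPot q m W (w + 1) (c + 1) + (1 - q') * lowerPot q m W (w + 1) c ≤
      lowerPot q m W w c := by
  obtain ⟨k, hk⟩ : ∃ k, W - w = k + 1 := ⟨W - w - 1, by omega⟩
  have hk' : W - (w + 1) = k := by omega
  simp only [lowerPot, hk, hk']
  have h0 : (0 : ℝ) ≤ 1 - q / 2 := by linarith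
  have h1 : (0 : ℝ) ≤ 2 ^ m * (1 / 2) ^ c * (1 - q / 2) ^ k := by positivity
  rw [pow_succ (1 / 2 : ℝ) c, pow_succ (1 - q / 2) k]
  nlinarith

/-- `(1 - q / 2) ^ σ ≤ exp (-2) ≤ 1 / 4` turns `2 ^ m` into `2 ^ (-m)`. This dictates the numbers of
trials per scale: `1024` times the threshold for success probability `1 / 256`, and `128` times for
`1 / 32`. -/
theorem lowerPot_zero_le {q : ℝ} {σ : ℕ} (hq1 : q ≤ 1) (hσ : 4 ≤ q * σ) (m : ℕ) :
    lowerPot q m (σ * m) 0 0 ≤ (1 / 2) ^ m := by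
  rw [lowerPot, Nat.sub_zero, pow_zero, mul_one, pow_mul, ← mul_pow]
  have h0 : (0 : ℝ) ≤ 1 - q / 2 := by linarith
  refine pow_le_pow_left₀ (by positivity) ?_ m
  have h1 : (1 - q / 2) ^ σ ≤ Real.exp (-2) := by
    calc (1 - q / 2) ^ σ ≤ (Real.exp (-(q / 2))) ^ σ := by
          refine pow_le_pow_left₀ h0 ?_ σ
          have := Real.add_one_le_exp (-(q / 2))
          linarith
      _ = Real.exp (σ * (-(q / 2))) := by rw [← Real.exp_nat_mul]
      _ ≤ Real.exp (-2) := by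
          apply Real.exp_le_exp.2
          linarith
  have h2 : Real.exp (-2) ≤ 1 / 4 := by
    rw [Real.exp_neg, show (2 : ℝ) = 1 + 1 by norm_num, Real.exp_add]
    have h4 := Real.exp_one_gt_d9
    rw [inv_le_comm₀ (by positivity) (by norm_num)]
    norm_num
    nlinarith
  linarith

/-! ### Small networks -/

section Small

variable {n : ℕ} {d : ℕ → ℕ} {N : ℕ} {cd : CDModel}

/-- Exactly one device draws `0` and exactly one draws `1`. -/
def PairDraw (x : Fin n → ℕ) : Prop :=
  ∃ u v, u ≠ v ∧ x u = 0 ∧ x v = 1 ∧ ∀ w, w ≠ u → w ≠ v → 2 ≤ x w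

open Classical in
/-- The actions in a trial. -/
noncomputable def smallActs (x : Fin n → ℕ) (t : ℕ) (v : Fin n) : Action Msg :=
  if t = 0 then if x v = 0 then beep else if x v = 1 then .listen else .idle
  else if t = 1 then
    if x v = 0 then .listen else if x v = 1 ∧ (∃! u, x u = 0) then beep else .idle
  else if x v = 0 ∧ PairDraw x then beep else .listen

/-- The right-hand side is what the handshake observes: a unique sender in slot 1 among those that
heard a unique sender in slot 0. -/
theorem pairDraw_iff (x : Fin n → ℕ) :
    PairDraw x ↔ ∃! v, x v = 1 ∧ ∃! u, x u = 0 := by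
  constructor
  · rintro ⟨u, v, huv, hu, hv, hw⟩
    have h0 : ∀ w, x w = 0 → w = u := fun w h => by
      by_contra hwu
      by_cases hwv : w = v
      · subst hwv; omega
      · have := hw w hwu hwv; omega
    have h1 : ∀ w, x w = 1 → w = v := fun w h => by
      by_contra hwv
      by_cases hwu : w = u
      · subst hwu; omega
      · have := hw w hwu hwv; omega
    exact ⟨v, ⟨hv, u, hu, h0⟩, fun w hw => h1 w hw.1⟩
  · rintro ⟨v, ⟨hv, u, hu, h0⟩, h1⟩
    refine ⟨u, v, ?_, hu, hv, fun w hwu hwv => ?_⟩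
    · rintro rfl; omega
    · have e0 : x w ≠ 0 := fun h => hwu (h0 w h)
      have e1 : x w ≠ 1 := fun h => hwv (h1 w ⟨h, u, hu, h0⟩)
      omega

theorem PairDraw.existsUnique_zero {x : Fin n → ℕ} (h : PairDraw x) : ∃! u, x u = 0 := by
  obtain ⟨v, hv, _⟩ := (pairDraw_iff x).1 h
  exact hv.2

open Classical in
theorem heard_small_zero (x : Fin n → ℕ) :
    (heard (some (channel (smallActs x 0)))).isSome = true ↔ ∃! u, x u = 0 := by
  rw [heard_channel (p := fun v => x v = 0) (m := (false, false, 0))]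
  · split_ifs with h <;> simp [h]
  · intro v hv; simp [smallActs, hv, beep]
  · intro v hv
    simp only [smallActs, hv, if_true, if_false]
    split_ifs <;> rfl

open Classical in
theorem heard_small_one (x : Fin n → ℕ) :
    (heard (some (channel (smallActs x 1)))).isSome = true ↔ PairDraw x := by
  rw [heard_channel (p := fun v => x v = 1 ∧ ∃! u, x u = 0) (m := (false, false, 0)),
    pairDraw_iff]
  · split_ifs with h <;> simp [h]
  · intro v hv; simp [smallActs, hv, beep]
  · intro v hv
    simp only [smallActs, hv, one_ne_zero, if_true, if_false]
    split_ifs <;> rfl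

open Classical in
-- The device that drew `0` learns of its success from the answer in slot 1, hence without any
-- feedback on its own transmission, and its confirmation in slot 2 reaches everybody else.
theorem heard_small_two (x : Fin n → ℕ) :
    (heard (some (channel (smallActs x 2)))).isSome = true ↔ PairDraw x := by
  rw [heard_channel (p := fun v => x v = 0 ∧ PairDraw x) (m := (false, false, 0))]
  · split_ifs with h
    · simp only [Option.isSome_some, true_iff]
      exact h.exists.choose_spec.2
    · simp only [Option.isSome_none, Bool.false_eq_true, false_iff]
      intro hp
      obtain ⟨u, hu, huu⟩ := hp.existsUnique_zero
      exact h ⟨u, ⟨hu, hp⟩, fun w hw => huu w hw.1⟩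
  · intro v hv; simp [smallActs, hv, beep]
  · intro v hv
    simp only [smallActs, hv, OfNat.ofNat_ne_zero, OfNat.ofNat_ne_one, if_false]
    rfl

theorem got_small_zero {x : Fin n → ℕ} {t : ℕ} {v : Fin n} (ht : 0 < t) (hv : x v = 1) :
    (got (obsOf cd (smallActs x) t v) 0).isSome = true ↔ ∃! u, x u = 0 := by
  rw [got_obsOf ht (by simp [smallActs, hv]), heard_small_zero]

theorem got_small_one {x : Fin n → ℕ} {t : ℕ} {v : Fin n} (ht : 1 < t) (hv : x v = 0) :
    (got (obsOf cd (smallActs x) t v) 1).isSome = true ↔ PairDraw x := by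
  rw [got_obsOf ht (by simp [smallActs, hv]), heard_small_one]

open Classical in
theorem smallAct_eq (x : Fin n → ℕ) {t : ℕ} (ht : t < 3) (v : Fin n) :
    smallAct (x v) (obsOf cd (smallActs x) t v) = smallActs x t v := by
  rw [smallAct, length_obsOf]
  interval_cases t
  · simp [smallActs]
  · simp only [one_ne_zero, if_false, if_true]
    rw [show smallActs x 1 v = if x v = 0 then .listen
      else if x v = 1 ∧ (∃! u, x u = 0) then beep else .idle by simp [smallActs]]
    by_cases h1 : x v = 1
    · simp only [h1, got_small_zero (cd := cd) one_pos h1]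
    · simp [h1]
  · simp only [OfNat.ofNat_ne_zero, OfNat.ofNat_ne_one, if_false]
    rw [show smallActs x 2 v = if x v = 0 ∧ PairDraw x then beep else .listen by simp [smallActs]]
    by_cases h0 : x v = 0
    · simp only [h0, got_small_one (cd := cd) one_lt_two h0]
    · simp [h0]

/-- All devices reach the same verdict and so keep a common memory: the confirming device knows it
from slot 1, the others from slot 2. -/
theorem small_success_iff (x : Fin n → ℕ) (v : Fin n) :
    ((x v = 0 ∧ (got (obsOf cd (smallActs x) 3 v) 1).isSome = true) ∨
      (got (obsOf cd (smallActs x) 3 v) 2).isSome = true) ↔ PairDraw x := by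
  by_cases h : x v = 0 ∧ PairDraw x
  · simp only [h.1, got_small_one (cd := cd) (by norm_num : 1 < 3) h.1, h.2, true_and, true_or]
  · rw [got_obsOf (by norm_num : 2 < 3) (by simp [smallActs, h]), heard_small_two]
    by_cases h0 : x v = 0
    · simp only [h0, got_small_one (cd := cd) (by norm_num : 1 < 3) h0, true_and, or_self]
    · simp [h0]

/-- The memory after trial `j` if no device terminates. -/
def smallNext (d : ℕ) (cd : CDModel) (j c : ℕ) : Mem :=
  if j + 1 < (d + 1) * smallTrials d then .small (j + 1) c else afterSmall cd

theorem smallFin_eq (j c : ℕ) (x : Fin n → ℕ) (v : Fin n) [Decidable (PairDraw x)] :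
    smallFin (d 0) cd j c (x v) (obsOf cd (smallActs x) 3 v) =
      if PairDraw x then
        if threshold (d 0) ≤ smallCount (d 0) j c + 1 then
          .inr ⟨2 ^ (d 0 - j / smallTrials (d 0)), if x v = 0 then .leader else .follower⟩
        else .inl (smallNext (d 0) cd j (smallCount (d 0) j c + 1))
      else .inl (smallNext (d 0) cd j (smallCount (d 0) j c)) := by
  rw [smallFin]
  simp only [small_success_iff]
  by_cases hp : PairDraw x
  · simp only [hp, if_true]
    by_cases h0 : x v = 0
    · simp only [h0, got_small_one (cd := cd) (by norm_num : 1 < 3) h0, hp, smallNext]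
      split_ifs <;> simp_all
    · simp only [h0, false_and, smallNext]
      split_ifs <;> simp_all
  · simp only [hp, smallNext]
    split_ifs <;> simp_all

/-- Termination takes place in a successful trial, whose third slot is already the concluding slot
demanded by leader election: one device transmits and all others listen. -/
theorem solved_small {x : Fin n → ℕ} (hx : PairDraw x) {C : ℝ} {k : ℕ} (h1 : (n : ℝ) ≤ C * k)
    (h2 : (k : ℝ) ≤ C * n) :
    Solved C (fun v => ⟨k, if x v = 0 then .leader else .follower⟩) (smallActs x 2) := by
  obtain ⟨u, hu, huu⟩ := hx.existsUnique_zero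
  refine ⟨k, u, fun _ => rfl, h1, h2, by simp [hu], ⟨_, by simp [smallActs, hu, hx, beep]; rfl⟩,
    fun v hv => ?_⟩
  have h0 : x v ≠ 0 := fun h0 => hv (huu v h0)
  simp [smallActs, h0]

open Classical in
/-- The probability of `PairDraw` when all devices draw from `{0, …, M - 1}`. -/
noncomputable def pairProb (n M : ℕ) : ℝ :=
  avg (fun _ : Fin n => M) fun x => if PairDraw x then 1 else 0

theorem pairProb_eq {M : ℕ} (hM : 2 ≤ M) :
    pairProb n M = (n : ℝ) * (n - 1) * ((1 / M : ℝ) ^ 2 * (1 - 2 / M : ℝ) ^ (n - 2)) := by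
  have := avg_unique_pair (ι := Fin n) hM
  rw [Fintype.card_fin] at this
  rw [← this, pairProb]
  refine avg_congr fun x _ => ?_
  by_cases h : PairDraw x
  · rw [if_pos h, if_pos (by exact h)]
  · rw [if_neg h, if_neg (by exact h)]

theorem pairProb_nonneg (n M : ℕ) : 0 ≤ pairProb n M :=
  avg_nonneg fun x _ => by split_ifs <;> simp

theorem avg_ite {ι : Type} [Fintype ι] [DecidableEq ι] {N : ι → ℕ} (hN : ∀ v, 0 < N v)
    (p : (ι → ℕ) → Prop) [∀ x, Decidable (p x)] (α β : ℝ) :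
    avg N (fun x => if p x then α else β) =
      avg N (fun x => if p x then 1 else 0) * α +
        (1 - avg N (fun x => if p x then 1 else 0)) * β := by
  have : (fun x => if p x then α else β) =
      fun x => (α - β) * (if p x then 1 else 0) + β := by
    funext x
    split_ifs <;> ring
  rw [this, avg_add, avg_mul_left, avg_const hN]
  ring

open Classical in
/-- A recursion for the failure probability of the procedure for small networks. -/
theorem small_fail {E e₀ T' : ℕ} {C F : ℝ} (val : ℕ → ℕ → ℝ) (hval : ∀ j c, 0 ≤ val j c)
    (hF : 0 ≤ F) (hE : e₀ + 3 * ((d 0 + 1) * smallTrials (d 0)) ≤ E)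
    (hnext : ∀ (D : Fin n → Device (protocol d N cd).alg) (T : ℕ),
      Conf d N cd (afterSmall cd) (e₀ + 3 * ((d 0 + 1) * smallTrials (d 0))) D → T' ≤ T →
      FailLE (protocol d N cd) cd (goodSet (protocol d N cd) n C E) D T F)
    (hstep : ∀ j < (d 0 + 1) * smallTrials (d 0), ∀ c, val j c < 1 →
      ∃ bad : ℝ, 0 ≤ bad ∧ (bad < 1 → ((n : ℝ) ≤ C * (2 ^ (d 0 - j / smallTrials (d 0)) : ℕ) ∧
        ((2 ^ (d 0 - j / smallTrials (d 0)) : ℕ) : ℝ) ≤ C * n)) ∧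
      pairProb n (2 ^ (d 0 - j / smallTrials (d 0) + 3)) *
        (if threshold (d 0) ≤ smallCount (d 0) j c + 1 then bad
          else if j + 1 < (d 0 + 1) * smallTrials (d 0) then val (j + 1) (smallCount (d 0) j c + 1)
          else F) +
      (1 - pairProb n (2 ^ (d 0 - j / smallTrials (d 0) + 3))) *
        (if j + 1 < (d 0 + 1) * smallTrials (d 0) then val (j + 1) (smallCount (d 0) j c)
          else F) ≤ val j c)
    (k j c T : ℕ) (hk : j + k + 1 = (d 0 + 1) * smallTrials (d 0))
    (hT : 3 * (k + 1) + T' ≤ T) (D : Fin n → Device (protocol d N cd).alg)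
    (h : Conf d N cd (.small j c) (e₀ + 3 * j) D) :
    FailLE (protocol d N cd) cd (goodSet (protocol d N cd) n C E) D T (val j c) := by
  induction k using Nat.strong_induction_on generalizing j c T D with
  | _ k ih =>
  -- Where the value is at least `1` nothing is claimed, so `hstep` is needed only below `1`.
  by_cases hv1 : 1 ≤ val j c
  · exact FailLE.of_one_le hv1
  push Not at hv1
  have hj : j < (d 0 + 1) * smallTrials (d 0) := by omega
  obtain ⟨bad, hbad0, hbad, hle⟩ := hstep j hj c hv1
  have hcont : ∀ (c' : ℕ) (D' : Fin n → Device (protocol d N cd).alg),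
      Conf d N cd (smallNext (d 0) cd j c') (e₀ + 3 * j + 3) D' →
      FailLE (protocol d N cd) cd (goodSet (protocol d N cd) n C E) D' (T - 3)
        (if j + 1 < (d 0 + 1) * smallTrials (d 0) then val (j + 1) c' else F) := by
    intro c' D' hD'
    by_cases hj1 : j + 1 < (d 0 + 1) * smallTrials (d 0)
    · rw [if_pos hj1]
      rw [smallNext, if_pos hj1] at hD'
      exact ih (k - 1) (by omega) (j + 1) c' (T - 3) (by omega) (by omega) D' hD'
    · rw [if_neg hj1]
      rw [smallNext, if_neg hj1] at hD'
      refine hnext D' (T - 3) ?_ (by omega)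
      rwa [show 3 * ((d 0 + 1) * smallTrials (d 0)) = 3 * j + 3 by omega]
  set α : ℝ := if threshold (d 0) ≤ smallCount (d 0) j c + 1 then bad
          else if j + 1 < (d 0 + 1) * smallTrials (d 0) then val (j + 1) (smallCount (d 0) j c + 1)
          else F with hα
  set β : ℝ := if j + 1 < (d 0 + 1) * smallTrials (d 0) then val (j + 1) (smallCount (d 0) j c)
          else F with hβ
  have hα0 : 0 ≤ α := by
    rw [hα]; split_ifs <;> first | exact hbad0 | exact hval _ _ | exact hF
  have hβ0 : 0 ≤ β := by
    rw [hβ]; split_ifs <;> first | exact hval _ _ | exact hF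
  have hM : 0 < 2 ^ (d 0 - j / smallTrials (d 0) + 3) := by positivity
  refine (h.fail_epoch (L := 3) (M := 2 ^ (d 0 - j / smallTrials (d 0) + 3)) rfl (by norm_num) rfl hM (by omega)
    (fun x => if PairDraw x then α else β) (fun x _ => ?_) smallActs
    (fun x _ t ht v => smallAct_eq x ht v) (fun x _ => ?_)).mono ?_
  · split_ifs <;> assumption
  · by_cases hp : PairDraw x
    · rw [if_pos hp]
      by_cases hc : threshold (d 0) ≤ smallCount (d 0) j c + 1
      · rw [hα, if_pos hc]
        by_cases hb : bad < 1
        · refine .inr (.inr ⟨_, fun v => (smallFin_eq j c x v).trans ?_,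
            solved_small hp (hbad hb).1 (hbad hb).2, by omega⟩)
          rw [if_pos hp, if_pos hc]
        · exact .inl (not_lt.1 hb)
      · rw [hα, if_neg hc]
        refine .inr (.inl ⟨_, fun v => (smallFin_eq j c x v).trans ?_, hcont _⟩)
        rw [if_pos hp, if_neg hc]
    · rw [if_neg hp]
      refine .inr (.inl ⟨_, fun v => (smallFin_eq j c x v).trans ?_, hcont _⟩)
      rw [if_neg hp]
  · rw [avg_ite fun _ => hM]
    exact hle

end Small

theorem succ_div_mod {W : ℕ} (hW : 0 < W) (j : ℕ) :
    (j % W + 1 < W ∧ (j + 1) / W = j / W ∧ (j + 1) % W = j % W + 1) ∨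
      (j % W + 1 = W ∧ (j + 1) / W = j / W + 1 ∧ (j + 1) % W = 0) := by
  have h1 := Nat.mod_lt j hW
  have h2 := Nat.div_add_mod j W
  rcases lt_or_eq_of_le (Nat.succ_le_of_lt h1) with h | h
  · left
    have e : j + 1 = (j % W + 1) + W * (j / W) := by omega
    refine ⟨h, ?_, ?_⟩
    · rw [e, Nat.add_mul_div_left _ _ hW, Nat.div_eq_of_lt h, zero_add]
    · rw [e, Nat.add_mul_mod_self_left, Nat.mod_eq_of_lt h]
  · right
    have e : j + 1 = W * (j / W + 1) := by rw [mul_add]; omega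
    refine ⟨h, ?_, ?_⟩
    · rw [e, Nat.mul_div_cancel_left _ hW]
    · rw [e, Nat.mul_mod_right]

/-! ### Potentials for the trials of the small-network routine -/

section Small

variable {n : ℕ} {d : ℕ → ℕ} {N : ℕ} {cd : CDModel}

/-- The estimate `2 ^ k` is off by more than a factor `C`. -/
def Far (C : ℝ) (n : ℕ) (k : ℕ) : Prop :=
  ¬ ((n : ℝ) ≤ C * (2 ^ k : ℕ) ∧ ((2 ^ k : ℕ) : ℝ) ≤ C * n)

open Classical in
/-- A potential for wrong estimates. -/
noncomputable def smallUpper (d : ℕ) (C : ℝ) (n : ℕ) (y : ℝ) (j c : ℕ) : ℝ :=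
  ((d - j / smallTrials d : ℕ) : ℝ) * y ^ threshold d +
    if Far C n (d - j / smallTrials d) then
      upperPot 1024 y (threshold d) (smallTrials d) (j % smallTrials d) (smallCount d j c)
    else 0

theorem smallUpper_nonneg {d : ℕ} {C : ℝ} {y : ℝ} (hy : 0 ≤ y) (j c : ℕ) :
    0 ≤ smallUpper d C n y j c := by
  unfold smallUpper
  have := upperPot_nonneg hy (σ := 1024) (threshold d) (smallTrials d) (j % smallTrials d)
    (smallCount d j c)
  split_ifs <;> positivity

theorem smallTrials_eq (d : ℕ) : smallTrials d = 1024 * threshold d := rfl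

open Classical in
-- Within a scale this is `upperPot_step`, or trivial if the scale is not far. When a scale ends,
-- the first summand of the potential drops by `y ^ threshold d`, which pays for the initial
-- potential of the next scale.
theorem smallUpper_step {d : ℕ} (hd : 0 < d) {C y q : ℝ} (hy : 0 < y) {j : ℕ} (hq0 : 0 ≤ q)
    (hq1 : q ≤ 1)
    (hq : Far C n (d - j / smallTrials d) → q ≤ y / (4 * (1024 : ℕ))) (c : ℕ) :
    q * (if threshold d ≤ smallCount d j c + 1 then (if Far C n (d - j / smallTrials d) then 1 else 0)
          else if j + 1 < (d + 1) * smallTrials d then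
            smallUpper d C n y (j + 1) (smallCount d j c + 1)
          else 0) +
      (1 - q) *
        (if j + 1 < (d + 1) * smallTrials d then smallUpper d C n y (j + 1) (smallCount d j c)
          else 0) ≤ smallUpper d C n y j c := by
  have hW : 0 < smallTrials d := by unfold smallTrials; positivity
  set W := smallTrials d with hWdef
  set s := j / W
  set w := j % W with hw
  set c₀ := smallCount d j c
  have hwW : w < W := Nat.mod_lt j hW
  have hym : 0 < y ^ threshold d := by positivity
  have hsd : (0 : ℝ) ≤ ((d - s : ℕ) : ℝ) := Nat.cast_nonneg _
  have hU := fun c' => upperPot_nonneg hy.le (σ := 1024) (threshold d) W (w + 1) c'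
  set R : ℕ → ℝ := fun c' => ((d - s : ℕ) : ℝ) * y ^ threshold d +
    if Far C n (d - s) then upperPot 1024 y (threshold d) W (w + 1) c' else 0 with hR
  have hR0 : ∀ c', 0 ≤ R c' := by
    intro c'
    have := hU c'
    simp only [hR]
    split_ifs <;> positivity
  have hnext : ∀ c', (if j + 1 < (d + 1) * W then smallUpper d C n y (j + 1) c' else 0) ≤ R c' := by
    intro c'
    split_ifs with hj1
    · rcases succ_div_mod hW j with ⟨h1, h2, h3⟩ | ⟨h1, h2, h3⟩
      · rw [smallUpper, ← hWdef, h2, h3, smallCount, ← hWdef, h3, if_neg (Nat.succ_ne_zero _)]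
      · rw [smallUpper, ← hWdef, h2, h3, smallCount, ← hWdef, h3, if_pos rfl]
        have hs1 : s + 1 ≤ d := by
          have : (j + 1) / W < d + 1 := Nat.div_lt_of_lt_mul (by rwa [mul_comm])
          rw [h2] at this
          omega
        have e : ((d - s : ℕ) : ℝ) = ((d - (s + 1) : ℕ) : ℝ) + 1 := by
          have : d - s = (d - (s + 1)) + 1 := by omega
          rw [this]
          push_cast
          rfl
        have h4 := upperPot_zero_le (σ := 1024) (by norm_num) hy (threshold d)
        rw [← smallTrials_eq, ← hWdef] at h4
        simp only [hR]
        rw [e]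
        have h5 := hU c'
        have h6 : (if Far C n (d - (s + 1)) then upperPot 1024 y (threshold d) W 0 0 else 0)
            ≤ y ^ threshold d := by
          split_ifs
          · exact h4
          · exact hym.le
        split_ifs at h6 ⊢ <;> linarith
    · exact hR0 c'
  have hfirst : (if threshold d ≤ c₀ + 1 then (if Far C n (d - s) then 1 else 0)
          else if j + 1 < (d + 1) * W then smallUpper d C n y (j + 1) (c₀ + 1)
          else 0) ≤ R (c₀ + 1) := by
    split_ifs with h1 h2 h3
    · simp only [hR]
      rw [if_pos h2]
      have := one_le_upperPot (σ := 1024) (y := y) h1 W (w + 1)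
      nlinarith
    · exact hR0 _
    · have := hnext (c₀ + 1)
      rwa [if_pos h3] at this
    · exact hR0 _
  refine (add_le_add (mul_le_mul_of_nonneg_left hfirst hq0)
    (mul_le_mul_of_nonneg_left (hnext c₀) (by linarith))).trans ?_
  have hfin : smallUpper d C n y j c = ((d - s : ℕ) : ℝ) * y ^ threshold d +
    if Far C n (d - s) then upperPot 1024 y (threshold d) W w c₀ else 0 := rfl
  rw [hfin]
  simp only [hR]
  split_ifs with hf
  · have := upperPot_step (σ := 1024) (m := threshold d) (c := c₀) (by norm_num) hy (hq hf) hq0 hwW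
    linarith
  · linarith

open Classical in
/-- A potential for not finding an estimate before the end of scale index `s`. -/
noncomputable def smallLower (d s : ℕ) (j c : ℕ) : ℝ :=
  if j / smallTrials d < s then (1 / 2) ^ threshold d
  else if j / smallTrials d = s ∧ smallCount d j c < threshold d then
    lowerPot (1 / 256) (threshold d) (smallTrials d) (j % smallTrials d) (smallCount d j c)
  else 1

theorem smallLower_nonneg (d s j c : ℕ) : 0 ≤ smallLower d s j c := by
  unfold smallLower
  have := lowerPot_nonneg (q := 1 / 256) (by norm_num) (threshold d) (smallTrials d)
    (j % smallTrials d) (smallCount d j c)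
  split_ifs <;> positivity

/-- Termination counts as `0` here, since wrong estimates are charged to `smallUpper`. The potential
is constant before scale index `s` and follows `lowerPot` during it; the assumption of a value below
`1` excludes all later scales. -/
theorem smallLower_step {d : ℕ} (hd : 0 < d) {s : ℕ} (hs : s ≤ d) {q : ℝ} {j : ℕ} (hq0 : 0 ≤ q)
    (hq1 : q ≤ 1)
    (hq : j / smallTrials d = s → 1 / 256 ≤ q) (c : ℕ) (hlt : smallLower d s j c < 1) :
    q * (if threshold d ≤ smallCount d j c + 1 then 0
          else if j + 1 < (d + 1) * smallTrials d then smallLower d s (j + 1) (smallCount d j c + 1)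
          else 1) +
      (1 - q) *
        (if j + 1 < (d + 1) * smallTrials d then smallLower d s (j + 1) (smallCount d j c)
          else 1) ≤ smallLower d s j c := by
  have hW : 0 < smallTrials d := by unfold smallTrials; positivity
  have hm : 0 < threshold d := by unfold threshold; positivity
  set W := smallTrials d with hWdef
  set w := j % W with hw
  set c₀ := smallCount d j c
  have hwW : w < W := Nat.mod_lt j hW
  have hδ : (0 : ℝ) < (1 / 2) ^ threshold d := by positivity
  have hz : smallLower d s j c = if j / W < s then (1 / 2) ^ threshold d
    else if j / W = s ∧ c₀ < threshold d then lowerPot (1 / 256) (threshold d) W w c₀ else 1 := rfl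
  rcases lt_trichotomy (j / W) s with h | h | h
  · rw [hz, if_pos h]
    have hj1 : j + 1 < (d + 1) * W := by
      have h1 := Nat.div_add_mod j W
      have h2 : W * (j / W + 1) ≤ W * d := Nat.mul_le_mul_left W (by omega)
      nlinarith
    have hnext : ∀ c', smallLower d s (j + 1) c' ≤ (1 / 2) ^ threshold d := by
      intro c'
      rw [smallLower, ← hWdef, smallCount, ← hWdef]
      rcases succ_div_mod hW j with ⟨h1, h2, h3⟩ | ⟨h1, h2, h3⟩
      · rw [h2, if_pos h]
      · rw [h2, h3, if_pos rfl]
        by_cases h4 : j / W + 1 < s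
        · rw [if_pos h4]
        · rw [if_neg h4, if_pos ⟨by omega, hm⟩]
          exact lowerPot_zero_le (by norm_num) (by norm_num) _
    have h1 := hnext c₀
    have h2 : (if threshold d ≤ c₀ + 1 then 0 else if j + 1 < (d + 1) * W then
        smallLower d s (j + 1) (c₀ + 1) else 1) ≤ (1 / 2 : ℝ) ^ threshold d := by
      rw [if_pos hj1]
      split_ifs
      · exact hδ.le
      · exact hnext _
    have h3 : (if j + 1 < (d + 1) * W then smallLower d s (j + 1) c₀ else 1) ≤
        (1 / 2 : ℝ) ^ threshold d := by rwa [if_pos hj1]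
    nlinarith
  · by_cases hc : c₀ < threshold d
    · rw [if_neg h.not_lt, if_pos ⟨h, hc⟩] at hz
      rw [hz]
      have hnext : ∀ c' < threshold d,
          (if j + 1 < (d + 1) * W then smallLower d s (j + 1) c' else 1) ≤
            lowerPot (1 / 256) (threshold d) W (w + 1) c' := by
        intro c' hc'
        rcases succ_div_mod hW j with ⟨h1, h2, h3⟩ | ⟨h1, h2, h3⟩
        · have h4 := Nat.div_add_mod j W
          have h5 : W * (j / W) ≤ W * d := Nat.mul_le_mul_left W (by omega)
          rw [if_pos (by nlinarith), smallLower, ← hWdef, smallCount, ← hWdef, h2, h3,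
            if_neg (by omega), if_neg (Nat.succ_ne_zero _), if_pos ⟨h, hc'⟩]
        -- If the scale ends with too few successes, the potential has grown to at least `1`, the
        -- value of having missed the scale.
        · have h4 : (1 : ℝ) ≤ lowerPot (1 / 256) (threshold d) W (w + 1) c' := by
            rw [hw, h1]
            exact one_le_lowerPot hc'.le W
          split_ifs
          · rw [smallLower, ← hWdef, h2, if_neg (by omega), if_neg (by omega)]
            exact h4
          · exact h4
      have h2 : (if threshold d ≤ c₀ + 1 then 0 else if j + 1 < (d + 1) * W then
          smallLower d s (j + 1) (c₀ + 1) else 1) ≤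
            lowerPot (1 / 256) (threshold d) W (w + 1) (c₀ + 1) := by
        by_cases h3 : threshold d ≤ c₀ + 1
        · rw [if_pos h3]
          exact lowerPot_nonneg (by norm_num) _ _ _ _
        · rw [if_neg h3]
          exact hnext _ (by omega)
      refine (add_le_add (mul_le_mul_of_nonneg_left h2 hq0)
        (mul_le_mul_of_nonneg_left (hnext c₀ hc) (sub_nonneg.2 hq1))).trans ?_
      exact lowerPot_step (hq h) (by norm_num) hwW
    · rw [hz, if_neg (by omega), if_neg (by tauto)] at hlt
      exact absurd hlt (lt_irrefl _)
  · rw [hz, if_neg (by omega), if_neg (by omega)] at hlt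
    exact absurd hlt (lt_irrefl _)

theorem pairProb_le_one (n : ℕ) {M : ℕ} (hM : 0 < M) : pairProb n M ≤ 1 := by
  classical
  calc pairProb n M ≤ avg (fun _ : Fin n => M) fun _ => 1 :=
        avg_mono fun x _ => by split_ifs <;> norm_num
    _ = 1 := avg_const (fun _ => hM) 1

open Classical in
/-- For all networks, the procedure for small networks fails with small probability, or continues. -/
theorem small_fail_of_next {E e₀ T' T : ℕ} {C F y : ℝ} (hd : 0 < d 0) (hy : 0 < y)
    (hF : 0 ≤ F) (hE : e₀ + 3 * ((d 0 + 1) * smallTrials (d 0)) ≤ E)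
    (hfar : ∀ k ≤ d 0, Far C n k → pairProb n (2 ^ (k + 3)) ≤ y / (4 * (1024 : ℕ)))
    (hnext : ∀ (D : Fin n → Device (protocol d N cd).alg) (T : ℕ),
      Conf d N cd (afterSmall cd) (e₀ + 3 * ((d 0 + 1) * smallTrials (d 0))) D → T' ≤ T →
      FailLE (protocol d N cd) cd (goodSet (protocol d N cd) n C E) D T F)
    (hT : 3 * ((d 0 + 1) * smallTrials (d 0)) + T' ≤ T)
    (D : Fin n → Device (protocol d N cd).alg) (h : Conf d N cd (.small 0 0) e₀ D) :
    FailLE (protocol d N cd) cd (goodSet (protocol d N cd) n C E) D T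
      ((d 0 + 1) * y ^ threshold (d 0) + F) := by
  have hW : 0 < smallTrials (d 0) := by unfold smallTrials; positivity
  have htot : 0 < (d 0 + 1) * smallTrials (d 0) := by positivity
  refine (small_fail (C := C) (F := F) (e₀ := e₀)
    (fun j c => smallUpper (d 0) C n y j c + F) (fun j c => add_nonneg (smallUpper_nonneg hy.le j c) hF)
    hF hE hnext ?_ ((d 0 + 1) * smallTrials (d 0) - 1) 0 0 T (by omega) (by omega) D h).mono ?_
  · intro j hj c _
    refine ⟨if Far C n (d 0 - j / smallTrials (d 0)) then 1 else 0, by split_ifs <;> norm_num, ?_, ?_⟩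
    · intro hb
      by_contra hcon
      rw [if_pos (by exact hcon)] at hb
      exact lt_irrefl _ hb
    · have hq0 := pairProb_nonneg n (2 ^ (d 0 - j / smallTrials (d 0) + 3))
      have hq1 := pairProb_le_one n (M := 2 ^ (d 0 - j / smallTrials (d 0) + 3)) (by positivity)
      have := smallUpper_step hd (n := n) hy hq0 hq1 (hfar _ (Nat.sub_le _ _)) c
      split_ifs at this ⊢ <;> nlinarith
  · have h4 := upperPot_zero_le (σ := 1024) (by norm_num) hy (threshold (d 0))
    have hym : 0 < y ^ threshold (d 0) := by positivity
    simp only [smallUpper, Nat.zero_div, Nat.zero_mod, smallCount, if_true, Nat.sub_zero]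
    rw [smallTrials_eq]
    split_ifs <;> linarith

open Classical in
/-- A small network is handled by the procedure for small networks. -/
theorem small_fail_of_le {E e₀ T s : ℕ} {C y : ℝ} (hd : 0 < d 0) (hy : 0 < y)
    (hE : e₀ + 3 * ((d 0 + 1) * smallTrials (d 0)) ≤ E)
    (hfar : ∀ k ≤ d 0, Far C n k → pairProb n (2 ^ (k + 3)) ≤ y / (4 * (1024 : ℕ)))
    (hs : s ≤ d 0) (hnear : 1 / 256 ≤ pairProb n (2 ^ (d 0 - s + 3)))
    (hT : 3 * ((d 0 + 1) * smallTrials (d 0)) ≤ T)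
    (D : Fin n → Device (protocol d N cd).alg) (h : Conf d N cd (.small 0 0) e₀ D) :
    FailLE (protocol d N cd) cd (goodSet (protocol d N cd) n C E) D T
      ((d 0 + 1) * y ^ threshold (d 0) + (1 / 2) ^ threshold (d 0)) := by
  have hW : 0 < smallTrials (d 0) := by unfold smallTrials; positivity
  have htot : 0 < (d 0 + 1) * smallTrials (d 0) := by positivity
  have hm : 0 < threshold (d 0) := by unfold threshold; positivity
  -- Reaching the end of the routine counts as failure, so nothing about its continuation is needed.
  refine (small_fail (C := C) (F := 1) (e₀ := e₀) (T' := 0)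
    (fun j c => smallUpper (d 0) C n y j c + smallLower (d 0) s j c)
    (fun j c => add_nonneg (smallUpper_nonneg hy.le j c) (smallLower_nonneg _ _ _ _))
    zero_le_one hE (fun _ _ _ _ => FailLE.of_one_le le_rfl) ?_
    ((d 0 + 1) * smallTrials (d 0) - 1) 0 0 T (by omega) (by omega) D h).mono ?_
  · intro j hj c hlt
    refine ⟨if Far C n (d 0 - j / smallTrials (d 0)) then 1 else 0, by split_ifs <;> norm_num, ?_, ?_⟩
    · intro hb
      by_contra hcon
      rw [if_pos (by exact hcon)] at hb
      exact lt_irrefl _ hb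
    · have hq0 := pairProb_nonneg n (2 ^ (d 0 - j / smallTrials (d 0) + 3))
      have hq1 := pairProb_le_one n (M := 2 ^ (d 0 - j / smallTrials (d 0) + 3)) (by positivity)
      have h1 := smallUpper_step hd (n := n) hy hq0 hq1 (hfar _ (Nat.sub_le _ _)) c
      have h0 := smallUpper_nonneg (n := n) (d := d 0) (C := C) hy.le j c
      have h2 := smallLower_step hd hs (j := j) hq0 hq1 (by rintro rfl; exact hnear) c
        (by linarith)
      split_ifs at h1 h2 ⊢ <;> linarith
  · have h4 := upperPot_zero_le (σ := 1024) (by norm_num) hy (threshold (d 0))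
    have h5 := lowerPot_zero_le (q := 1 / 256) (σ := 1024) (by norm_num) (by norm_num)
      (threshold (d 0))
    have hym : 0 < y ^ threshold (d 0) := by positivity
    have h6 : smallLower (d 0) s 0 0 ≤ (1 / 2) ^ threshold (d 0) := by
      rw [smallLower, Nat.zero_div, Nat.zero_mod, smallCount, Nat.zero_mod, if_pos rfl]
      split_ifs with h7 h8
      · exact le_rfl
      · exact h5
      · exfalso
        exact h8 ⟨by omega, hm⟩
    have h7 : smallUpper (d 0) C n y 0 0 ≤ (d 0 + 1) * y ^ threshold (d 0) := by
      simp only [smallUpper, Nat.zero_div, Nat.zero_mod, smallCount, if_true, Nat.sub_zero]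
      rw [smallTrials_eq]
      split_ifs <;> linarith
    linarith

end Small

/-! ### Recognizing a network of one device -/

section Solo

variable {n : ℕ} {d : ℕ → ℕ} {N : ℕ} {cd : CDModel}

theorem solved_single {C : ℝ} (hC : 1 ≤ C) (b : Fin 1 → Action Msg) (hb : b 0 = beep) :
    Solved C (fun _ => ⟨1, .leader⟩) b :=
  ⟨1, 0, fun _ => rfl, by simpa, by simpa, rfl, ⟨_, hb⟩,
    fun v hv => absurd (Subsingleton.elim v 0) hv⟩

/-- In Sender-CD one slot in which everybody transmits decides the matter: a lone device hears its
own message, while a collision sounds like silence. -/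
theorem got_beep_of_subsingleton (cd : CDModel) (hcd : cd = .senderCD) (v : Fin 1) :
    (got (obsOf cd (fun _ (_ : Fin 1) => beep) 1 v) 0).isSome = true := by
  subst hcd
  rw [got, obsOf_getD _ _ one_pos, channel_of_unique (m := (false, false, 0)) 0 rfl
    fun u hu => absurd (Subsingleton.elim u 0) hu]
  rfl

theorem got_beep_of_two_le (hn : 2 ≤ n) (v : Fin n) :
    (got (obsOf .senderCD (fun _ (_ : Fin n) => beep) 1 v) 0).isSome = false := by
  rw [got, obsOf_getD _ _ one_pos, channel_of_two (u := ⟨0, by omega⟩) (v := ⟨1, by omega⟩)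
    (by simp) (by simp [beep, Action.sent]) (by simp [beep, Action.sent])]
  rfl

theorem solo_sender_one {E T : ℕ} {C : ℝ} (hC : 1 ≤ C) (hE : 1 ≤ E) (hT : 1 ≤ T)
    (D : Fin 1 → Device (protocol d N .senderCD).alg) (h : Conf d N .senderCD .solo 0 D) (ε : ℝ)
    (hε : 0 ≤ ε) :
    FailLE (protocol d N .senderCD) .senderCD (goodSet (protocol d N .senderCD) 1 C E) D T ε := by
  refine (h.fail_epoch (L := 1) (M := 1) rfl one_pos rfl one_pos hT (fun _ => ε) (fun _ _ => hε)
    (fun _ _ _ => beep) (fun x _ t _ v => rfl) (fun x _ => .inr (.inr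
      ⟨_, fun v => ?_, solved_single hC _ rfl, by omega⟩))).mono
    (avg_const (fun _ => one_pos) ε).le
  change (if (got (obsOf .senderCD (fun _ (_ : Fin 1) => beep) 1 v) 0).isSome = true then
    Sum.inr (Output.mk 1 .leader) else Sum.inl (Mem.small 0 0)) = _
  rw [if_pos (got_beep_of_subsingleton _ rfl v)]

theorem solo_sender {E T T' : ℕ} {C F : ℝ} (hn : 2 ≤ n) (hF : 0 ≤ F) (hT : 1 + T' ≤ T)
    (hnext : ∀ (D : Fin n → Device (protocol d N .senderCD).alg) (T : ℕ),
      Conf d N .senderCD (.small 0 0) 1 D → T' ≤ T →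
      FailLE (protocol d N .senderCD) .senderCD (goodSet (protocol d N .senderCD) n C E) D T F)
    (D : Fin n → Device (protocol d N .senderCD).alg) (h : Conf d N .senderCD .solo 0 D) :
    FailLE (protocol d N .senderCD) .senderCD (goodSet (protocol d N .senderCD) n C E) D T F := by
  refine (h.fail_epoch (L := 1) (M := 1) rfl one_pos rfl one_pos (by omega) (fun _ => F)
    (fun _ _ => hF) (fun _ _ _ => beep) (fun x _ t _ v => rfl) (fun x _ => .inr (.inl
      ⟨_, fun v => ?_, fun D' hD' => hnext D' _ hD' (by omega)⟩))).mono
    (avg_const (fun _ => one_pos) F).le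
  change (if (got (obsOf .senderCD (fun _ (_ : Fin n) => beep) 1 v) 0).isSome = true then
    Sum.inr (Output.mk 1 .leader) else Sum.inl (Mem.small 0 0)) = _
  rw [if_neg (by rw [got_beep_of_two_le hn]; simp)]

/-- The models in which listeners detect collisions. -/
def HasReceiverCD (cd : CDModel) : Prop := cd = .strongCD ∨ cd = .receiverCD

theorem feedback_listen_of_receiver (hcd : HasReceiverCD cd) {M : Type} (s : Signal M) :
    feedback s cd .listen = some s := by
  rcases hcd with rfl | rfl <;> rfl

theorem nonsilent_listen {M : Type} (hcd : HasReceiverCD cd) (a : Fin n → Action M) :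
    nonsilent (feedback (channel a) cd .listen) = true ↔ ∃ v, (a v).sent ≠ none := by
  rw [feedback_listen_of_receiver hcd]
  have : nonsilent (some (channel a)) = true ↔ channel a ≠ .silence := by
    cases channel a <;> simp [nonsilent]
  rw [this, Ne, channel_eq_silence_iff]
  push Not
  rfl

theorem solo_len (hcd : HasReceiverCD cd) : epochLen d N cd .solo = N := by
  rcases hcd with rfl | rfl <;> rfl

theorem solo_size (hcd : HasReceiverCD cd) : drawSize d N cd .solo = N := by
  rcases hcd with rfl | rfl <;> rfl

/-- The actions in the test for a single device. -/
def soloActs (x : Fin n → ℕ) (t : ℕ) (v : Fin n) : Action Msg :=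
  if t = x v then beep else .listen

theorem solo_act (hcd : HasReceiverCD cd) (x : Fin n → ℕ) (t : ℕ) (v : Fin n) :
    epochAct d cd .solo (x v) (obsOf cd (soloActs x) t v) = soloActs x t v := by
  have : ∀ obs, epochAct d cd .solo (x v) obs =
      if obs.length = x v then beep else .listen := by
    rcases hcd with rfl | rfl <;> intro <;> rfl
  rw [this, length_obsOf]
  rfl

/-- A device listens in every slot except its own, so each draw different from its own reaches it as
a message or as noise. -/
theorem solo_fin (hcd : HasReceiverCD cd) (x : Fin n → ℕ) (v : Fin n) (b : Bool)
    (hb : b = true ↔ ∃ t < N, t ≠ x v ∧ ∃ u, x u = t) :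
    epochFin d N cd .solo (x v) (obsOf cd (soloActs x) N v) = .inl (.soloEnd b) := by
  have : ∀ obs, epochFin d N cd .solo (x v) obs =
      .inl (.soloEnd ((List.range N).any fun t => t != x v && nonsilent (obs.getD t none))) := by
    rcases hcd with rfl | rfl <;> intro <;> rfl
  rw [this]
  congr 2
  rw [Bool.eq_iff_iff, hb, List.any_eq_true]
  refine exists_congr fun t => ?_
  rw [List.mem_range]
  refine and_congr_right fun ht => ?_
  rw [Bool.and_eq_true, bne_iff_ne]
  refine and_congr_right fun htx => ?_
  rw [obsOf_getD _ _ ht, show soloActs x t v = .listen by simp [soloActs, htx],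
    nonsilent_listen hcd]
  refine exists_congr fun u => ?_
  by_cases hu : t = x u
  · simp [soloActs, hu, beep, Action.sent]
  · simp [soloActs, hu, Action.sent, Ne.symm hu]

theorem soloEnd_step {E T T' e : ℕ} {C F : ℝ} (hF : 0 ≤ F) (hT : 1 + T' ≤ T)
    (hnext : ∀ (D : Fin n → Device (protocol d N cd).alg) (T : ℕ),
      Conf d N cd (.small 0 0) (e + 1) D → T' ≤ T →
      FailLE (protocol d N cd) cd (goodSet (protocol d N cd) n C E) D T F)
    (D : Fin n → Device (protocol d N cd).alg) (h : Conf d N cd (.soloEnd true) e D) :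
    FailLE (protocol d N cd) cd (goodSet (protocol d N cd) n C E) D T F :=
  (h.fail_epoch (L := 1) (M := 1) rfl one_pos rfl one_pos (by omega) (fun _ => F)
    (fun _ _ => hF) (fun _ _ _ => .idle) (fun _ _ _ _ _ => rfl) (fun _ _ => .inr (.inl
      ⟨.small 0 0, fun _ => rfl, fun D' hD' => hnext D' _ hD' (by omega)⟩))).mono
    (avg_const (fun _ => one_pos) F).le

theorem soloEnd_one {E T e : ℕ} {C : ℝ} (hC : 1 ≤ C) (hE : e + 1 ≤ E) (hT : 1 ≤ T)
    (D : Fin 1 → Device (protocol d N cd).alg) (h : Conf d N cd (.soloEnd false) e D) {ε : ℝ}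
    (hε : 0 ≤ ε) :
    FailLE (protocol d N cd) cd (goodSet (protocol d N cd) 1 C E) D T ε :=
  (h.fail_epoch (L := 1) (M := 1) rfl one_pos rfl one_pos hT (fun _ => ε) (fun _ _ => hε)
    (fun _ _ _ => beep) (fun _ _ _ _ _ => rfl) (fun _ _ => .inr (.inr
      ⟨fun _ => ⟨1, .leader⟩, fun _ => rfl, solved_single hC _ rfl, hE⟩))).mono
    (avg_const (fun _ => one_pos) ε).le

theorem solo_receiver_one (hcd : HasReceiverCD cd) {E T : ℕ} {C : ℝ} (hC : 1 ≤ C) (hN : 0 < N)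
    (hE : N + 1 ≤ E) (hT : N + 1 ≤ T)
    (D : Fin 1 → Device (protocol d N cd).alg) (h : Conf d N cd .solo 0 D) {ε : ℝ}
    (hε : 0 ≤ ε) :
    FailLE (protocol d N cd) cd (goodSet (protocol d N cd) 1 C E) D T ε := by
  refine (h.fail_epoch (L := N) (M := N) (solo_len hcd) hN (solo_size hcd) hN (by omega)
    (fun _ => ε) (fun _ _ => hε) soloActs (fun x _ t _ v => solo_act hcd x t v)
    (fun x _ => .inr (.inl ⟨_, fun v => solo_fin hcd x v false ?_,
      fun D' hD' => soloEnd_one hC (by omega) (by omega) D' hD' hε⟩))).mono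
    (avg_const (fun _ => hN) ε).le
  simp only [Bool.false_eq_true, false_iff]
  rintro ⟨t, _, ht, u, hu⟩
  exact ht (by rw [← hu, Subsingleton.elim u v])

open Classical in
-- The test errs only if all draws coincide, which has probability `N * (1 / N) ^ n`. Otherwise
-- every device has some draw other than its own to hear, and all of them move on together.
theorem solo_receiver (hcd : HasReceiverCD cd) {E T T' : ℕ} {C F : ℝ} (hn : 2 ≤ n) (hN : 0 < N)
    (hF : 0 ≤ F) (hT : N + 1 + T' ≤ T)
    (hnext : ∀ (D : Fin n → Device (protocol d N cd).alg) (T : ℕ),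
      Conf d N cd (.small 0 0) (N + 1) D → T' ≤ T →
      FailLE (protocol d N cd) cd (goodSet (protocol d N cd) n C E) D T F)
    (D : Fin n → Device (protocol d N cd).alg) (h : Conf d N cd .solo 0 D) :
    FailLE (protocol d N cd) cd (goodSet (protocol d N cd) n C E) D T
      ((1 / N : ℝ) ^ (n - 1) + F) := by
  have hN' : (0 : ℝ) < N := by exact_mod_cast hN
  refine (h.fail_epoch (L := N) (M := N) (solo_len hcd) hN (solo_size hcd) hN (by omega)
    (fun x => (if ∃ k ∈ range N, ∀ v, x v = k then 1 else 0) + F)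
    (fun x _ => add_nonneg (by split_ifs <;> norm_num) hF)
    soloActs (fun x _ t _ v => solo_act hcd x t v) (fun x hx => ?_)).mono ?_
  · by_cases hs : ∃ k ∈ range N, ∀ v, x v = k
    · rw [if_pos hs]
      exact .inl (by linarith)
    · rw [if_neg hs, zero_add]
      refine .inr (.inl ⟨_, fun v => solo_fin hcd x v true ?_, fun D' hD' =>
        soloEnd_step hF (by omega) hnext D' (by rwa [zero_add] at hD')⟩)
      simp only [true_iff]
      by_contra hcon
      apply hs
      refine ⟨x v, mem_range.2 (hx v), fun u => ?_⟩
      by_contra hu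
      exact hcon ⟨x u, hx u, hu, u, rfl⟩
  · rw [avg_add, avg_const fun _ => hN]
    gcongr
    refine (avg_exists_le (range N) fun k x => ∀ v, x v = k).trans ?_
    have h1 : ∀ k ∈ range N, avg (fun _ : Fin n => N)
        (fun x => if ∀ v, x v = k then (1 : ℝ) else 0) = (1 / N : ℝ) ^ n := by
      intro k hk
      have : (fun x : Fin n → ℕ => if ∀ v, x v = k then (1 : ℝ) else 0) =
          fun x => ∏ v, if x v = k then 1 else 0 := by
        funext x
        rw [Finset.prod_ite_zero]
        simp
      rw [this, avg_prod fun _ j => if j = k then (1 : ℝ) else 0]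
      simp only [Finset.sum_ite_eq', hk, if_true, Finset.prod_const, card_univ, Fintype.card_fin]
    rw [Finset.sum_congr rfl h1, Finset.sum_const, card_range, nsmul_eq_mul]
    obtain ⟨k, rfl⟩ : ∃ k, n = k + 1 := ⟨n - 1, by omega⟩
    rw [Nat.add_sub_cancel, pow_succ]
    field_simp
    exact le_rfl

end Solo

/-! ### Unbounded binary search for the stage -/

section Search

variable {n : ℕ} {d : ℕ → ℕ} {N : ℕ} {cd : CDModel}

/-- The actions in a test of the network size. -/
def searchActs (x : Fin n → ℕ) (_ : ℕ) (v : Fin n) : Action Msg :=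
  if x v = 0 then beep else .listen

/-- The memory after a test. -/
def searchNext (lo hi : ℕ) (b : Prop) [Decidable b] : Mem :=
  if b then if hi = probe lo hi + 1 then .pick (probe lo hi) else .search (probe lo hi) hi
  else if probe lo hi = lo + 1 then .pick lo else .search lo (probe lo hi)

/-- Senders know that somebody drew `0`; only listeners need collision detection to agree with them.
-/
theorem search_bit (hcd : HasReceiverCD cd) (x : Fin n → ℕ) (v : Fin n) :
    (x v = 0 ∨ nonsilent ((obsOf cd (searchActs x) 1 v).getD 0 none) = true) ↔
      ∃ u, x u = 0 := by
  by_cases hv : x v = 0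
  · simp only [hv, true_or, true_iff]
    exact ⟨v, hv⟩
  · rw [obsOf_getD _ _ one_pos, show searchActs x 0 v = .listen by simp [searchActs, hv],
      nonsilent_listen hcd]
    simp only [hv, false_or]
    refine exists_congr fun u => ?_
    by_cases hu : x u = 0
    · simp [searchActs, hu, beep, Action.sent]
    · simp [searchActs, hu, Action.sent]

theorem search_fin (hcd : HasReceiverCD cd) (lo hi : ℕ) (x : Fin n → ℕ) (v : Fin n)
    [Decidable (∃ u, x u = 0)] :
    epochFin d N cd (.search lo hi) (x v) (obsOf cd (searchActs x) 1 v) =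
      .inl (searchNext lo hi (∃ u, x u = 0)) := by
  rw [epochFin, searchNext]
  simp only [search_bit hcd]
  split_ifs <;> rfl

open Classical in
-- Probes `m ≥ I + 1` are expected to be silent and probes `m ≤ I - 2` are not; for `m = I - 1` and
-- `m = I` both answers are acceptable. Outside an event of probability `δ`, a nonsilent probe thus
-- yields `m ≤ I`, but a silent one only `I ≤ m + 1`.
theorem search_step (hcd : HasReceiverCD cd) {lo hi e E T I : ℕ} {C F δ : ℝ} (hF : 0 ≤ F)
    (hδ : 0 ≤ δ) (hT : 1 ≤ T)
    (hlow : ∀ m, m + 2 ≤ I → (1 - 1 / 2 ^ d m : ℝ) ^ n ≤ δ)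
    (hhigh : ∀ m, I + 1 ≤ m → (n : ℝ) / 2 ^ d m ≤ δ)
    (hyes : probe lo hi ≤ I → ∀ (D : Fin n → Device (protocol d N cd).alg),
      Conf d N cd (if hi = probe lo hi + 1 then .pick (probe lo hi)
        else .search (probe lo hi) hi) (e + 1) D →
      FailLE (protocol d N cd) cd (goodSet (protocol d N cd) n C E) D (T - 1) F)
    (hno : I ≤ probe lo hi + 1 → ∀ (D : Fin n → Device (protocol d N cd).alg),
      Conf d N cd (if probe lo hi = lo + 1 then .pick lo
        else .search lo (probe lo hi)) (e + 1) D →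
      FailLE (protocol d N cd) cd (goodSet (protocol d N cd) n C E) D (T - 1) F)
    (D : Fin n → Device (protocol d N cd).alg) (h : Conf d N cd (.search lo hi) e D) :
    FailLE (protocol d N cd) cd (goodSet (protocol d N cd) n C E) D T (δ + F) := by
  set m := probe lo hi with hm
  have hM : 0 < 2 ^ d m := by positivity
  set bad : (Fin n → ℕ) → Prop := fun x =>
    (I + 1 ≤ m ∧ ∃ u, x u = 0) ∨ (m + 2 ≤ I ∧ ¬ ∃ u, x u = 0) with hbad
  refine (h.fail_epoch (L := 1) (M := 2 ^ d m) rfl one_pos rfl hM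
    (by omega) (fun x => (if bad x then 1 else 0) + F)
    (fun x _ => add_nonneg (by split_ifs <;> norm_num) hF)
    searchActs (fun x _ t _ v => rfl) (fun x hx => ?_)).mono ?_
  · by_cases hb : bad x
    · rw [if_pos hb]
      exact .inl (by linarith)
    · rw [if_neg hb, zero_add]
      refine .inr (.inl ⟨_, fun v => search_fin hcd lo hi x v, fun D' hc => ?_⟩)
      by_cases hu : ∃ u, x u = 0
      · rw [searchNext, if_pos hu] at hc
        refine hyes ?_ _ hc
        by_contra hcon
        exact hb (Or.inl ⟨by omega, hu⟩)
      · rw [searchNext, if_neg hu] at hc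
        refine hno ?_ _ hc
        by_contra hcon
        exact hb (Or.inr ⟨by omega, hu⟩)
  · rw [avg_add, avg_const fun _ => hM]
    gcongr
    have hp : (0 : ℝ) < 2 ^ d m := by positivity
    by_cases h1 : I + 1 ≤ m
    · have h2 : ∀ x, (if bad x then (1 : ℝ) else 0) ≤
          if ∃ u ∈ (univ : Finset (Fin n)), x u = 0 then 1 else 0 := by
        intro x
        by_cases hb : bad x
        · rw [if_pos hb, if_pos]
          rcases hb with hb | hb
          · simpa using hb.2
          · omega
        · rw [if_neg hb]
          split_ifs <;> norm_num
      refine (avg_mono fun x _ => h2 x).trans ((avg_exists_le univ fun u x => x u = 0).trans ?_)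
      refine le_trans (le_of_eq ?_) (hhigh m h1)
      have h3 : ∀ u : Fin n, avg (fun _ : Fin n => 2 ^ d m)
          (fun x => if x u = 0 then (1 : ℝ) else 0) = 1 / 2 ^ d m := by
        intro u
        have : (fun x : Fin n → ℕ => if x u = 0 then (1 : ℝ) else 0) =
            fun x => ∏ v, if v = u then (if x v = 0 then 1 else 0) else 1 := by
          funext x
          rw [Finset.prod_ite_eq' univ u fun v => if x v = 0 then (1 : ℝ) else 0]
          simp
        rw [this, avg_prod fun v j => if v = u then (if j = 0 then (1 : ℝ) else 0) else 1,
          Finset.prod_eq_single u]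
        · simp
        · intro v _ hv
          simp [hv]
        · simp
      rw [Finset.sum_congr rfl fun u _ => h3 u]
      simp [div_eq_mul_inv]
    · by_cases h2 : m + 2 ≤ I
      · have h3 : ∀ x, (if bad x then (1 : ℝ) else 0) ≤ ∏ v, if x v = 0 then 0 else 1 := by
          intro x
          by_cases hb : bad x
          · rw [if_pos hb, Finset.prod_eq_one]
            intro v _
            rcases hb with hb | hb
            · omega
            · rw [if_neg]
              exact fun h0 => hb.2 ⟨v, h0⟩
          · rw [if_neg hb]
            exact Finset.prod_nonneg fun v _ => by split_ifs <;> norm_num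
        refine (avg_mono fun x _ => h3 x).trans ?_
        rw [avg_prod fun v j => if j = 0 then (0 : ℝ) else 1]
        refine le_trans (le_of_eq ?_) (hlow m h2)
        rw [Finset.prod_const, card_univ, Fintype.card_fin]
        congr 1
        obtain ⟨M, hM'⟩ : ∃ M, 2 ^ d m = M + 1 := ⟨2 ^ d m - 1, by omega⟩
        have hM'' : (2 : ℝ) ^ d m = M + 1 := by exact_mod_cast hM'
        rw [hM', Finset.sum_range_succ', hM'']
        have : (M : ℝ) + 1 ≠ 0 := by positivity
        simp
        field_simp
        ring
      · refine le_trans (le_of_eq ?_) hδ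
        refine (avg_congr fun x _ => ?_).trans (avg_const (fun _ : Fin n => hM) 0)
        have hb : ¬ bad x := by
          rintro (⟨h, _⟩ | ⟨h, _⟩)
          exacts [h1 h, h2 h]
        exact if_neg hb

/-- The binary search. -/
theorem binary_search (hcd : HasReceiverCD cd) {E T' I e' : ℕ} {C F δ : ℝ} (hF : 0 ≤ F)
    (hδ : 0 ≤ δ)
    (hlow : ∀ m, m + 2 ≤ I → (1 - 1 / 2 ^ d m : ℝ) ^ n ≤ δ)
    (hhigh : ∀ m, I + 1 ≤ m → (n : ℝ) / 2 ^ d m ≤ δ)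
    (hnext : ∀ i e, I ≤ i + 2 → i ≤ I → e ≤ e' →
      ∀ (D : Fin n → Device (protocol d N cd).alg) (T : ℕ), Conf d N cd (.pick i) e D → T' ≤ T →
      FailLE (protocol d N cd) cd (goodSet (protocol d N cd) n C E) D T F)
    (s : ℕ) : ∀ lo hi e T : ℕ, lo + 1 < hi → lo ≤ I → I ≤ hi + 1 → hi ≤ lo + 2 ^ s →
      e + s ≤ e' → s + T' ≤ T → ∀ (D : Fin n → Device (protocol d N cd).alg),
      Conf d N cd (.search lo hi) e D →
      FailLE (protocol d N cd) cd (goodSet (protocol d N cd) n C E) D T (s * δ + F) := by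
  induction s with
  | zero => intro lo hi e T h1 _ _ h2; simp at h2; omega
  | succ s ih =>
    intro lo hi e T h1 h2 h3 h4 he hT D h
    have hp : probe lo hi = (lo + hi) / 2 := by rw [probe, if_neg (by omega)]
    have hs : (0 : ℝ) ≤ s * δ := by positivity
    rw [pow_succ] at h4
    -- The invariant is `lo ≤ I ≤ hi + 1`, so an interval with `hi = lo + 1` leaves `lo ≤ I ≤ lo +
    -- 2`.
    refine (search_step hcd (F := s * δ + F) (by positivity) hδ (by omega) hlow hhigh ?_ ?_ D
      h).mono (by push_cast; linarith)
    · intro hm D' hD'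
      split_ifs at hD' with hc
      · exact (hnext _ _ (by omega) hm (by omega) D' (T - 1) hD' (by omega)).mono (by linarith)
      · exact ih _ _ _ _ (by omega) hm h3 (by omega) (by omega) (by omega) D' hD'
    · intro hm D' hD'
      split_ifs at hD' with hc
      · exact (hnext _ _ (by omega) h2 (by omega) D' (T - 1) hD' (by omega)).mono (by linarith)
      · exact ih _ _ _ _ (by omega) h2 hm (by omega) (by omega) (by omega) D' hD'

/-- The doubling search. -/
theorem doubling_search (hcd : HasReceiverCD cd) {E T' I e' : ℕ} {C F δ : ℝ} (hF : 0 ≤ F)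
    (hδ : 0 ≤ δ)
    (hlow : ∀ m, m + 2 ≤ I → (1 - 1 / 2 ^ d m : ℝ) ^ n ≤ δ)
    (hhigh : ∀ m, I + 1 ≤ m → (n : ℝ) / 2 ^ d m ≤ δ)
    (hnext : ∀ i e, I ≤ i + 2 → i ≤ I → e ≤ e' →
      ∀ (D : Fin n → Device (protocol d N cd).alg) (T : ℕ), Conf d N cd (.pick i) e D → T' ≤ T →
      FailLE (protocol d N cd) cd (goodSet (protocol d N cd) n C E) D T F)
    {K : ℕ} (hK : I + 2 ≤ 2 ^ K) (r : ℕ) : ∀ t e T : ℕ, t + r = K → 2 ^ t - 1 ≤ I →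
      e + (r + K) ≤ e' → r + K + T' ≤ T → ∀ (D : Fin n → Device (protocol d N cd).alg),
      Conf d N cd (.search (2 ^ t - 1) 0) e D →
      FailLE (protocol d N cd) cd (goodSet (protocol d N cd) n C E) D T ((r + K) * δ + F) := by
  induction r with
  | zero =>
    -- Here `2 ^ K - 1 ≤ I` contradicts `I + 2 ≤ 2 ^ K`: the doubling has stopped earlier.
    intro t e T ht h1
    rw [add_zero] at ht
    subst ht
    omega
  | succ r ih =>
    intro t e T ht h1 he hT D h
    have h2t := Nat.one_le_two_pow (n := t)
    -- `hi = 0` encodes that no upper bound is known yet.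
    have hp : probe (2 ^ t - 1) 0 = 2 ^ (t + 1) - 1 := by
      rw [probe, if_pos rfl, pow_succ]
      omega
    have hKδ : (0 : ℝ) ≤ (r + K) * δ := by positivity
    refine (search_step hcd (F := (r + K) * δ + F) (by positivity) hδ (by omega) hlow hhigh ?_ ?_
      D h).mono (by push_cast; linarith)
    · intro hm D' hD'
      rw [if_neg (by omega), hp] at hD'
      exact ih (t + 1) _ _ (by omega) (by rwa [hp] at hm) (by omega) (by omega) D' hD'
    · intro hm D' hD'
      rw [hp] at hm hD'
      split_ifs at hD' with hc
      · exact (hnext _ _ (by omega) h1 (by omega) D' (T - 1) hD' (by omega)).mono (by linarith)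
      · refine (binary_search hcd hF hδ hlow hhigh hnext t _ _ _ _ ?_ h1 hm ?_ ?_ ?_ D'
          hD').mono ?_
        · rw [pow_succ] at hc ⊢; omega
        · rw [pow_succ]; omega
        · omega
        · omega
        · have : (t : ℝ) ≤ r + K := by
            have : t ≤ r + K := by omega
            exact_mod_cast this
          nlinarith

end Search

/-! ### One round of a stage -/

section Round

variable {n : ℕ} {cd : CDModel}

/-- The device is a candidate in round `j`. -/
def CandIn (d j : ℕ) (r : Fin n → Duty) (x : Fin n → ℕ) (v : Fin n) : Prop :=
  r v = .cand j ∧ x v < blockLen d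

/-- The device transmits in slot `τ` of the broadcast in round `j`. -/
def Sends (d j : ℕ) (r : Fin n → Duty) (info : Fin n → Option (Bool × ℕ)) (x : Fin n → ℕ)
    (τ : ℕ) (v : Fin n) : Prop :=
  (info v).isSome ∧ ∃ l w, r v = .relay j l w ∧ x v ≠ 0 ∧ Nat.log 2 (x v) ≤ d ∧
    τ = Nat.log 2 (x v) * attempts d + w

/-- The broadcast in round `j` succeeds in slot `τ`. -/
def BlockOK (d j : ℕ) (r : Fin n → Duty) (info : Fin n → Option (Bool × ℕ)) (x : Fin n → ℕ)
    (τ : ℕ) : Prop :=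
  ∃! v, Sends d j r info x τ v

open Classical in
/-- Whether there is exactly one candidate in round `j`. -/
noncomputable def single (d j : ℕ) (r : Fin n → Duty) (x : Fin n → ℕ) : Bool :=
  decide (∃! v, CandIn d j r x v)

/-- The message broadcast in round `j`. -/
noncomputable def roundMsg (d j : ℕ) (r : Fin n → Duty) (x : Fin n → ℕ) (f : Bool) (c : ℕ) : Msg :=
  (single d j r x, f, newCount d j (single d j r x) c)

/-- The device becomes the leader in round `j`. -/
def Elected (d j : ℕ) (r : Fin n → Duty) (info : Fin n → Option (Bool × ℕ)) (x : Fin n → ℕ)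
    (f : Bool) (c : ℕ) (v : Fin n) : Prop :=
  CandIn d j r x v ∧ BlockOK d j r info x (x v) ∧ leads d j (some (roundMsg d j r x f c)) = true

open Classical in
/-- The actions in round `j`. -/
noncomputable def roundActs (d j : ℕ) (r : Fin n → Duty) (info : Fin n → Option (Bool × ℕ))
    (f : Bool) (c : ℕ) (x : Fin n → ℕ) (t : ℕ) (v : Fin n) : Action Msg :=
  if t = 0 then
    if CandIn d j r x v then beep else if (info v).isSome then .listen else .idle
  else if t = blockLen d + 1 then
    if Elected d j r info x f c v then beep
    else if ∃ l w, r v = .relay (j + 1) l w ∧ BlockOK d j r info x l then .listen else .idle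
  else if CandIn d j r x v ∧ t = 1 + x v then .listen
  else if Sends d j r info x (t - 1) v then .transmit (roundMsg d j r x f c)
  else if ∃ l w, r v = .relay (j + 1) l w ∧ t = 1 + l then .listen
  else .idle

/-- The relays have admissible slots. -/
def RolesOK (d : ℕ) (r : Fin n → Duty) : Prop :=
  ∀ v j l w, r v = .relay j l w → l < blockLen d ∧ w < attempts d

/-- Only relays of round `j` are informed, and their information is `(f, c)`. -/
def InfoOK (j : ℕ) (r : Fin n → Duty) (info : Fin n → Option (Bool × ℕ)) (f : Bool) (c : ℕ) :
    Prop :=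
  ∀ v p, info v = some p → p = (f, c) ∧ ∃ l w, r v = .relay j l w

variable {d j c : ℕ} {r : Fin n → Duty} {info : Fin n → Option (Bool × ℕ)} {f : Bool}
  {x : Fin n → ℕ}

theorem Sends.lt (hr : RolesOK d r) {τ : ℕ} {v : Fin n} (h : Sends d j r info x τ v) :
    τ < blockLen d := by
  obtain ⟨_, l, w, hv, _, hlog, rfl⟩ := h
  have := (hr v j l w hv).2
  have h2 : Nat.log 2 (x v) * attempts d ≤ d * attempts d := Nat.mul_le_mul_right _ hlog
  rw [blockLen, add_mul, one_mul]
  omega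

theorem Elected.single_eq {v : Fin n} (h : Elected d j r info x f c v) :
    single d j r x = true := by
  have := h.2.2
  simp only [leads, roundMsg, Bool.and_eq_true] at this
  exact this.1.1

open Classical in
-- Election requires the broadcast to certify a single candidate, so two devices elected in the same
-- round are both that candidate.
theorem Elected.unique {u v : Fin n} (hu : Elected d j r info x f c u)
    (hv : Elected d j r info x f c v) : u = v := by
  have := (decide_eq_true_iff (p := ∃! v, CandIn d j r x v)).1 hu.single_eq
  exact this.unique hu.1 hv.1

open Classical in
theorem heard_round_zero :
    heard (some (channel (roundActs d j r info f c x 0))) =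
      if single d j r x then some (false, false, 0) else none := by
  rw [heard_channel (p := CandIn d j r x) (m := (false, false, 0))]
  · simp [single]
  · intro v hv; simp [roundActs, hv, beep]
  · intro v hv
    simp only [roundActs, hv, if_true, if_false]
    split_ifs <;> rfl

open Classical in
theorem heard_round_block {τ : ℕ}
    (hτ : τ < blockLen d) :
    heard (some (channel (roundActs d j r info f c x (1 + τ)))) =
      if BlockOK d j r info x τ then some (roundMsg d j r x f c) else none := by
  have h0 : 1 + τ ≠ 0 := by omega
  have h1 : 1 + τ ≠ blockLen d + 1 := by omega
  rw [heard_channel (p := Sends d j r info x τ) (m := roundMsg d j r x f c)]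
  · rfl
  · intro v hv
    have hc : ¬ CandIn d j r x v := by
      obtain ⟨_, l, w, h, _⟩ := hv
      rintro ⟨h', _⟩
      rw [h] at h'
      cases h'
    simp [roundActs, h1, hv, hc]
  · intro v hv
    simp only [roundActs, h0, h1, if_false, Nat.add_sub_cancel_left, hv]
    split_ifs <;> rfl

open Classical in
theorem heard_round_last :
    heard (some (channel (roundActs d j r info f c x (blockLen d + 1)))) =
      if ∃ v, Elected d j r info x f c v then some (false, false, 0) else none := by
  rw [heard_channel (p := Elected d j r info x f c) (m := (false, false, 0))]
  · have : (∃! v, Elected d j r info x f c v) ↔ ∃ v, Elected d j r info x f c v :=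
      ⟨fun h => h.exists, fun ⟨v, hv⟩ => ⟨v, hv, fun u hu => hu.unique hv⟩⟩
    simp only [this]
  · intro v hv; simp [roundActs, hv, beep]
  · intro v hv
    simp only [roundActs, hv, if_true, if_false, Nat.succ_ne_zero]
    split_ifs <;> rfl

theorem got_round_zero (hi : InfoOK j r info f c) {v : Fin n} (hv : (info v).isSome) {t : ℕ}
    (ht : 0 < t) :
    (got (obsOf cd (roundActs d j r info f c x) t v) 0).isSome = single d j r x := by
  have hc : ¬ CandIn d j r x v := by
    obtain ⟨p, hp⟩ := Option.isSome_iff_exists.1 hv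
    obtain ⟨_, l, w, h⟩ := hi v p hp
    rintro ⟨h', _⟩
    rw [h] at h'
    cases h'
  rw [got_obsOf ht (by simp [roundActs, hv, hc]), heard_round_zero]
  cases single d j r x <;> rfl

open Classical in
theorem got_round_cand {v : Fin n}
    (hv : CandIn d j r x v) {t : ℕ} (ht : 1 + x v < t) :
    got (obsOf cd (roundActs d j r info f c x) t v) (1 + x v) =
      if BlockOK d j r info x (x v) then some (roundMsg d j r x f c) else none := by
  have h1 : 1 + x v ≠ blockLen d + 1 := by have := hv.2; omega
  have h2 : x v ≠ blockLen d := by have := hv.2; omega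
  rw [got_obsOf ht (by simp [roundActs, h1, hv]), heard_round_block hv.2]

open Classical in
theorem got_round_relay (hr : RolesOK d r) {v : Fin n} {l w : ℕ}
    (hv : r v = .relay (j + 1) l w) {t : ℕ} (ht : 1 + l < t) :
    got (obsOf cd (roundActs d j r info f c x) t v) (1 + l) =
      if BlockOK d j r info x l then some (roundMsg d j r x f c) else none := by
  have hl := (hr v _ l w hv).1
  have h1 : l ≠ blockLen d := by omega
  have hc : ¬ CandIn d j r x v := by
    rintro ⟨h', _⟩
    rw [hv] at h'
    cases h'
  have hs : ¬ Sends d j r info x l v := by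
    rintro ⟨_, l', w', h, _⟩
    rw [hv] at h
    injection h with h
    omega
  refine (got_obsOf ht ?_).trans (heard_round_block hl)
  have h2 : 1 + l ≠ blockLen d + 1 := by omega
  have h3 : 1 + l ≠ 0 := by omega
  simp only [roundActs, h3, h2, if_false, hc, false_and, Nat.add_sub_cancel_left, hs]
  rw [if_pos ⟨l, w, hv, rfl⟩]

open Classical in
-- Whoever received the broadcast also hears the acknowledgement. Hence the flag that is passed on
-- cannot disagree with the actual leadership.
theorem got_round_ack {v : Fin n} {l w : ℕ}
    (hv : r v = .relay (j + 1) l w) (hb : BlockOK d j r info x l) {t : ℕ}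
    (ht : blockLen d + 1 < t) :
    got (obsOf cd (roundActs d j r info f c x) t v) (blockLen d + 1) =
      if ∃ v, Elected d j r info x f c v then some (false, false, 0) else none := by
  have he : ¬ Elected d j r info x f c v := by
    rintro ⟨⟨h', _⟩, _⟩
    rw [hv] at h'
    cases h'
  refine (got_obsOf ht ?_).trans heard_round_last
  simp only [roundActs, Nat.succ_ne_zero, if_false, if_true, he]
  rw [if_pos ⟨l, w, hv, hb⟩]

open Classical in
-- The local program, which sees only its own observations, follows the global description
-- `roundActs`. The cases are a candidate, a relay that is still uninformed, and an informed relay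
-- of round `j`.
theorem roundAct_eq (hr : RolesOK d r) (hi : InfoOK j r info f c) {t : ℕ}
    (ht : t < blockLen d + 2) (v : Fin n) :
    roundAct d j (r v) (info v) (x v) (obsOf cd (roundActs d j r info f c x) t v) =
      roundActs d j r info f c x t v := by
  rcases hrv : r v with j' | ⟨j', l, w⟩
  · have hinfo : info v = none := by
      by_contra h
      obtain ⟨p, hp⟩ := Option.ne_none_iff_exists'.1 h
      obtain ⟨_, l, w, h⟩ := hi v p hp
      rw [hrv] at h
      cases h
    have hs : ∀ τ, ¬ Sends d j r info x τ v := by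
      rintro τ ⟨h, _⟩
      simp [hinfo] at h
    have hrel : ∀ p : ℕ → ℕ → Prop, ¬ ∃ l w, r v = .relay (j + 1) l w ∧ p l w := by
      rintro p ⟨l, w, h, _⟩
      rw [hrv] at h
      cases h
    have hc : CandIn d j r x v ↔ j' = j ∧ x v < blockLen d := by simp [CandIn, hrv]
    have hrel1 := hrel fun l _ => BlockOK d j r info x l
    have hrel2 := hrel fun l _ => t = 1 + l
    simp only [roundAct, length_obsOf, roundActs, hinfo, hs, hrel1, hrel2, if_false, ← hc]
    by_cases hcv : CandIn d j r x v
    · simp only [hcv, if_true, true_and]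
      by_cases h0 : t = 0
      · simp [h0]
      by_cases h1 : t = blockLen d + 1
      · simp only [h1, if_true, Nat.succ_ne_zero, if_false]
        rw [← h1]
        have hx := hcv.2
        rw [got_round_cand hcv (by omega)]
        have : leads d j (if BlockOK d j r info x (x v) then some (roundMsg d j r x f c) else none)
            = true ↔ Elected d j r info x f c v := by
          rw [Elected]
          by_cases hb : BlockOK d j r info x (x v)
          · simp [hb, hcv]
          · simp [hb, leads]
        simp only [this]
      · simp [h0, h1]
    · have he : ¬ Elected d j r info x f c v := fun h => hcv h.1
      simp [hcv, he]
  · have hc : ¬ CandIn d j r x v := by simp [CandIn, hrv]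
    have he : ¬ Elected d j r info x f c v := fun h => hc h.1
    have hlw := hr v j' l w hrv
    rcases hinfo : info v with _ | ⟨f', c'⟩
    · have hs : ∀ τ, ¬ Sends d j r info x τ v := by
        rintro τ ⟨h, _⟩
        simp [hinfo] at h
      have hrel : ∀ p : ℕ → ℕ → Prop,
          (∃ l w, r v = .relay (j + 1) l w ∧ p l w) ↔ j' = j + 1 ∧ p l w := by
        intro p
        constructor
        · rintro ⟨l', w', h, hp⟩
          rw [hrv] at h
          cases h
          exact ⟨rfl, hp⟩
        · rintro ⟨rfl, hp⟩
          exact ⟨l, w, hrv, hp⟩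
      have hrel1 := hrel fun l _ => BlockOK d j r info x l
      have hrel2 := hrel fun l _ => t = 1 + l
      simp only [roundAct, length_obsOf, roundActs, hinfo, hs, hc, he, false_and, if_false,
        Option.isSome_none, hrel1, hrel2]
      by_cases hj : j' = j + 1
      · subst hj
        by_cases h0 : t = 0
        · subst h0
          simp
          omega
        by_cases h1 : t = blockLen d + 1
        · subst h1
          have h2 : blockLen d + 1 ≠ 1 + l := by omega
          simp only [if_true, true_and, h2, if_false, Nat.succ_ne_zero]
          rw [got_round_relay hr hrv (by omega)]
          by_cases hb : BlockOK d j r info x l <;> simp [hb]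
        · simp [h0, h1]
      · simp [hj]
    · have hv : (info v).isSome := by simp [hinfo]
      obtain ⟨hp, l', w', h⟩ := hi v _ hinfo
      rw [hrv] at h
      cases h
      cases hp
      have hrel : ∀ p : ℕ → ℕ → Prop, ¬ ∃ l w, r v = .relay (j + 1) l w ∧ p l w := by
        rintro p ⟨l, w, h, _⟩
        rw [hrv] at h
        injection h with h
        omega
      have hs : ∀ τ, Sends d j r info x τ v ↔ x v ≠ 0 ∧ Nat.log 2 (x v) ≤ d ∧
          τ = Nat.log 2 (x v) * attempts d + w := by
        intro τ
        constructor
        · rintro ⟨_, l', w', h, h'⟩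
          rw [hrv] at h
          cases h
          exact h'
        · intro h'
          exact ⟨hv, l, w, hrv, h'⟩
      have hrel1 := hrel fun l _ => BlockOK d j r info x l
      have hrel2 := hrel fun l _ => t = 1 + l
      by_cases h0 : t = 0
      · simp [roundAct, length_obsOf, roundActs, hc, h0, hinfo]
      · have hg := got_round_zero (cd := cd) (d := d) (x := x) hi hv (Nat.pos_of_ne_zero h0)
        simp only [roundAct, length_obsOf, h0, if_false, hg]
        by_cases h1 : t = blockLen d + 1
        · have : ¬ (x v ≠ 0 ∧ Nat.log 2 (x v) ≤ d ∧
              t = 1 + (Nat.log 2 (x v) * attempts d + w)) := by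
            rintro ⟨hx0, hx1, hx2⟩
            have := Sends.lt hr ((hs _).2 ⟨hx0, hx1, rfl⟩)
            omega
          simp only [roundActs, h1, if_true, if_false, he, hrel1] at this ⊢
          rw [if_neg this]
          simp
        · have : (t = 1 + (Nat.log 2 (x v) * attempts d + w)) ↔
              t - 1 = Nat.log 2 (x v) * attempts d + w := by omega
          simp only [roundActs, h0, h1, if_false, hc, false_and, hs, hrel2, this]
          rfl

open Classical in
/-- Whether a leader is elected in round `j`. -/
noncomputable def electedIn (d j : ℕ) (r : Fin n → Duty) (info : Fin n → Option (Bool × ℕ))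
    (x : Fin n → ℕ) (f : Bool) (c : ℕ) : Bool :=
  decide (∃ v, Elected d j r info x f c v)

open Classical in
/-- The information after round `j`. -/
noncomputable def infoAfter (d j : ℕ) (r : Fin n → Duty) (info : Fin n → Option (Bool × ℕ))
    (f : Bool) (c : ℕ) (x : Fin n → ℕ) (v : Fin n) : Option (Bool × ℕ) :=
  if ∃ l w, r v = .relay (j + 1) l w ∧ BlockOK d j r info x l then
    some (f || electedIn d j r info x f c, newCount d j (single d j r x) c)
  else none

open Classical in
theorem roundInfo_eq (hr : RolesOK d r) (v : Fin n) :
    roundInfo d j (r v) (obsOf cd (roundActs d j r info f c x) (blockLen d + 2) v) =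
      infoAfter d j r info f c x v := by
  rcases hrv : r v with j' | ⟨j', l, w⟩
  · simp [roundInfo, infoAfter, hrv]
  · by_cases hj : j' = j + 1
    · subst hj
      have hlw := hr v _ l w hrv
      simp only [roundInfo, if_true]
      rw [got_round_relay hr hrv (by omega)]
      by_cases hb : BlockOK d j r info x l
      · have h1 : ∃ l w, r v = .relay (j + 1) l w ∧ BlockOK d j r info x l := ⟨l, w, hrv, hb⟩
        rw [infoAfter, if_pos h1, got_round_ack hrv hb (by omega), if_pos hb]
        simp only [Option.map_some, roundMsg, electedIn]
        by_cases he : ∃ v, Elected d j r info x f c v <;> simp [he]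
      · have h1 : ¬ ∃ l w, r v = .relay (j + 1) l w ∧ BlockOK d j r info x l := by
          rintro ⟨l', w', h, h'⟩
          rw [hrv] at h
          cases h
          exact hb h'
        rw [infoAfter, if_neg h1, if_neg hb]
        rfl
    · have h1 : ¬ ∃ l w, r v = .relay (j + 1) l w ∧ BlockOK d j r info x l := by
        rintro ⟨l', w', h, h'⟩
        rw [hrv] at h
        cases h
        exact hj rfl
      rw [infoAfter, if_neg h1]
      simp [roundInfo, hj]

open Classical in
/-- The leadership after round `j`. -/
noncomputable def leadAfter (d j : ℕ) (r : Fin n → Duty) (info : Fin n → Option (Bool × ℕ))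
    (f : Bool) (c : ℕ) (lead : Fin n → Option ℕ) (x : Fin n → ℕ) (v : Fin n) : Option ℕ :=
  if Elected d j r info x f c v then some (d - j / scaleRounds d) else lead v

theorem roundLead_eq (lead : Fin n → Option ℕ)
    (v : Fin n) :
    roundLead d j (r v) (lead v) (x v)
        (obsOf cd (roundActs d j r info f c x) (blockLen d + 2) v) =
      leadAfter d j r info f c lead x v := by
  classical
  rcases hrv : r v with j' | ⟨j', l, w⟩
  · have hc : CandIn d j r x v ↔ j' = j ∧ x v < blockLen d := by simp [CandIn, hrv]
    simp only [roundLead, leadAfter, ← and_assoc, ← hc]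
    by_cases hcv : CandIn d j r x v
    · have hx := hcv.2
      rw [got_round_cand hcv (by omega)]
      have : (CandIn d j r x v ∧ leads d j (if BlockOK d j r info x (x v) then
          some (roundMsg d j r x f c) else none) = true) ↔ Elected d j r info x f c v := by
        rw [Elected]
        by_cases hb : BlockOK d j r info x (x v)
        · simp [hb]
        · simp [hb, leads]
      simp only [this]
    · have he : ¬ Elected d j r info x f c v := fun h => hcv h.1
      simp [hcv, he]
  · have hc : ¬ CandIn d j r x v := by simp [CandIn, hrv]
    have he : ¬ Elected d j r info x f c v := fun h => hc h.1
    simp [roundLead, leadAfter, he]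

/-- An upper bound for the energy spent in a stage before round `j`. -/
def spent (j : ℕ) : Duty → ℕ
  | .cand j' => if j' < j then 3 else 0
  | .relay j' _ _ => if j' < j then 4 else if j' = j then 2 else 0

/-- A candidate is awake in slot 0, in its listening slot and in the last slot. A relay uses at most
two slots of the round in which it is to receive and two of the round in which it sends. Other
rounds cost nothing, which makes the energy of a stage independent of `d`. -/
theorem round_cost (hi : InfoOK j r info f c) (v : Fin n) :
    spent j (r v) + ∑ t ∈ range (blockLen d + 2), (roundActs d j r info f c x t v).cost ≤
      spent (j + 1) (r v) := by
  classical
  rcases hrv : r v with j' | ⟨j', l, w⟩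
  · have hinfo : info v = none := by
      by_contra h
      obtain ⟨p, hp⟩ := Option.ne_none_iff_exists'.1 h
      obtain ⟨_, l, w, h⟩ := hi v p hp
      rw [hrv] at h
      cases h
    have hs : ∀ τ, ¬ Sends d j r info x τ v := by
      rintro τ ⟨h, _⟩
      simp [hinfo] at h
    have hrel : ∀ p : ℕ → ℕ → Prop, ¬ ∃ l w, r v = .relay (j + 1) l w ∧ p l w := by
      rintro p ⟨l, w, h, _⟩
      rw [hrv] at h
      cases h
    have hrel1 := hrel fun l _ => BlockOK d j r info x l
    by_cases hj : j' = j
    · have := sum_cost_le (fun t => roundActs d j r info f c x t v) (blockLen d + 2)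
        {0, 1 + x v, blockLen d + 1} fun t ht => by
          simp only [mem_insert, mem_singleton, not_or] at ht
          have hrel2 := hrel fun l _ => t = 1 + l
          simp only [roundActs, ht, hs, hrel2, and_false, if_false]
      have h3 : ({0, 1 + x v, blockLen d + 1} : Finset ℕ).card ≤ 3 := card_le_three
      subst hj
      simp only [spent, lt_irrefl, if_false, Nat.lt_succ_self, if_true]
      omega
    · have hc : ¬ CandIn d j r x v := by simp [CandIn, hrv, hj]
      have he : ¬ Elected d j r info x f c v := fun h => hc h.1
      have := sum_cost_le (fun t => roundActs d j r info f c x t v) (blockLen d + 2)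
        ∅ fun t ht => by
          have hrel2 := hrel fun l _ => t = 1 + l
          simp only [roundActs, hs, hrel1, hrel2, false_and, if_false, hc, he, hinfo,
            Option.isSome_none, Bool.false_eq_true, ite_self]
      simp only [card_empty, nonpos_iff_eq_zero] at this
      simp only [spent, this]
      split_ifs <;> omega
  · have hc : ¬ CandIn d j r x v := by simp [CandIn, hrv]
    have he : ¬ Elected d j r info x f c v := fun h => hc h.1
    rcases hinfo : info v with _ | ⟨f', c'⟩
    · have hs : ∀ τ, ¬ Sends d j r info x τ v := by
        rintro τ ⟨h, _⟩
        simp [hinfo] at h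
      by_cases hj : j' = j + 1
      · have := sum_cost_le (fun t => roundActs d j r info f c x t v) (blockLen d + 2)
          {1 + l, blockLen d + 1} fun t ht => by
            simp only [mem_insert, mem_singleton, not_or] at ht
            have hrel2 : ¬ ∃ l w, r v = .relay (j + 1) l w ∧ t = 1 + l := by
              rintro ⟨l', w', h, h'⟩
              rw [hrv] at h
              cases h
              exact ht.1 h'
            simp only [roundActs, ht, hs, hc, hinfo, Option.isSome_none, Bool.false_eq_true,
              false_and, if_false, ite_self, hrel2]
        have h3 : ({1 + l, blockLen d + 1} : Finset ℕ).card ≤ 2 := card_le_two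
        subst hj
        simp only [spent, lt_irrefl, if_false, if_true, if_neg (show ¬ j + 1 < j by omega),
          if_neg (show ¬ j + 1 = j by omega)]
        omega
      · have hrel : ∀ p : ℕ → ℕ → Prop, ¬ ∃ l w, r v = .relay (j + 1) l w ∧ p l w := by
          rintro p ⟨l, w, h, _⟩
          rw [hrv] at h
          injection h with h
          omega
        have hrel1 := hrel fun l _ => BlockOK d j r info x l
        have := sum_cost_le (fun t => roundActs d j r info f c x t v) (blockLen d + 2)
          ∅ fun t ht => by
            have hrel2 := hrel fun l _ => t = 1 + l
            simp only [roundActs, hs, hrel1, hrel2, false_and, if_false, hc, he, hinfo,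
              Option.isSome_none, Bool.false_eq_true, ite_self]
        simp only [card_empty, nonpos_iff_eq_zero] at this
        simp only [spent, this]
        split_ifs <;> omega
    · obtain ⟨hp, l', w', h⟩ := hi v _ hinfo
      rw [hrv] at h
      cases h
      have hrel : ∀ p : ℕ → ℕ → Prop, ¬ ∃ l w, r v = .relay (j + 1) l w ∧ p l w := by
        rintro p ⟨l, w, h, _⟩
        rw [hrv] at h
        injection h with h
        omega
      have hrel1 := hrel fun l _ => BlockOK d j r info x l
      have := sum_cost_le (fun t => roundActs d j r info f c x t v) (blockLen d + 2)
        {0, 1 + (Nat.log 2 (x v) * attempts d + w)} fun t ht => by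
          simp only [mem_insert, mem_singleton, not_or] at ht
          have hrel2 := hrel fun l _ => t = 1 + l
          have hs : ¬ Sends d j r info x (t - 1) v := by
            rintro ⟨_, l', w', h, _, _, h'⟩
            rw [hrv] at h
            cases h
            omega
          simp only [roundActs, ht, hs, hc, he, hrel1, hrel2, false_and, if_false, ite_self]
      have h3 : ({0, 1 + (Nat.log 2 (x v) * attempts d + w)} : Finset ℕ).card ≤ 2 := card_le_two
      simp only [spent, lt_irrefl, if_false, if_true, Nat.lt_succ_self]
      omega

/-- Information can get lost but never becomes inconsistent: all informed devices hold the same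
state, including whether a leader has just been elected. -/
theorem infoOK_infoAfter :
    InfoOK (j + 1) r (infoAfter d j r info f c x)
      (f || electedIn d j r info x f c)
      (newCount d j (single d j r x) c) := by
  classical
  intro v p hp
  rw [infoAfter] at hp
  split_ifs at hp with h
  obtain ⟨l, w, h, _⟩ := h
  exact ⟨(Option.some.inj hp).symm, l, w, h⟩

end Round

/-! ### Stages -/

section Stage

variable {n : ℕ} {d : ℕ → ℕ} {N : ℕ} {cd : CDModel}

/-- The numbers of possible draws in round `j`. -/
def roundSize (d j : ℕ) (r : Fin n → Duty) (info : Fin n → Option (Bool × ℕ)) (v : Fin n) : ℕ :=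
  match r v with
  | .cand j' => if j' = j then 2 ^ (d - j / scaleRounds d) * blockLen d else 1
  | .relay _ _ _ => if (info v).isSome then 2 ^ (d + 2) else 1

theorem attempts_pos {d : ℕ} (hd : 0 < d) : 0 < attempts d := by unfold attempts; positivity

theorem blockLen_pos {d : ℕ} (hd : 0 < d) : 0 < blockLen d := by
  have := attempts_pos hd
  unfold blockLen; positivity

theorem countRounds_pos {d : ℕ} (hd : 0 < d) : 0 < countRounds d := by unfold countRounds; positivity

theorem scaleRounds_pos {d : ℕ} (hd : 0 < d) : 0 < scaleRounds d := by
  have := countRounds_pos hd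
  unfold scaleRounds; positivity

theorem numRounds_pos {d : ℕ} (hd : 0 < d) : 0 < numRounds d := by
  have := scaleRounds_pos hd
  unfold numRounds; positivity

theorem numRoles_pos {d : ℕ} (hd : 0 < d) : 0 < numRoles d := by
  have := numRounds_pos hd
  unfold numRoles; positivity

theorem roundSize_pos {d : ℕ} (hd : 0 < d) (j : ℕ) (r : Fin n → Duty)
    (info : Fin n → Option (Bool × ℕ)) (v : Fin n) : 0 < roundSize d j r info v := by
  have := blockLen_pos hd
  rw [roundSize]
  split <;> split_ifs <;> positivity

theorem drawSize_round (i j : ℕ) (r : Fin n → Duty) (info : Fin n → Option (Bool × ℕ))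
    (l : Option ℕ) (v : Fin n) :
    drawSize d N cd (.round i j (r v) (info v) l) = roundSize (d i) j r info v := by
  rw [roundSize]
  cases r v <;> rfl

/-- The configurations in round `j` of stage `i`. -/
structure StageConf (d : ℕ → ℕ) (N : ℕ) (cd : CDModel) (i j : ℕ) (r : Fin n → Duty)
    (info : Fin n → Option (Bool × ℕ)) (lead : Fin n → Option ℕ) (e : ℕ)
    (D : Fin n → Device (protocol d N cd).alg) : Prop where
  state : ∀ v, (D v).state = .ready (Mem.round i j (r v) (info v) (lead v))
  elapsed : ∀ v w, (D v).elapsed = (D w).elapsed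
  energy : ∀ v, (D v).energy ≤ e + spent j (r v)

/-- The configurations at the end of stage `i`. -/
structure EndConf (d : ℕ → ℕ) (N : ℕ) (cd : CDModel) (i : ℕ) (lead : Fin n → Option ℕ) (e : ℕ)
    (D : Fin n → Device (protocol d N cd).alg) : Prop where
  state : ∀ v, (D v).state = .ready (Mem.announce i (lead v))
  elapsed : ∀ v w, (D v).elapsed = (D w).elapsed
  energy : ∀ v, (D v).energy ≤ e

/-- `found` is the scale at which a leader was elected. -/
def LeadOK (found : Option ℕ) (lead : Fin n → Option ℕ) : Prop :=
  match found with
  | none => ∀ v, lead v = none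
  | some k => ∃ l, lead l = some k ∧ ∀ v, v ≠ l → lead v = none

/-- The scale at which a leader was elected, after round `j`. -/
noncomputable def foundAfter (d j : ℕ) (r : Fin n → Duty) (info : Fin n → Option (Bool × ℕ))
    (found : Option ℕ) (c : ℕ) (x : Fin n → ℕ) : Option ℕ :=
  if electedIn d j r info x found.isSome c then some (d - j / scaleRounds d) else found

theorem leads_false {d j : ℕ} {r : Fin n → Duty} {x : Fin n → ℕ} {c : ℕ} :
    leads d j (some (roundMsg d j r x true c)) = false := by
  simp [leads, roundMsg]

theorem foundAfter_isSome {d' j : ℕ} {r : Fin n → Duty} {info : Fin n → Option (Bool × ℕ)}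
    {found : Option ℕ} {c : ℕ} {x : Fin n → ℕ} :
    (foundAfter d' j r info found c x).isSome =
      (found.isSome || electedIn d' j r info x found.isSome c) := by
  rw [foundAfter]
  cases electedIn d' j r info x found.isSome c <;> simp

/-- Once a leader exists, every circulating copy of the information has its flag set, and a set flag
makes `leads` false. Within one round uniqueness is `Elected.unique`. -/
theorem leadOK_after {d' j : ℕ} {r : Fin n → Duty} {info : Fin n → Option (Bool × ℕ)}
    {found : Option ℕ} {c : ℕ} {x : Fin n → ℕ} {lead : Fin n → Option ℕ}
    (h : LeadOK found lead) :
    LeadOK (foundAfter d' j r info found c x)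
      (leadAfter d' j r info found.isSome c lead x) := by
  classical
  by_cases he : ∃ v, Elected d' j r info x found.isSome c v
  · have hf : found = none := by
      rcases found with _ | k
      · rfl
      · obtain ⟨v, hv⟩ := he
        have := hv.2.2
        rw [Option.isSome_some, leads_false] at this
        cases this
    subst hf
    rw [foundAfter, if_pos (by simpa [electedIn] using he)]
    obtain ⟨l, hl⟩ := he
    refine ⟨l, by rw [leadAfter, if_pos hl], fun v hv => ?_⟩
    rw [leadAfter, if_neg fun h' => hv (h'.unique hl)]
    exact h v
  · rw [foundAfter, if_neg (by simpa [electedIn] using he)]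
    have : leadAfter d' j r info found.isSome c lead x = lead := by
      funext v
      rw [leadAfter, if_neg fun h' => he ⟨v, h'⟩]
    rwa [this]

/-- In contrast to `Conf.fail_epoch`, energy is charged role by role through `spent`, since a round
is much longer than what a device may spend in it. -/
theorem StageConf.fail_round {i j e T E c : ℕ} {C : ℝ} {r : Fin n → Duty}
    {info : Fin n → Option (Bool × ℕ)} {lead : Fin n → Option ℕ} {found : Option ℕ}
    {D : Fin n → Device (protocol d N cd).alg} (h : StageConf d N cd i j r info lead e D)
    (hd : 0 < d i) (hr : RolesOK (d i) r) (hi : InfoOK j r info found.isSome c)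
    (hT : blockLen (d i) + 2 ≤ T) (g : (Fin n → ℕ) → ℝ) (hg : ∀ x, 0 ≤ g x)
    (hnext : ∀ x, ∀ D' : Fin n → Device (protocol d N cd).alg,
      (if j + 1 < numRounds (d i) then
        StageConf d N cd i (j + 1) r (infoAfter (d i) j r info found.isSome c x)
          (leadAfter (d i) j r info found.isSome c lead x) e D'
      else EndConf d N cd i (leadAfter (d i) j r info found.isSome c lead x) (e + 4) D') →
      FailLE (protocol d N cd) cd (goodSet (protocol d N cd) n C E) D' (T - (blockLen (d i) + 2))
        (g x)) :
    FailLE (protocol d N cd) cd (goodSet (protocol d N cd) n C E) D T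
      (avg (roundSize (d i) j r info) g) := by
  have hsz : (fun v => (protocol d N cd).size (Mem.round i j (r v) (info v) (lead v))) =
      roundSize (d i) j r info := funext fun v => drawSize_round i j r info (lead v) v
  rw [← hsz]
  refine FailLE.epoch (P := protocol d N cd) (fun v => Mem.round i j (r v) (info v) (lead v))
    h.state (L := blockLen (d i) + 2) (fun _ => rfl) (by omega) (fun v => ?_) hT g
    (fun x _ => hg x) (roundActs (d i) j r info found.isSome c) (fun x _ t ht v => ?_)
    (fun x _ => hnext x _ ?_)
  · exact (roundSize_pos hd j r info v).trans_eq (congrFun hsz v).symm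
  · exact roundAct_eq hr hi ht v
  · have hfin : ∀ v, epochFin d N cd (Mem.round i j (r v) (info v) (lead v)) (x v)
        (obsOf cd (roundActs (d i) j r info found.isSome c x) (blockLen (d i) + 2) v) =
        .inl (roundNext (d i) i j (r v) (infoAfter (d i) j r info found.isSome c x v)
          (leadAfter (d i) j r info found.isSome c lead x v)) := by
      intro v
      rw [epochFin, roundInfo_eq hr, roundLead_eq]
    have hcost : ∀ v, (midDev (protocol d N cd) cd
        (fun v => Mem.round i j (r v) (info v) (lead v)) x
        (roundActs (d i) j r info found.isSome c x) D (blockLen (d i) + 2) v).energy ≤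
        e + spent (j + 1) (r v) := by
      intro v
      have h1 := round_cost (d := d i) (x := x) hi v
      have h2 := h.energy v
      change (D v).energy + ∑ s ∈ range (blockLen (d i) + 2),
        (roundActs (d i) j r info found.isSome c x s v).cost ≤ _
      omega
    split_ifs with hj
    · refine ⟨fun v => midDev_state_of_inl le_rfl ((hfin v).trans ?_),
        fun v w => congrArg (· + (blockLen (d i) + 2)) (h.elapsed v w), hcost⟩
      rw [roundNext, if_pos hj]
      rfl
    · refine ⟨fun v => midDev_state_of_inl le_rfl ((hfin v).trans ?_),
        fun v w => congrArg (· + (blockLen (d i) + 2)) (h.elapsed v w), fun v => ?_⟩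
      · rw [roundNext, if_neg hj]
        rfl
      · refine (hcost v).trans (Nat.add_le_add_left ?_ e)
        rcases r v with j' | ⟨j', l, w⟩ <;> simp only [spent] <;> split_ifs <;> omega

/-- The actions in the announcement. -/
def announceActs (est : ℕ → ℕ) (lead : Fin n → Option ℕ) (_ : ℕ) (v : Fin n) : Action Msg :=
  match lead v with
  | some k => .transmit (false, false, est k)
  | none => .listen

theorem epochAct_announce (i : ℕ) (lead : Option ℕ) (x : ℕ) (obs : List (Obs Msg)) :
    epochAct d cd (.announce i lead) x obs = match lead with
      | some k => .transmit (false, false, numRoles (d i) * 2 ^ k)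
      | none => .listen := by
  cases lead <;> rfl

theorem epochFin_announce_some {i k : ℕ} {lead : Option ℕ} (h : lead = some k) (x : ℕ)
    (obs : List (Obs Msg)) :
    epochFin d N cd (.announce i lead) x obs = .inr ⟨numRoles (d i) * 2 ^ k, .leader⟩ := by
  subst h
  rfl

theorem epochFin_announce_none {i : ℕ} {lead : Option ℕ} (h : lead = none) (x : ℕ)
    {obs : List (Obs Msg)} {q : Option Msg} (hq : got obs 0 = q) :
    epochFin d N cd (.announce i lead) x obs =
      q.elim (.inl (.pick (i + 1))) fun q => .inr ⟨q.2.2, .follower⟩ := by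
  subst h hq
  change (match got obs 0 with
    | some q => Sum.inr (Output.mk q.2.2 .follower)
    | none => Sum.inl (Mem.pick (i + 1))) = _
  cases got obs 0 <;> rfl

theorem got_announce {est : ℕ → ℕ} {lead : Fin n → Option ℕ} {found : Option ℕ}
    (h : LeadOK found lead) {v : Fin n} (hv : lead v = none) :
    got (obsOf cd (announceActs est lead) 1 v) 0 = found.map fun k => (false, false, est k) := by
  rw [got_obsOf one_pos (by simp [announceActs, hv])]
  rcases found with _ | k
  · rw [channel_of_silence fun u => by simp [announceActs, h u, Action.sent]]
    rfl
  · obtain ⟨l, hl, hu⟩ := h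
    rw [channel_of_unique (m := (false, false, est k)) l (by simp [announceActs, hl, Action.sent])
      fun u hul => by simp [announceActs, hu u hul, Action.sent]]
    rfl

/-- A leader is heard by everybody, and the absence of a leader is noticed by everybody. So the
devices either terminate in the same slot with the same estimate or enter the next stage together.
-/
theorem EndConf.fail_announce {i e T E : ℕ} {C ε : ℝ} {lead : Fin n → Option ℕ}
    {found : Option ℕ} {D : Fin n → Device (protocol d N cd).alg}
    (h : EndConf d N cd i lead e D) (hl : LeadOK found lead) (hε : 0 ≤ ε) (hE : e + 1 ≤ E)
    (hT : 1 ≤ T)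
    (hnone : found = none → ∀ D' : Fin n → Device (protocol d N cd).alg,
      Conf d N cd (.pick (i + 1)) (e + 1) D' →
        FailLE (protocol d N cd) cd (goodSet (protocol d N cd) n C E) D' (T - 1) ε)
    (hsome : ∀ k, found = some k → (n : ℝ) ≤ C * (numRoles (d i) * 2 ^ k : ℕ) ∧
      ((numRoles (d i) * 2 ^ k : ℕ) : ℝ) ≤ C * n) :
    FailLE (protocol d N cd) cd (goodSet (protocol d N cd) n C E) D T ε := by
  have hsz : ∀ v, 0 < (protocol d N cd).size (Mem.announce i (lead v)) := fun _ => one_pos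
  have hcost := fun v => sum_cost_le_length
    (fun t => announceActs (fun k => numRoles (d i) * 2 ^ k) lead t v) 1
  refine (FailLE.epoch (P := protocol d N cd) (fun v => Mem.announce i (lead v))
    h.state (L := 1) (fun _ => rfl) one_pos hsz hT (fun _ => ε) (fun _ _ => hε)
    (fun _ => announceActs (fun k => numRoles (d i) * 2 ^ k) lead) (fun x _ t ht v => ?_)
    (fun x _ => ?_)).mono (avg_const hsz ε).le
  · exact epochAct_announce i (lead v) (x v) _
  · rcases found with _ | k
    · refine hnone rfl _ ⟨fun v => midDev_state_of_inl le_rfl ?_,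
        fun v w => congrArg (· + 1) (h.elapsed v w), fun v => Nat.add_le_add (h.energy v) (hcost v)⟩
      have h1 := got_announce (cd := cd) (est := fun k => numRoles (d i) * 2 ^ k) hl (hl v)
      exact epochFin_announce_none (hl v) (x v) h1
    · obtain ⟨h2, h3⟩ := hsome k rfl
      obtain ⟨l, hll, hu⟩ := id hl
      refine fail_of_solved (m := fun v => Mem.announce i (lead v)) h.elapsed (fun _ => rfl) _
        (fun v => ⟨numRoles (d i) * 2 ^ k, if v = l then .leader else .follower⟩) (fun v => ?_)
        (fun v => (Nat.add_le_add (h.energy v) (hcost v)).trans hE)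
        ⟨_, l, fun _ => rfl, h2, h3, by simp,
          ⟨(false, false, numRoles (d i) * 2 ^ k), ?_⟩, fun v hv => ⟨by simp [hv], ?_⟩⟩ _ _
      · by_cases hv : v = l
        · subst hv
          rw [if_pos rfl]
          exact epochFin_announce_some hll _ _
        · have h1 := got_announce (cd := cd) (est := fun k => numRoles (d i) * 2 ^ k) hl (hu v hv)
          rw [if_neg hv]
          exact epochFin_announce_none (hu v hv) _ h1
      · simp only [announceActs, hll]
      · simp only [announceActs, hu v hv]

/-- A recursion for the failure probability of a stage, with given roles. -/
theorem stage_fail {i e T' E : ℕ} {C F : ℝ} {r : Fin n → Duty} (hd : 0 < d i)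
    (hr : RolesOK (d i) r) (hE : e + 5 ≤ E)
    (val : ℕ → Option ℕ → ℕ → (Fin n → Option (Bool × ℕ)) → ℝ)
    (hval : ∀ j found c info, 0 ≤ val j found c info)
    (hnext : ∀ (D : Fin n → Device (protocol d N cd).alg) (T : ℕ),
      Conf d N cd (.pick (i + 1)) (e + 5) D → T' ≤ T →
      FailLE (protocol d N cd) cd (goodSet (protocol d N cd) n C E) D T F)
    (hnone : ∀ c info, F ≤ val (numRounds (d i)) none c info)
    (hsome : ∀ k c info, val (numRounds (d i)) (some k) c info < 1 →
      (n : ℝ) ≤ C * (numRoles (d i) * 2 ^ k : ℕ) ∧ ((numRoles (d i) * 2 ^ k : ℕ) : ℝ) ≤ C * n)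
    (hstep : ∀ j < numRounds (d i), ∀ found c info, InfoOK j r info found.isSome c →
      val j found c info < 1 →
      avg (roundSize (d i) j r info) (fun x => val (j + 1) (foundAfter (d i) j r info found c x)
        (newCount (d i) j (single (d i) j r x) c)
        (infoAfter (d i) j r info found.isSome c x)) ≤ val j found c info)
    (k : ℕ) : ∀ (j T c : ℕ) (found : Option ℕ) (info : Fin n → Option (Bool × ℕ))
      (lead : Fin n → Option ℕ), j + k + 1 = numRounds (d i) →
      (k + 1) * (blockLen (d i) + 2) + 1 + T' ≤ T → InfoOK j r info found.isSome c →
      LeadOK found lead → ∀ D : Fin n → Device (protocol d N cd).alg,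
      StageConf d N cd i j r info lead e D →
      FailLE (protocol d N cd) cd (goodSet (protocol d N cd) n C E) D T (val j found c info) := by
  induction k with
  | zero =>
    intro j T c found info lead hk hT hi hl D h
    by_cases hv : 1 ≤ val j found c info
    · exact FailLE.of_one_le hv
    refine (h.fail_round hd hr hi (by omega) _ (fun x => hval _ _ _ _) fun x D' hD' => ?_).mono
      (hstep j (by omega) found c info hi (not_le.1 hv))
    rw [if_neg (by omega)] at hD'
    have hj : j + 1 = numRounds (d i) := by omega
    by_cases hv' : 1 ≤ val (j + 1) (foundAfter (d i) j r info found c x)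
        (newCount (d i) j (single (d i) j r x) c) (infoAfter (d i) j r info found.isSome c x)
    · exact FailLE.of_one_le hv'
    refine hD'.fail_announce (leadOK_after hl) (hval _ _ _ _) hE (by omega)
      (fun hf D'' hD'' => (hnext D'' _ hD'' (by omega)).mono ?_) (fun k hf => ?_)
    · rw [hj, hf]
      exact hnone _ _
    · rw [hj, hf] at hv'
      exact hsome k _ _ (not_le.1 hv')
  | succ k ih =>
    intro j T c found info lead hk hT hi hl D h
    by_cases hv : 1 ≤ val j found c info
    · exact FailLE.of_one_le hv
    have hT' : (k + 1 + 1) * (blockLen (d i) + 2) =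
      (k + 1) * (blockLen (d i) + 2) + (blockLen (d i) + 2) := by ring
    refine (h.fail_round hd hr hi (by omega) _ (fun x => hval _ _ _ _) fun x D' hD' => ?_).mono
      (hstep j (by omega) found c info hi (not_le.1 hv))
    rw [if_pos (by omega)] at hD'
    refine ih (j + 1) _ _ _ _ _ (by omega) (by omega) ?_ (leadOK_after hl) D' hD'
    rw [foundAfter_isSome]
    exact infoOK_infoAfter

/-- The information before the first round. -/
def startInfo : Duty → Option (Bool × ℕ)
  | .relay 0 _ _ => some (false, 0)
  | _ => none

theorem rolesOK_decodeDuty {d' : ℕ} (hd : 0 < d') (x : Fin n → ℕ) :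
    RolesOK d' fun v => decodeDuty d' (x v) := by
  intro v j l w h
  change decodeDuty d' (x v) = _ at h
  rw [decodeDuty] at h
  split_ifs at h
  cases h
  exact ⟨Nat.mod_lt _ (blockLen_pos hd), Nat.mod_lt _ (attempts_pos hd)⟩

theorem infoOK_startInfo (r : Fin n → Duty) :
    InfoOK 0 r (fun v => startInfo (r v)) false 0 := by
  intro v p h
  rcases hrv : r v with j | ⟨_ | j, l, w⟩
  · simp [hrv, startInfo] at h
  · simp only [hrv, startInfo] at h
    cases h
    exact ⟨rfl, l, w, rfl⟩
  · simp [hrv, startInfo] at h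

theorem Conf.fail_pick {i e T E : ℕ} {C : ℝ} {D : Fin n → Device (protocol d N cd).alg}
    (h : Conf d N cd (.pick i) e D) (hd : 0 < d i) (hT : 1 ≤ T) (g : (Fin n → ℕ) → ℝ)
    (hg : ∀ x, 0 ≤ g x)
    (hnext : ∀ x, ∀ D' : Fin n → Device (protocol d N cd).alg,
      StageConf d N cd i 0 (fun v => decodeDuty (d i) (x v))
        (fun v => startInfo (decodeDuty (d i) (x v))) (fun _ => none) e D' →
      FailLE (protocol d N cd) cd (goodSet (protocol d N cd) n C E) D' (T - 1) (g x)) :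
    FailLE (protocol d N cd) cd (goodSet (protocol d N cd) n C E) D T
      (avg (fun _ => numRoles (d i)) g) := by
  refine FailLE.epoch (P := protocol d N cd) (fun _ => Mem.pick i)
    h.state (L := 1) (fun _ => rfl) one_pos (fun v => numRoles_pos hd) hT g
    (fun x _ => hg x) (fun _ _ _ => .idle) (fun x _ t ht v => rfl)
    (fun x _ => hnext x _ ⟨fun v => midDev_state_of_inl le_rfl ?_,
      fun v w => congrArg (· + 1) (h.elapsed v w), fun v => ?_⟩)
  · change Sum.inl (Mem.round i 0 (decodeDuty (d i) (x v)) (match decodeDuty (d i) (x v) with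
        | .relay 0 _ _ => some (false, 0)
        | _ => none) none) = _
    rcases decodeDuty (d i) (x v) with j | ⟨_ | j, l, w⟩ <;> rfl
  · have := h.energy v
    change (D v).energy + ∑ s ∈ range 1, (Action.idle : Action Msg).cost ≤ _
    simp only [Action.cost, Finset.sum_const_zero]
    omega

end Stage

/-! ### Probabilities in a round -/

/-- Bernoulli's inequality gives `(1 - g) ^ (r - 1) ≥ 1 - (r - 1) * g ≥ 1 / 2`. -/
theorem half_le_unique {r : ℕ} {g α : ℝ} (hg0 : 0 ≤ g) (hg1 : g ≤ 1) (h1 : α ≤ r * g)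
    (h2 : r * g ≤ 1 / 2) : α / 2 ≤ r * (g * (1 - g) ^ (r - 1)) := by
  rcases r with _ | r
  · simp only [Nat.cast_zero, zero_mul] at h1 ⊢
    linarith
  · have h3 := one_add_mul_le_pow (a := -g) (by linarith) r
    rw [Nat.add_sub_cancel]
    have h4 : (1 / 2 : ℝ) ≤ (1 - g) ^ r := by
      push_cast at h2
      have : 1 + (-g) = 1 - g := by ring
      rw [this] at h3
      nlinarith
    have h5 : (0 : ℝ) ≤ (r + 1 : ℕ) * g := by positivity
    nlinarith

section Round

variable {n : ℕ} {d j c : ℕ} {r : Fin n → Duty} {info : Fin n → Option (Bool × ℕ)}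

open Classical in
/-- The candidates of round `j`. -/
noncomputable def cands (j : ℕ) (r : Fin n → Duty) : Finset (Fin n) :=
  univ.filter fun v => r v = .cand j

open Classical in
/-- The informed relays of round `j` in column `w`. -/
noncomputable def column (j w : ℕ) (r : Fin n → Duty) (info : Fin n → Option (Bool × ℕ)) :
    Finset (Fin n) :=
  univ.filter fun v => (info v).isSome ∧ ∃ l, r v = .relay j l w

theorem mem_cands {v : Fin n} : v ∈ cands j r ↔ r v = .cand j := by simp [cands]

theorem mem_column {w : ℕ} {v : Fin n} :
    v ∈ column j w r info ↔ (info v).isSome ∧ ∃ l, r v = .relay j l w := by simp [column]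

theorem single_iff {x : Fin n → ℕ} : single d j r x = true ↔
    ∃ v ∈ cands j r, x v ∈ range (blockLen d) ∧
      ∀ u ∈ cands j r, u ≠ v → x u ∉ range (blockLen d) := by
  classical
  rw [single, decide_eq_true_iff]
  simp only [mem_cands, mem_range]
  constructor
  · rintro ⟨v, hv, hu⟩
    exact ⟨v, hv.1, hv.2, fun u h1 h2 h3 => h2 (hu u ⟨h1, h3⟩)⟩
  · rintro ⟨v, h1, h2, hu⟩
    refine ⟨v, ⟨h1, h2⟩, fun u h => ?_⟩
    by_contra huv
    exact hu u h.1 huv h.2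

theorem roundSize_cands {v : Fin n} (hv : v ∈ cands j r) :
    roundSize d j r info v = 2 ^ (d - j / scaleRounds d) * blockLen d := by
  rw [mem_cands] at hv
  simp [roundSize, hv]

theorem roundSize_column {w : ℕ} {v : Fin n} (hv : v ∈ column j w r info) :
    roundSize d j r info v = 2 ^ (d + 2) := by
  obtain ⟨h, l, hl⟩ := mem_column.1 hv
  simp [roundSize, hl, h]

/-- The probability that there is exactly one candidate, if a device is a candidate with
probability `1 / 2 ^ k`. -/
noncomputable def singleProb (N k : ℕ) : ℝ := N * (1 / 2 ^ k * (1 - 1 / 2 ^ k) ^ (N - 1))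

theorem div_two_pow_mul {b : ℕ} (hb : 0 < b) (k : ℕ) :
    (b : ℝ) / (2 ^ k * b : ℕ) = 1 / 2 ^ k := by
  have : (0 : ℝ) < b := by exact_mod_cast hb
  push_cast
  field_simp

theorem avg_single (hd : 0 < d) :
    avg (roundSize d j r info) (fun x => if single d j r x = true then 1 else 0) =
      singleProb (cands j r).card (d - j / scaleRounds d) := by
  classical
  have hb := blockLen_pos hd
  have := avg_unique (roundSize_pos hd j r info) (cands j r) (fun v hv => roundSize_cands hv)
    (range (blockLen d)) (range (blockLen d)) subset_rfl
    (range_subset_range.2 (Nat.le_mul_of_pos_left _ (by positivity)))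
  rw [card_range, div_two_pow_mul hb] at this
  rw [singleProb, ← this]
  refine avg_congr fun x _ => ?_
  simp only [single_iff]
  congr

/-- The draw of an active candidate doubles as its listening slot, which is uniform among the
broadcast slots; hence the additional factor `1 / blockLen d`. -/
theorem avg_lead_slot (hd : 0 < d) {τ : ℕ} (hτ : τ < blockLen d) [∀ x : Fin n → ℕ, Decidable
    (∃ v ∈ cands j r, x v ∈ ({τ} : Finset ℕ) ∧
      ∀ u ∈ cands j r, u ≠ v → x u ∉ range (blockLen d))] :
    avg (roundSize d j r info) (fun x => if ∃ v ∈ cands j r, x v ∈ ({τ} : Finset ℕ) ∧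
      ∀ u ∈ cands j r, u ≠ v → x u ∉ range (blockLen d) then 1 else 0) =
      1 / blockLen d * singleProb (cands j r).card (d - j / scaleRounds d) := by
  have hb := blockLen_pos hd
  have := avg_unique (roundSize_pos hd j r info) (cands j r) (fun v hv => roundSize_cands hv)
    {τ} (range (blockLen d)) (by simpa using hτ)
    (range_subset_range.2 (Nat.le_mul_of_pos_left _ (by positivity)))
  rw [card_range, div_two_pow_mul hb, card_singleton] at this
  have hb' : (0 : ℝ) < blockLen d := by exact_mod_cast hb
  refine (Eq.trans ?_ this).trans ?_
  · refine avg_congr fun x _ => ?_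
    congr
  · rw [singleProb]
    push_cast
    field_simp

/-- A broadcast slot encodes an exponent and a column. In a given slot only devices of that column
can transmit, namely those whose draw has that binary logarithm. -/
theorem blockOK_iff (hr : RolesOK d r) {k w : ℕ} (hk : k ≤ d) (hw : w < attempts d)
    {x : Fin n → ℕ} : BlockOK d j r info x (k * attempts d + w) ↔
    ∃ v ∈ column j w r info, x v ∈ Ico (2 ^ k) (2 ^ (k + 1)) ∧
      ∀ u ∈ column j w r info, u ≠ v → x u ∉ Ico (2 ^ k) (2 ^ (k + 1)) := by
  have h : ∀ v, Sends d j r info x (k * attempts d + w) v ↔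
      v ∈ column j w r info ∧ x v ∈ Ico (2 ^ k) (2 ^ (k + 1)) := by
    intro v
    rw [mem_column, mem_Ico]
    constructor
    · rintro ⟨h1, l, w', h2, h3, h4, h5⟩
      have hw' := (hr v j l w' h2).2
      have e1 : Nat.log 2 (x v) = k := by
        have := congrArg (· / attempts d) h5
        rw [mul_comm k, mul_comm (Nat.log 2 (x v)), Nat.mul_add_div (by omega),
          Nat.mul_add_div (by omega), Nat.div_eq_of_lt hw, Nat.div_eq_of_lt hw'] at this
        omega
      have e2 : w' = w := by rw [e1] at h5; omega
      subst e2
      have := (Nat.log_eq_iff (Or.inr ⟨one_lt_two, h3⟩)).1 e1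
      exact ⟨⟨h1, l, h2⟩, this⟩
    · rintro ⟨⟨h1, l, h2⟩, h3⟩
      have hx0 : x v ≠ 0 := by
        have := Nat.two_pow_pos k
        omega
      have := (Nat.log_eq_iff (Or.inr ⟨one_lt_two, hx0⟩)).2 h3
      exact ⟨h1, l, w, h2, hx0, by omega, by rw [this]⟩
  rw [BlockOK]
  simp only [h]
  constructor
  · rintro ⟨v, hv, hu⟩
    exact ⟨v, hv.1, hv.2, fun u h1 h2 h3 => h2 (hu u ⟨h1, h3⟩)⟩
  · rintro ⟨v, h1, h2, hu⟩
    refine ⟨v, ⟨h1, h2⟩, fun u h => ?_⟩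
    by_contra huv
    exact hu u h.1 huv h.2

open Classical in
theorem avg_blockOK (hd : 0 < d) (hr : RolesOK d r) {k w : ℕ} (hk : k ≤ d)
    (hw : w < attempts d) :
    avg (roundSize d j r info)
      (fun x => if BlockOK d j r info x (k * attempts d + w) then 1 else 0) =
      (column j w r info).card * (2 ^ k / 2 ^ (d + 2) *
        (1 - 2 ^ k / 2 ^ (d + 2)) ^ ((column j w r info).card - 1)) := by
  have hk2 : 2 ^ (k + 1) ≤ 2 ^ (d + 2) := Nat.pow_le_pow_right two_pos (by omega)
  have := avg_unique (roundSize_pos hd j r info) (column j w r info)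
    (fun v hv => roundSize_column hv)
    (Ico (2 ^ k) (2 ^ (k + 1))) (Ico (2 ^ k) (2 ^ (k + 1))) subset_rfl
    (fun t ht => mem_range.2 ((mem_Ico.1 ht).2.trans_le hk2))
  rw [Nat.card_Ico, pow_succ, show 2 ^ k * 2 - 2 ^ k = 2 ^ k by omega] at this
  push_cast at this
  rw [← this]
  refine avg_congr fun x _ => ?_
  simp only [blockOK_iff hr hk hw, pow_succ]
  congr

/-- For some broadcast slot, all relays of round `j` that listen in this slot are informed. -/
def Alive (d j : ℕ) (r : Fin n → Duty) (info : Fin n → Option (Bool × ℕ)) : Prop :=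
  ∃ l < blockLen d, ∀ v w, r v = .relay j l w → (info v).isSome

/-- The number `R` of informed relays in the column lies between `1` and `2 ^ d`. With `k = d -
Nat.log 2 R`, the expected number of transmitters `R * 2 ^ k / 2 ^ (d + 2)` is `R / 2 ^ Nat.log 2 R
/ 4`. -/
theorem Alive.exists_scale (h : Alive d j r info) (hn : n ≤ 2 ^ d) {w : ℕ}
    (hrel : ∀ l < blockLen d, ∃ v, r v = .relay j l w) :
    ∃ k ≤ d, (1 / 4 : ℝ) ≤ (column j w r info).card * (2 ^ k / 2 ^ (d + 2)) ∧
      (column j w r info).card * (2 ^ k / 2 ^ (d + 2)) ≤ (1 / 2 : ℝ) := by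
  obtain ⟨l, hl, hall⟩ := h
  obtain ⟨v, hv⟩ := hrel l hl
  set R := (column j w r info).card with hR
  have h1 : R ≠ 0 := by
    rw [hR, Finset.card_ne_zero]
    exact ⟨v, mem_column.2 ⟨hall v w hv, l, hv⟩⟩
  have h2 : R ≤ 2 ^ d := by
    refine le_trans ?_ hn
    simpa using Finset.card_le_univ (column j w r info)
  have h3 := Nat.pow_log_le_self 2 h1
  have h4 := Nat.lt_pow_succ_log_self one_lt_two R
  have h5 : Nat.log 2 R ≤ d := by
    by_contra hcon
    have : 2 ^ (d + 1) ≤ 2 ^ Nat.log 2 R := Nat.pow_le_pow_right two_pos (by omega)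
    have h0 := Nat.two_pow_pos d
    rw [pow_succ] at this
    omega
  obtain ⟨t, ht⟩ := Nat.exists_eq_add_of_le h5
  refine ⟨t, by omega, ?_, ?_⟩
  · have : (2 : ℝ) ^ (d + 2) = 2 ^ Nat.log 2 R * 2 ^ t * 4 := by
      rw [← pow_add, ← ht, pow_add]; norm_num
    have h3' : (2 : ℝ) ^ Nat.log 2 R ≤ R := by exact_mod_cast h3
    have hp : (0 : ℝ) < 2 ^ Nat.log 2 R := by positivity
    rw [this, show (R : ℝ) * (2 ^ t / (2 ^ Nat.log 2 R * 2 ^ t * 4)) =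
      (R / 2 ^ Nat.log 2 R) / 4 by field_simp]
    rw [div_le_div_iff_of_pos_right (by norm_num), le_div_iff₀ hp]
    linarith
  · have : (2 : ℝ) ^ (d + 2) = 2 ^ Nat.log 2 R * 2 ^ t * 4 := by
      rw [← pow_add, ← ht, pow_add]; norm_num
    have h4' : (R : ℝ) ≤ 2 ^ Nat.log 2 R * 2 := by
      rw [← pow_succ]; exact_mod_cast h4.le
    have hp : (0 : ℝ) < 2 ^ Nat.log 2 R := by positivity
    rw [this, show (R : ℝ) * (2 ^ t / (2 ^ Nat.log 2 R * 2 ^ t * 4)) =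
      (R / 2 ^ Nat.log 2 R) / 4 by field_simp]
    rw [div_le_div_iff₀ (by norm_num) (by norm_num), div_mul_eq_mul_div, div_le_iff₀ hp]
    linarith

open Classical in
theorem Alive.blockOK_ge (h : Alive d j r info) (hd : 0 < d) (hr : RolesOK d r) (hn : n ≤ 2 ^ d)
    {w : ℕ} (hw : w < attempts d) (hrel : ∀ l < blockLen d, ∃ v, r v = .relay j l w) :
    ∃ k ≤ d, 1 / 8 ≤ avg (roundSize d j r info)
      (fun x => if BlockOK d j r info x (k * attempts d + w) then 1 else 0) := by
  obtain ⟨k, hk, h1, h2⟩ := h.exists_scale hn hrel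
  refine ⟨k, hk, ?_⟩
  rw [avg_blockOK hd hr hk hw]
  have h3 : (2 : ℝ) ^ k ≤ 2 ^ (d + 2) := pow_le_pow_right₀ one_le_two (by omega)
  have := half_le_unique (by positivity) (div_le_one_of_le₀ h3 (by positivity)) h1 h2
  linarith

theorem slot_lt_blockLen {k w : ℕ} (hk : k ≤ d) (hw : w < attempts d) :
    k * attempts d + w < blockLen d := by
  have := Nat.mul_le_mul_right (attempts d) hk
  rw [blockLen, add_mul, one_mul]
  omega

theorem alive_infoAfter {f : Bool} {x : Fin n → ℕ} {τ : ℕ} (hτ : τ < blockLen d)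
    (h : BlockOK d j r info x τ) : Alive d (j + 1) r (infoAfter d j r info f c x) :=
  ⟨τ, hτ, fun v w hv => by rw [infoAfter, if_pos ⟨τ, w, hv, h⟩]; rfl⟩

theorem blockOK_congr (hr : RolesOK d r) {k w : ℕ} (hk : k ≤ d) (hw : w < attempts d)
    {x y : Fin n → ℕ} (h : ∀ v ∈ column j w r info, x v = y v) :
    BlockOK d j r info x (k * attempts d + w) ↔ BlockOK d j r info y (k * attempts d + w) := by
  rw [blockOK_iff hr hk hw, blockOK_iff hr hk hw]
  refine exists_congr fun v => and_congr_right fun hv => ?_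
  rw [h v hv]
  refine and_congr_right fun _ => forall_congr' fun u => forall_congr' fun hu => ?_
  rw [h u hu]

open Classical in
/-- The public information is lost with small probability. -/
theorem Alive.avg_not_alive_le (h : Alive d j r info) (hd : 0 < d) (hr : RolesOK d r)
    (hn : n ≤ 2 ^ d)
    (hrel : ∀ w < attempts d, ∀ l < blockLen d, ∃ v, r v = .relay j l w) (f : Bool) (c : ℕ) :
    avg (roundSize d j r info)
      (fun x => if Alive d (j + 1) r (infoAfter d j r info f c x) then 0 else 1) ≤
      (7 / 8) ^ attempts d := by
  have hN := roundSize_pos hd j r info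
  have hk : ∀ w, ∃ k ≤ d, w < attempts d → 1 / 8 ≤ avg (roundSize d j r info)
      (fun x => if BlockOK d j r info x (k * attempts d + w) then 1 else 0) := by
    intro w
    by_cases hw : w < attempts d
    · obtain ⟨k, hk, h1⟩ := h.blockOK_ge hd hr hn hw (hrel w hw)
      exact ⟨k, hk, fun _ => h1⟩
    · exact ⟨0, Nat.zero_le _, fun h' => absurd h' hw⟩
  choose k hk hge using hk
  calc (avg (roundSize d j r info)
      (fun x => if Alive d (j + 1) r (infoAfter d j r info f c x) then 0 else 1) : ℝ)
      ≤ avg (roundSize d j r info) (fun x => ∏ w ∈ range (attempts d),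
          if BlockOK d j r info x (k w * attempts d + w) then 0 else 1) := by
        refine avg_mono fun x _ => ?_
        by_cases ha : Alive d (j + 1) r (infoAfter d j r info f c x)
        · rw [if_pos ha]
          exact Finset.prod_nonneg fun w _ => by split_ifs <;> norm_num
        · rw [if_neg ha, Finset.prod_eq_one]
          intro w hw
          rw [if_neg]
          exact fun hb => ha (alive_infoAfter (slot_lt_blockLen (hk w) (mem_range.1 hw)) hb)
    _ = ∏ w ∈ range (attempts d), avg (roundSize d j r info) (fun x =>
          if BlockOK d j r info x (k w * attempts d + w) then 0 else 1) := by
        -- Different columns consist of different devices, so their attempts are independent.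
        refine avg_prod_of_disjoint hN _ (fun w => column j w r info) ?_ _ ?_
        · intro w _ w' _ hww'
          refine Finset.disjoint_left.2 fun v hv hv' => hww' ?_
          obtain ⟨_, l, hl⟩ := mem_column.1 hv
          obtain ⟨_, l', hl'⟩ := mem_column.1 hv'
          rw [hl] at hl'
          cases hl'
          rfl
        · intro w hw x y hxy
          simp only [blockOK_congr hr (hk w) (mem_range.1 hw) hxy]
    _ ≤ ∏ w ∈ range (attempts d), (7 / 8 : ℝ) := by
        refine Finset.prod_le_prod (fun w _ => avg_nonneg fun x _ => by split_ifs <;> norm_num)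
          fun w hw => ?_
        rw [avg_ite hN]
        have := hge w (mem_range.1 hw)
        linarith
    _ = (7 / 8) ^ attempts d := by rw [Finset.prod_const, card_range]

open Classical in
/-- If enough successes were counted, a leader is elected with probability at least
`1 / (256 * blockLen d)`. -/
theorem Alive.avg_elected_ge (h : Alive d j r info) (hd : 0 < d) (hr : RolesOK d r)
    (hn : n ≤ 2 ^ d) (hrel : ∀ w < attempts d, ∀ l < blockLen d, ∃ v, r v = .relay j l w)
    (hs : 1 / 32 ≤ singleProb (cands j r).card (d - j / scaleRounds d))
    (hj : countRounds d ≤ j % scaleRounds d) (hc : threshold d ≤ c) :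
    1 / (256 * blockLen d) ≤ avg (roundSize d j r info)
      (fun x => if electedIn d j r info x false c then 1 else 0) := by
  have hN := roundSize_pos hd j r info
  have ha := attempts_pos hd
  have hb : (0 : ℝ) < blockLen d := by exact_mod_cast blockLen_pos hd
  obtain ⟨k, hk, h8⟩ := h.blockOK_ge hd hr hn ha (hrel 0 ha)
  have hτ := slot_lt_blockLen hk ha
  set τ := k * attempts d + 0 with hτdef
  -- The factors are `1 / 32` for a single candidate, `1 / blockLen d` for its listening slot being
  -- `τ`, and `1 / 8` for the broadcast in slot `τ`.
  calc (1 / (256 * blockLen d) : ℝ) = 1 / blockLen d * (1 / 32) * (1 / 8) := by field_simp; norm_num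
    _ ≤ (1 / blockLen d * singleProb (cands j r).card (d - j / scaleRounds d)) *
        avg (roundSize d j r info) (fun x => if BlockOK d j r info x τ then 1 else 0) := by gcongr
    _ = avg (roundSize d j r info) (fun x => (if ∃ v ∈ cands j r, x v ∈ ({τ} : Finset ℕ) ∧
          ∀ u ∈ cands j r, u ≠ v → x u ∉ range (blockLen d) then 1 else 0) *
          if BlockOK d j r info x τ then 1 else 0) := by
        rw [← avg_lead_slot (info := info) hd hτ]
        symm
        -- Candidates and relays are different devices, so the two events are independent.
        refine avg_mul_of_disjoint hN (cands j r) _ _ (fun x y hxy => ?_) fun x y hxy => ?_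
        · have : (∃ v ∈ cands j r, x v ∈ ({τ} : Finset ℕ) ∧
              ∀ u ∈ cands j r, u ≠ v → x u ∉ range (blockLen d)) ↔
              ∃ v ∈ cands j r, y v ∈ ({τ} : Finset ℕ) ∧
              ∀ u ∈ cands j r, u ≠ v → y u ∉ range (blockLen d) := by
            refine exists_congr fun v => and_congr_right fun hv => ?_
            rw [hxy v hv]
            refine and_congr_right fun _ => forall_congr' fun u => forall_congr' fun hu => ?_
            rw [hxy u hu]
          simp only [this]
        · have := blockOK_congr (j := j) (info := info) hr hk ha (x := x) (y := y) fun v hv =>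
            hxy v fun hv' => by
              obtain ⟨_, l, hl⟩ := mem_column.1 hv
              rw [mem_cands, hl] at hv'
              cases hv'
          simp only [hτdef, this]
    _ ≤ _ := by
        refine avg_mono fun x _ => ?_
        by_cases h1 : ∃ v ∈ cands j r, x v ∈ ({τ} : Finset ℕ) ∧
          ∀ u ∈ cands j r, u ≠ v → x u ∉ range (blockLen d)
        · by_cases h2 : BlockOK d j r info x τ
          · rw [if_pos h1, if_pos h2, if_pos]
            · norm_num
            · obtain ⟨v, hv, hx, hu⟩ := h1
              rw [mem_singleton] at hx
              have hsg : single d j r x = true :=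
                single_iff.2 ⟨v, hv, by rw [hx]; exact mem_range.2 hτ, hu⟩
              rw [electedIn, decide_eq_true_iff]
              refine ⟨v, ⟨mem_cands.1 hv, by rw [hx]; exact hτ⟩, by rw [hx]; exact h2, ?_⟩
              have hw := countRounds_pos hd
              have h3 : newCount d j true c = c := by
                rw [newCount, if_neg (by omega), if_neg (by omega), add_zero]
              simp [leads, roundMsg, hsg, h3, hj, hc]
          · rw [if_neg h2, mul_zero]
            split_ifs <;> norm_num
        · rw [if_neg h1, zero_mul]
          split_ifs <;> norm_num

end Round

/-! ### The failure probability of a stage with given roles -/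

section Value

variable {n : ℕ} {d : ℕ}

/-- The number of successes at the current scale before round `j`. -/
def scaleCount (d j c : ℕ) : ℕ := if j % scaleRounds d = 0 then 0 else c

theorem newCount_of_lt {j : ℕ} (hj : j % scaleRounds d < countRounds d) (b : Bool) (c : ℕ) :
    newCount d j b c = if b = true then scaleCount d j c + 1 else scaleCount d j c := by
  cases b <;> simp [newCount, scaleCount, hj]

theorem newCount_of_le {j : ℕ} (hj : countRounds d ≤ j % scaleRounds d) (b : Bool) (c : ℕ) :
    newCount d j b c = scaleCount d j c := by
  simp [newCount, scaleCount, hj]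

theorem scaleCount_of_le (hd : 0 < d) {j : ℕ} (hj : countRounds d ≤ j % scaleRounds d) (c : ℕ) :
    scaleCount d j c = c := by
  have := countRounds_pos hd
  rw [scaleCount, if_neg (by omega)]

theorem countRounds_lt_scaleRounds (hd : 0 < d) : countRounds d < scaleRounds d := by
  have := blockLen_pos hd
  rw [scaleRounds]
  have : 0 < 256 * blockLen d * d ^ 2 := by positivity
  omega

/-- The estimate for scale `k` is off by more than a factor `C`. -/
def StageFar (d : ℕ) (C : ℝ) (n k : ℕ) : Prop :=
  ¬ ((n : ℝ) ≤ C * (numRoles d * 2 ^ k : ℕ) ∧ ((numRoles d * 2 ^ k : ℕ) : ℝ) ≤ C * n)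

open Classical in
/-- A potential for electing a leader at a wrong scale. -/
noncomputable def stageUpper (d : ℕ) (C : ℝ) (n : ℕ) (y : ℝ) (j : ℕ) (found : Option ℕ) (c : ℕ) :
    ℝ :=
  match found with
  | some k => if StageFar d C n k then 1 else 0
  | none => if j / scaleRounds d ≤ d then
      ((d - j / scaleRounds d : ℕ) : ℝ) * y ^ threshold d +
        if StageFar d C n (d - j / scaleRounds d) then
          upperPot 128 y (threshold d) (countRounds d) (j % scaleRounds d) (scaleCount d j c)
        else 0
    else 0

theorem stageUpper_nonneg {C y : ℝ} (hy : 0 ≤ y) (j : ℕ) (found : Option ℕ) (c : ℕ) :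
    0 ≤ stageUpper d C n y j found c := by
  have := upperPot_nonneg hy (σ := 128) (threshold d) (countRounds d) (j % scaleRounds d)
    (scaleCount d j c)
  rcases found with _ | k <;> simp only [stageUpper] <;> split_ifs <;> positivity

theorem stageUpper_zero_le {C y : ℝ} (hy : 0 < y) :
    stageUpper d C n y 0 none 0 ≤ (d + 1) * y ^ threshold d := by
  have h1 := upperPot_zero_le (σ := 128) (by norm_num) hy (threshold d)
  have h2 : (0 : ℝ) < y ^ threshold d := by positivity
  have h3 : countRounds d = 128 * threshold d := rfl
  simp only [stageUpper, Nat.zero_div, Nat.zero_le, if_true, Nat.sub_zero, Nat.zero_mod, scaleCount,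
    h3]
  split_ifs <;> linarith

theorem foundAfter_some {j : ℕ} {r : Fin n → Duty} {info : Fin n → Option (Bool × ℕ)} {k c : ℕ}
    {x : Fin n → ℕ} : foundAfter d j r info (some k) c x = some k := by
  rw [foundAfter, if_neg]
  simp only [electedIn, decide_eq_true_iff, not_exists]
  intro v hv
  have := hv.2.2
  rw [Option.isSome_some, leads_false] at this
  cases this

theorem eligible_of_electedIn {j : ℕ} {r : Fin n → Duty} {info : Fin n → Option (Bool × ℕ)}
    {c : ℕ} {x : Fin n → ℕ} (h : electedIn d j r info x false c = true) :
    countRounds d ≤ j % scaleRounds d ∧ threshold d ≤ newCount d j (single d j r x) c := by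
  obtain ⟨v, hv⟩ : ∃ v, Elected d j r info x false c v := by simpa [electedIn] using h
  have := hv.2.2
  simp only [leads, roundMsg, Bool.and_eq_true] at this
  exact of_decide_eq_true this.2

open Classical in
-- In counting rounds this is `upperPot_step`; in election rounds the count is frozen and the
-- exponent `W - w` is already `0`, so the potential stands still. An election at a far scale would
-- require the threshold to be reached, where `upperPot` is at least `1`, and this is excluded by
-- `hlt`.
theorem avg_stageUpper_le (hd : 0 < d) {C y : ℝ} (hy : 0 < y) {r : Fin n → Duty}
    {info : Fin n → Option (Bool × ℕ)} {j : ℕ} (hj : j < numRounds d) {found : Option ℕ} {c : ℕ}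
    (hq : StageFar d C n (d - j / scaleRounds d) →
      singleProb (cands j r).card (d - j / scaleRounds d) ≤ y / (4 * (128 : ℕ)))
    (hlt : stageUpper d C n y j found c < 1) :
    avg (roundSize d j r info) (fun x => stageUpper d C n y (j + 1)
      (foundAfter d j r info found c x) (newCount d j (single d j r x) c)) ≤
      stageUpper d C n y j found c := by
  have hN := roundSize_pos hd j r info
  rcases found with _ | k
  swap
  · simp only [foundAfter_some, stageUpper]
    exact (avg_const hN _).le
  have hP := scaleRounds_pos hd
  have hWP := countRounds_lt_scaleRounds hd
  set P := scaleRounds d with hPdef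
  set W := countRounds d with hWdef
  set m := threshold d with hmdef
  set s := j / P with hs
  set w := j % P with hw
  set c₀ := scaleCount d j c with hc₀
  have hwP : w < P := Nat.mod_lt j hP
  have hsd : s ≤ d := Nat.lt_succ_iff.1 (Nat.div_lt_of_lt_mul (by rw [mul_comm]; exact hj))
  have hym : 0 < y ^ m := by positivity
  have hsd0 : (0 : ℝ) ≤ ((d - s : ℕ) : ℝ) := Nat.cast_nonneg _
  set R : ℕ → ℕ → ℝ := fun w' c' => ((d - s : ℕ) : ℝ) * y ^ m +
    if StageFar d C n (d - s) then upperPot 128 y m W w' c' else 0 with hR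
  have hU := fun w' c' => upperPot_nonneg hy.le (σ := 128) m W w' c'
  have hR0 : ∀ w' c', 0 ≤ R w' c' := by
    intro w' c'
    have := hU w' c'
    simp only [hR]
    split_ifs <;> positivity
  have hval : stageUpper d C n y j none c = R w c₀ := by
    simp only [stageUpper, ← hPdef, ← hs, if_pos hsd]
    rfl
  have hnone : ∀ c', stageUpper d C n y (j + 1) none c' ≤ R (w + 1) c' := by
    intro c'
    simp only [stageUpper, scaleCount, ← hPdef, ← hWdef, ← hmdef]
    rcases succ_div_mod hP j with ⟨h1, h2, h3⟩ | ⟨h1, h2, h3⟩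
    · rw [h2, h3, if_pos hsd, if_neg (Nat.succ_ne_zero _)]
    · rw [h2, h3, if_pos rfl]
      split_ifs with h4 h5
      · have h6 := upperPot_zero_le (σ := 128) (by norm_num) hy m
        have h7 : W = 128 * m := rfl
        rw [← h7] at h6
        have e : ((d - s : ℕ) : ℝ) = ((d - (s + 1) : ℕ) : ℝ) + 1 := by
          have : d - s = (d - (s + 1)) + 1 := by omega
          rw [this]
          push_cast
          rfl
        have h8 := hU (w + 1) c'
        simp only [hR]
        rw [e]
        split_ifs <;> linarith
      · have e : ((d - s : ℕ) : ℝ) = ((d - (s + 1) : ℕ) : ℝ) + 1 := by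
          have : d - s = (d - (s + 1)) + 1 := by omega
          rw [this]
          push_cast
          rfl
        have h8 := hU (w + 1) c'
        simp only [hR]
        rw [e]
        split_ifs <;> linarith
      · exact hR0 _ _
  rw [hval] at hlt ⊢
  have hpoint : ∀ x, stageUpper d C n y (j + 1) (foundAfter d j r info none c x)
      (newCount d j (single d j r x) c) ≤ R (w + 1) (newCount d j (single d j r x) c) := by
    intro x
    by_cases he : electedIn d j r info x false c = true
    · rw [foundAfter, Option.isSome_none, if_pos he]
      obtain ⟨h1, h2⟩ := eligible_of_electedIn he
      rw [newCount_of_le h1] at h2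
      have h3 : ¬ StageFar d C n (d - s) := by
        intro hf
        simp only [hR, if_pos hf] at hlt
        have := one_le_upperPot (σ := 128) (y := y) h2 W w
        have : 0 ≤ ((d - s : ℕ) : ℝ) * y ^ m := by positivity
        linarith
      simp only [stageUpper]
      rw [if_neg h3]
      exact hR0 _ _
    · rw [foundAfter, Option.isSome_none, if_neg he]
      exact hnone _
  refine (avg_mono fun x _ => hpoint x).trans ?_
  by_cases hwW : w < W
  · have h1 : ∀ x, R (w + 1) (newCount d j (single d j r x) c) =
        if single d j r x = true then R (w + 1) (c₀ + 1) else R (w + 1) c₀ := by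
      intro x
      rw [newCount_of_lt hwW]
      split_ifs <;> rfl
    simp only [h1]
    rw [avg_ite hN, avg_single hd, ← hPdef, ← hs]
    set q := singleProb (cands j r).card (d - s) with hqdef
    have hq0 : 0 ≤ q := by
      rw [hqdef, hs, hPdef, ← avg_single (info := info) hd]
      exact avg_nonneg fun x _ => by split_ifs <;> norm_num
    simp only [hR]
    split_ifs with hf
    · have := upperPot_step (σ := 128) (m := m) (c := c₀) (by norm_num) hy (hq hf) hq0 hwW
      linarith
    · linarith
  · have h1 : ∀ x, R (w + 1) (newCount d j (single d j r x) c) = R w c₀ := by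
      intro x
      rw [newCount_of_le (not_lt.1 hwW)]
      have e1 : W - (w + 1) = 0 := by omega
      have e2 : W - w = 0 := by omega
      simp only [hR, upperPot, e1, e2]
      rfl
    simp only [h1]
    exact (avg_const hN _).le

/-- The probability that a leader is not elected in a round, when the count is sufficient. -/
noncomputable def missProb (d : ℕ) : ℝ := 1 - 1 / (256 * blockLen d)

theorem missProb_nonneg (hd : 0 < d) : 0 ≤ missProb d := by
  have hb : (1 : ℝ) ≤ blockLen d := by exact_mod_cast blockLen_pos hd
  rw [missProb, sub_nonneg, div_le_one (by positivity)]
  linarith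

theorem missProb_le_one : missProb d ≤ 1 := by
  rw [missProb]
  have : (0 : ℝ) ≤ 1 / (256 * blockLen d) := by positivity
  linarith

/-- A potential for not electing a leader by the end of scale index `s`, as long as the public
information is not lost. -/
noncomputable def lowerMain (d s j c : ℕ) : ℝ :=
  if j / scaleRounds d < s then
    (1 / 2) ^ threshold d + missProb d ^ (scaleRounds d - countRounds d)
  else if j / scaleRounds d = s then
    if j % scaleRounds d < countRounds d then
      lowerPot (1 / 32) (threshold d) (countRounds d) (j % scaleRounds d) (scaleCount d j c) +
        missProb d ^ (scaleRounds d - countRounds d)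
    else if threshold d ≤ c then missProb d ^ (scaleRounds d - j % scaleRounds d) else 1
  else 1

open Classical in
/-- A potential for not electing a leader by the end of scale index `s`. -/
noncomputable def stageLower (d s : ℕ) (r : Fin n → Duty) (j : ℕ) (found : Option ℕ) (c : ℕ)
    (info : Fin n → Option (Bool × ℕ)) : ℝ :=
  match found with
  | some _ => 0
  | none => if Alive d j r info then
      ((numRounds d - j : ℕ) : ℝ) * (7 / 8) ^ attempts d + lowerMain d s j c
    else 1

theorem lowerMain_nonneg (hd : 0 < d) (s j c : ℕ) : 0 ≤ lowerMain d s j c := by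
  have h1 := missProb_nonneg hd
  have h2 := lowerPot_nonneg (q := 1 / 32) (by norm_num) (threshold d) (countRounds d)
    (j % scaleRounds d) (scaleCount d j c)
  unfold lowerMain
  split_ifs <;> positivity

theorem stageLower_nonneg (hd : 0 < d) (s : ℕ) (r : Fin n → Duty) (j : ℕ) (found : Option ℕ)
    (c : ℕ) (info : Fin n → Option (Bool × ℕ)) : 0 ≤ stageLower d s r j found c info := by
  have := lowerMain_nonneg hd s j c
  rcases found with _ | k <;> simp only [stageLower]
  · split_ifs <;> positivity
  · exact le_rfl

theorem lowerMain_start_le (hd : 0 < d) (s c : ℕ) : lowerMain d s 0 c ≤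
    (1 / 2) ^ threshold d + missProb d ^ (scaleRounds d - countRounds d) := by
  have h1 := lowerPot_zero_le (q := 1 / 32) (σ := 128) (by norm_num) (by norm_num) (threshold d)
  have h2 : countRounds d = 128 * threshold d := rfl
  rw [← h2] at h1
  have h3 := countRounds_pos hd
  rw [lowerMain, Nat.zero_div, Nat.zero_mod, scaleCount, Nat.zero_mod, if_pos rfl, if_pos h3]
  split_ifs with h4 h5
  · exact le_rfl
  · linarith
  · omega

open Classical in
-- At scale index `s` the counting rounds follow `lowerPot`, and every election round contributes
-- one factor `missProb d`. If counting ends below the threshold, `lowerPot` has reached `1`, the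
-- value of that hopeless state.
theorem avg_lowerMain_le (hd : 0 < d) {s : ℕ} {r : Fin n → Duty}
    {info : Fin n → Option (Bool × ℕ)} {j c : ℕ}
    (hr : RolesOK d r) (hn : n ≤ 2 ^ d)
    (hrel : ∀ w < attempts d, ∀ l < blockLen d, ∃ v, r v = .relay j l w)
    (hnear : j / scaleRounds d = s →
      1 / 32 ≤ singleProb (cands j r).card (d - j / scaleRounds d))
    (ha : Alive d j r info) (hlt : lowerMain d s j c < 1) :
    avg (roundSize d j r info) (fun x => if (foundAfter d j r info none c x).isSome then 0 else
      lowerMain d s (j + 1) (newCount d j (single d j r x) c)) ≤ lowerMain d s j c := by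
  have hN := roundSize_pos hd j r info
  have hP := scaleRounds_pos hd
  have hWP := countRounds_lt_scaleRounds hd
  have hmp := missProb_nonneg hd
  have hmp1 := missProb_le_one (d := d)
  have hpos := fun j c => lowerMain_nonneg hd s j c
  have hdrop : ∀ x, (if (foundAfter d j r info none c x).isSome then 0 else
      lowerMain d s (j + 1) (newCount d j (single d j r x) c)) ≤
      lowerMain d s (j + 1) (newCount d j (single d j r x) c) := by
    intro x
    split_ifs
    · exact hpos _ _
    · exact le_rfl
  rcases lt_trichotomy (j / scaleRounds d) s with h | h | h
  · have hval : lowerMain d s j c =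
        (1 / 2) ^ threshold d + missProb d ^ (scaleRounds d - countRounds d) := by
      rw [lowerMain, if_pos h]
    rw [hval]
    refine (avg_mono fun x _ => (hdrop x).trans ?_).trans (avg_const hN _).le
    rcases succ_div_mod hP j with ⟨h1, h2, h3⟩ | ⟨h1, h2, h3⟩
    · rw [lowerMain, h2, if_pos h]
    · have hW := countRounds_pos hd
      rw [lowerMain, h2, h3, scaleCount, h3, if_pos rfl, if_pos hW]
      have h4 := lowerPot_zero_le (q := 1 / 32) (σ := 128) (by norm_num) (by norm_num)
        (threshold d)
      have h5 : countRounds d = 128 * threshold d := rfl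
      rw [← h5] at h4
      split_ifs
      · exact le_rfl
      · linarith
      · omega
  · by_cases hw : j % scaleRounds d < countRounds d
    · have hval : lowerMain d s j c = lowerPot (1 / 32) (threshold d) (countRounds d)
          (j % scaleRounds d) (scaleCount d j c) +
          missProb d ^ (scaleRounds d - countRounds d) := by
        rw [lowerMain, if_neg (by omega), if_pos h, if_pos hw]
      rw [hval]
      set Q : ℕ → ℝ := fun c' => lowerPot (1 / 32) (threshold d) (countRounds d)
          (j % scaleRounds d + 1) c' with hQ
      have hnext : ∀ c', lowerMain d s (j + 1) c' ≤
          Q c' + missProb d ^ (scaleRounds d - countRounds d) := by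
        intro c'
        rcases succ_div_mod hP j with ⟨h1, h2, h3⟩ | ⟨h1, h2, h3⟩
        · have hQ0 : 0 ≤ Q c' := lowerPot_nonneg (by norm_num) _ _ _ _
          have hm0 : 0 ≤ missProb d ^ (scaleRounds d - countRounds d) := by positivity
          rw [lowerMain, h2, h3, if_neg (by omega), if_pos h, scaleCount, h3,
            if_neg (Nat.succ_ne_zero _)]
          split_ifs with h4 h5
          · exact le_rfl
          · rw [show j % scaleRounds d + 1 = countRounds d by omega]
            linarith
          · have h6 : j % scaleRounds d + 1 = countRounds d := by omega
            have := one_le_lowerPot (q := 1 / 32) (not_le.1 h5).le (countRounds d)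
            simp only [hQ, h6]
            linarith
        · omega
      have h1 : ∀ x, lowerMain d s (j + 1) (newCount d j (single d j r x) c) ≤
          (if single d j r x = true then Q (scaleCount d j c + 1) else Q (scaleCount d j c)) +
            missProb d ^ (scaleRounds d - countRounds d) := by
        intro x
        refine (hnext _).trans (le_of_eq ?_)
        rw [newCount_of_lt hw]
        split_ifs <;> rfl
      refine (avg_mono fun x _ => (hdrop x).trans (h1 x)).trans ?_
      rw [avg_add, avg_const hN, avg_ite hN, avg_single hd]
      have := lowerPot_step (q := 1 / 32) (m := threshold d) (c := scaleCount d j c) (hnear h)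
        (by norm_num) hw
      linarith
    · rw [not_lt] at hw
      have hval : lowerMain d s j c = if threshold d ≤ c then
          missProb d ^ (scaleRounds d - j % scaleRounds d) else 1 := by
        rw [lowerMain, if_neg (by omega), if_pos h, if_neg (by omega)]
      by_cases hc : threshold d ≤ c
      · rw [if_pos hc] at hval
        have hnext : lowerMain d s (j + 1) c ≤
            missProb d ^ (scaleRounds d - (j % scaleRounds d + 1)) := by
          rcases succ_div_mod hP j with ⟨h1, h2, h3⟩ | ⟨h1, h2, h3⟩
          · rw [lowerMain, h2, h3, if_neg (by omega), if_pos h, if_neg (by omega), if_pos hc]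
          · rw [lowerMain, h2, if_neg (by omega), if_neg (by omega), h1, Nat.sub_self, pow_zero]
        have hel := ha.avg_elected_ge hd hr hn hrel (hnear h) hw hc
        have hmod := Nat.mod_lt j hP
        obtain ⟨t, ht⟩ : ∃ t, scaleRounds d - j % scaleRounds d = t + 1 :=
          ⟨scaleRounds d - j % scaleRounds d - 1, by omega⟩
        have ht' : scaleRounds d - (j % scaleRounds d + 1) = t := by omega
        rw [ht'] at hnext
        rw [hval, ht, pow_succ]
        have h1 : ∀ x, (if (foundAfter d j r info none c x).isSome then 0 else
            lowerMain d s (j + 1) (newCount d j (single d j r x) c)) ≤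
            if electedIn d j r info x false c = true then 0 else missProb d ^ t := by
          intro x
          rw [newCount_of_le hw, scaleCount_of_le hd hw, foundAfter_isSome, Option.isSome_none,
            Bool.false_or]
          split_ifs
          · exact le_rfl
          · exact hnext
        refine (avg_mono fun x _ => h1 x).trans ?_
        rw [avg_ite hN, mul_zero, zero_add, mul_comm]
        have : 0 ≤ missProb d ^ t := by positivity
        refine mul_le_mul_of_nonneg_left ?_ this
        rw [missProb]
        linarith
      · rw [hval, if_neg hc] at hlt
        exact absurd hlt (lt_irrefl _)
  · rw [lowerMain, if_neg (by omega), if_neg (by omega)] at hlt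
    exact absurd hlt (lt_irrefl _)

open Classical in
-- Losing the public information is valued `1` and has probability at most `(7 / 8) ^ attempts d`
-- per round. This is prepaid by the summand proportional to the number of remaining rounds.
theorem avg_stageLower_le (hd : 0 < d) {s : ℕ} {r : Fin n → Duty}
    {info : Fin n → Option (Bool × ℕ)} {j c : ℕ} (hj : j < numRounds d) {found : Option ℕ}
    (hr : RolesOK d r) (hn : n ≤ 2 ^ d)
    (hrel : ∀ w < attempts d, ∀ l < blockLen d, ∃ v, r v = .relay j l w)
    (hnear : j / scaleRounds d = s →
      1 / 32 ≤ singleProb (cands j r).card (d - j / scaleRounds d))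
    (hlt : stageLower d s r j found c info < 1) :
    avg (roundSize d j r info) (fun x => stageLower d s r (j + 1) (foundAfter d j r info found c x)
      (newCount d j (single d j r x) c) (infoAfter d j r info found.isSome c x)) ≤
      stageLower d s r j found c info := by
  have hN := roundSize_pos hd j r info
  rcases found with _ | k
  swap
  · simp only [foundAfter_some, stageLower]
    exact (avg_const hN _).le
  by_cases ha : Alive d j r info
  swap
  · simp only [stageLower, if_neg ha] at hlt
    exact absurd hlt (lt_irrefl _)
  have hval : stageLower d s r j none c info =
      ((numRounds d - j : ℕ) : ℝ) * (7 / 8) ^ attempts d + lowerMain d s j c := by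
    simp only [stageLower, if_pos ha]
  have hε : (0 : ℝ) ≤ (7 / 8) ^ attempts d := by positivity
  have hJ0 : (0 : ℝ) ≤ ((numRounds d - (j + 1) : ℕ) : ℝ) := Nat.cast_nonneg _
  have hJ : ((numRounds d - j : ℕ) : ℝ) = ((numRounds d - (j + 1) : ℕ) : ℝ) + 1 := by
    have : numRounds d - j = numRounds d - (j + 1) + 1 := by omega
    rw [this]
    push_cast
    rfl
  have hpoint : ∀ x, stageLower d s r (j + 1) (foundAfter d j r info none c x)
      (newCount d j (single d j r x) c) (infoAfter d j r info false c x) ≤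
      ((numRounds d - (j + 1) : ℕ) : ℝ) * (7 / 8) ^ attempts d +
        ((if Alive d (j + 1) r (infoAfter d j r info false c x) then 0 else 1) +
        if (foundAfter d j r info none c x).isSome then 0 else
          lowerMain d s (j + 1) (newCount d j (single d j r x) c)) := by
    intro x
    have h1 := lowerMain_nonneg hd s (j + 1) (newCount d j (single d j r x) c)
    have h2 : 0 ≤ ((numRounds d - (j + 1) : ℕ) : ℝ) * (7 / 8) ^ attempts d := by positivity
    rcases foundAfter d j r info none c x with _ | k <;> simp only [stageLower]
    · by_cases hx : Alive d (j + 1) r (infoAfter d j r info false c x)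
      · simp only [if_pos hx]
        simp
      · simp only [if_neg hx]
        simp
        linarith
    · simp only [Option.isSome_some, if_true]
      split_ifs <;> linarith
  refine (avg_mono fun x _ => hpoint x).trans ?_
  rw [avg_add, avg_add, avg_const hN, hval, hJ]
  rw [hval] at hlt
  have h1 := ha.avg_not_alive_le hd hr hn hrel false c
  have h2 : 0 ≤ ((numRounds d - j : ℕ) : ℝ) * (7 / 8) ^ attempts d := by positivity
  have h3 := avg_lowerMain_le hd hr hn hrel hnear ha (c := c) (by linarith)
  linarith

end Value

/-! ### From the potentials to failure bounds for a stage -/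

section Stage

variable {n : ℕ} {d : ℕ → ℕ} {N : ℕ} {cd : CDModel}

/-- A stage continues with the next one, or fails with small probability. -/
theorem stage_fail_of_next {i e T T' E : ℕ} {C F y : ℝ} {r : Fin n → Duty} (hd : 0 < d i)
    (hr : RolesOK (d i) r) (hE : e + 5 ≤ E) (hy : 0 < y) (hF : 0 ≤ F)
    (hfar : ∀ j < numRounds (d i), StageFar (d i) C n (d i - j / scaleRounds (d i)) →
      singleProb (cands j r).card (d i - j / scaleRounds (d i)) ≤ y / (4 * (128 : ℕ)))
    (hnext : ∀ (D : Fin n → Device (protocol d N cd).alg) (T : ℕ),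
      Conf d N cd (.pick (i + 1)) (e + 5) D → T' ≤ T →
      FailLE (protocol d N cd) cd (goodSet (protocol d N cd) n C E) D T F)
    (hT : numRounds (d i) * (blockLen (d i) + 2) + 1 + T' ≤ T)
    (D : Fin n → Device (protocol d N cd).alg)
    (h : StageConf d N cd i 0 r (fun v => startInfo (r v)) (fun _ => none) e D) :
    FailLE (protocol d N cd) cd (goodSet (protocol d N cd) n C E) D T
      ((d i + 1) * y ^ threshold (d i) + F) := by
  have hJ := numRounds_pos hd
  refine (stage_fail hd hr hE (fun j found c _ => stageUpper (d i) C n y j found c + F)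
    (fun j found c _ => add_nonneg (stageUpper_nonneg hy.le j found c) hF) hnext
    (fun c _ => ?_) (fun k c _ hlt => ?_) (fun j hj found c info _ hlt => ?_)
    (numRounds (d i) - 1) 0 T 0 none _ _ (by omega) ?_ (infoOK_startInfo r) (fun _ => rfl) D
    h).mono ?_
  · linarith [stageUpper_nonneg (d := d i) (C := C) (n := n) hy.le (numRounds (d i)) none c]
  · by_contra hcon
    simp only [stageUpper] at hlt
    rw [if_pos (by exact hcon)] at hlt
    linarith
  · rw [avg_add, avg_const (roundSize_pos hd j r info)]
    have := avg_stageUpper_le hd hy hj (info := info) (hfar j hj) (c := c) (found := found)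
      (by linarith)
    linarith
  · rwa [Nat.sub_add_cancel hJ]
  · have := stageUpper_zero_le (d := d i) (C := C) (n := n) hy
    linarith

/-- A stage whose parameter matches the network size succeeds with high probability. -/
theorem stage_fail_of_le {i e T E s : ℕ} {C y : ℝ} {r : Fin n → Duty} (hd : 0 < d i)
    (hr : RolesOK (d i) r) (hE : e + 5 ≤ E) (hy : 0 < y)
    (hfar : ∀ j < numRounds (d i), StageFar (d i) C n (d i - j / scaleRounds (d i)) →
      singleProb (cands j r).card (d i - j / scaleRounds (d i)) ≤ y / (4 * (128 : ℕ)))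
    (hn : n ≤ 2 ^ d i) (hs : s ≤ d i)
    (hrel : ∀ j < numRounds (d i), ∀ w < attempts (d i), ∀ l < blockLen (d i),
      ∃ v, r v = .relay j l w)
    (hnear : ∀ j < numRounds (d i), j / scaleRounds (d i) = s →
      1 / 32 ≤ singleProb (cands j r).card (d i - j / scaleRounds (d i)))
    (hT : numRounds (d i) * (blockLen (d i) + 2) + 1 ≤ T)
    (D : Fin n → Device (protocol d N cd).alg)
    (h : StageConf d N cd i 0 r (fun v => startInfo (r v)) (fun _ => none) e D) :
    FailLE (protocol d N cd) cd (goodSet (protocol d N cd) n C E) D T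
      ((d i + 1) * y ^ threshold (d i) + (numRounds (d i) * (7 / 8) ^ attempts (d i) +
        ((1 / 2) ^ threshold (d i) +
          missProb (d i) ^ (scaleRounds (d i) - countRounds (d i))))) := by
  classical
  have hJ := numRounds_pos hd
  have hP := scaleRounds_pos hd
  refine (stage_fail (F := 1) (T' := 0) hd hr hE
    (fun j found c info => stageUpper (d i) C n y j found c + stageLower (d i) s r j found c info)
    (fun j found c info => add_nonneg (stageUpper_nonneg hy.le j found c)
      (stageLower_nonneg hd s r j found c info)) (fun _ _ _ _ => FailLE.of_one_le le_rfl)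
    (fun c info => ?_) (fun k c info hlt => ?_) (fun j hj found c info _ hlt => ?_)
    (numRounds (d i) - 1) 0 T 0 none _ _ (by omega) ?_ (infoOK_startInfo r) (fun _ => rfl) D
    h).mono ?_
  · have h1 := stageUpper_nonneg (d := d i) (C := C) (n := n) hy.le (numRounds (d i)) none c
    have h2 : 1 ≤ stageLower (d i) s r (numRounds (d i)) none c info := by
      simp only [stageLower]
      split_ifs
      · have h3 : numRounds (d i) / scaleRounds (d i) = d i + 1 := by
          rw [numRounds, Nat.mul_div_cancel _ hP]
        rw [lowerMain, h3, if_neg (by omega), if_neg (by omega)]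
        have : (0 : ℝ) ≤ ((numRounds (d i) - numRounds (d i) : ℕ) : ℝ) *
          (7 / 8) ^ attempts (d i) := by positivity
        linarith
      · exact le_rfl
    linarith
  · by_contra hcon
    simp only [stageUpper, stageLower] at hlt
    rw [if_pos (by exact hcon)] at hlt
    linarith
  · have h1 := stageUpper_nonneg (d := d i) (C := C) (n := n) hy.le j found c
    have h2 := stageLower_nonneg hd s r j found c info
    rw [avg_add]
    exact add_le_add (avg_stageUpper_le hd hy hj (hfar j hj) (by linarith))
      (avg_stageLower_le hd hj hr hn (hrel j hj) (hnear j hj) (by linarith))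
  · rwa [Nat.sub_add_cancel hJ]
  · have h1 := stageUpper_zero_le (d := d i) (C := C) (n := n) hy
    have h2 := lowerMain_start_le hd s 0
    have h3 : Alive (d i) 0 r (fun v => startInfo (r v)) :=
      ⟨0, blockLen_pos hd, fun v w hv => by simp only [hv]; rfl⟩
    have h4 : stageLower (d i) s r 0 none 0 (fun v => startInfo (r v)) =
        numRounds (d i) * (7 / 8) ^ attempts (d i) + lowerMain (d i) s 0 0 := by
      simp only [stageLower, if_pos h3, Nat.sub_zero]
    rw [h4]
    linarith

end Stage

/-! ### The distribution of the roles -/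

section Counts

variable {n : ℕ}

/-- The number of devices that drew `ρ`. -/
def drawCount (x : Fin n → ℕ) (ρ : ℕ) : ℕ := (univ.filter fun v => x v = ρ).card

/-- All numbers are drawn about as often as expected. -/
def Balanced (R : ℕ) (x : Fin n → ℕ) : Prop :=
  ∀ ρ < R, (n / R : ℝ) / 2 ≤ drawCount x ρ ∧ (drawCount x ρ : ℝ) ≤ 2 * (n / R)

/-- By independence the exponential moment is the `n`-th power of `1 + (exp t - 1) / R`. -/
theorem avg_exp_drawCount_le {R ρ : ℕ} (hρ : ρ < R) (t : ℝ) :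
    avg (fun _ : Fin n => R) (fun x => Real.exp (t * drawCount x ρ)) ≤
      Real.exp (n / R * (Real.exp t - 1)) := by
  have hR : (0 : ℝ) < R := by exact_mod_cast (by omega : 0 < R)
  have h1 : ∀ x : Fin n → ℕ, Real.exp (t * drawCount x ρ) =
      ∏ v, if x v = ρ then Real.exp t else 1 := by
    intro x
    rw [Finset.prod_ite, Finset.prod_const, Finset.prod_const_one, mul_one, mul_comm,
      Real.exp_nat_mul]
    rfl
  simp only [h1]
  rw [avg_prod fun _ k => if k = ρ then Real.exp t else 1]
  have h2 : (∑ k ∈ range R, if k = ρ then Real.exp t else 1) / R = 1 + (Real.exp t - 1) / R := by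
    have : ∀ k, (if k = ρ then Real.exp t else 1) = (if k = ρ then Real.exp t - 1 else 0) + 1 := by
      intro k; split_ifs <;> ring
    simp only [this, Finset.sum_add_distrib, Finset.sum_ite_eq', mem_range, hρ, if_true]
    simp
    field_simp
    ring
  rw [Finset.prod_const, h2, card_univ, Fintype.card_fin]
  have h3 : 0 ≤ 1 + (Real.exp t - 1) / R := by
    rw [← h2]
    exact div_nonneg (Finset.sum_nonneg fun k _ => by split_ifs <;> positivity) hR.le
  calc (1 + (Real.exp t - 1) / R) ^ n ≤ (Real.exp ((Real.exp t - 1) / R)) ^ n := by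
        refine pow_le_pow_left₀ h3 ?_ n
        linarith [Real.add_one_le_exp ((Real.exp t - 1) / R)]
    _ = Real.exp (n / R * (Real.exp t - 1)) := by
        rw [← Real.exp_nat_mul]
        congr 1
        field_simp

theorem exp_half_le : Real.exp (1 / 2) ≤ 7 / 4 := by
  have h3 : Real.exp (1 / 2) * Real.exp (1 / 2) = Real.exp 1 := by
    rw [← Real.exp_add]; norm_num
  have h4 := Real.exp_one_lt_d9
  nlinarith [Real.exp_pos (1 / 2)]

theorem exp_neg_half_le : Real.exp (-(1 / 2)) ≤ 11 / 16 := by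
  have h3 : Real.exp (-(1 / 2)) * Real.exp (-(1 / 2)) * Real.exp 1 = 1 := by
    rw [← Real.exp_add, ← Real.exp_add]; norm_num
  have h4 := Real.exp_one_gt_d9
  have h5 := Real.exp_pos (-(1 / 2))
  by_contra hcon
  push Not at hcon
  have h6 : (11 / 16 : ℝ) * (11 / 16) ≤ Real.exp (-(1 / 2)) * Real.exp (-(1 / 2)) := by nlinarith
  nlinarith

open Classical in
-- Chernoff's bound with `t = -1 / 2` for the lower tail and `t = 1 / 2` for the upper one, and a
-- union bound over the roles. The bounds `11 / 16` and `7 / 4` for the two exponentials leave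
-- exponents `-μ / 16` and `-μ / 4`.
theorem avg_not_balanced_le {R : ℕ} (hR : 0 < R) :
    avg (fun _ : Fin n => R) (fun x => if Balanced R x then 0 else 1) ≤
      2 * R * Real.exp (-(n / R / 16)) := by
  set μ : ℝ := n / R with hμ
  have hμ0 : 0 ≤ μ := by positivity
  have h1 : ∀ x : Fin n → ℕ, (if Balanced R x then (0 : ℝ) else 1) ≤
      ∑ ρ ∈ range R, (Real.exp (-(1 / 2) * drawCount x ρ) * Real.exp (μ / 4) +
        Real.exp (1 / 2 * drawCount x ρ) * Real.exp (-μ)) := by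
    intro x
    split_ifs with hb
    · positivity
    · rw [Balanced] at hb
      push Not at hb
      obtain ⟨ρ, hρ, hb⟩ := hb
      refine le_trans ?_ (Finset.single_le_sum (fun ρ _ => by positivity) (mem_range.2 hρ))
      rw [← Real.exp_add, ← Real.exp_add]
      by_cases h : μ / 2 ≤ drawCount x ρ
      · have := hb h
        have h2 : 1 ≤ Real.exp (1 / 2 * drawCount x ρ + -μ) := Real.one_le_exp (by linarith)
        have := Real.exp_pos (-(1 / 2) * drawCount x ρ + μ / 4)
        linarith
      · have h2 : 1 ≤ Real.exp (-(1 / 2) * drawCount x ρ + μ / 4) :=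
          Real.one_le_exp (by push Not at h; linarith)
        have := Real.exp_pos (1 / 2 * drawCount x ρ + -μ)
        linarith
  refine (avg_mono fun x _ => h1 x).trans ?_
  rw [avg_sum]
  have h2 : ∀ ρ ∈ range R, avg (fun _ : Fin n => R) (fun x =>
      Real.exp (-(1 / 2) * drawCount x ρ) * Real.exp (μ / 4) +
        Real.exp (1 / 2 * drawCount x ρ) * Real.exp (-μ)) ≤ 2 * Real.exp (-(μ / 16)) := by
    intro ρ hρ
    rw [mem_range] at hρ
    rw [avg_add]
    have e1 : (fun x : Fin n → ℕ => Real.exp (-(1 / 2) * drawCount x ρ) * Real.exp (μ / 4)) =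
        fun x => Real.exp (μ / 4) * Real.exp (-(1 / 2) * drawCount x ρ) := by
      funext x; ring
    have e2 : (fun x : Fin n → ℕ => Real.exp (1 / 2 * drawCount x ρ) * Real.exp (-μ)) =
        fun x => Real.exp (-μ) * Real.exp (1 / 2 * drawCount x ρ) := by
      funext x; ring
    rw [e1, e2, avg_mul_left, avg_mul_left]
    have h3 := avg_exp_drawCount_le (n := n) hρ (-(1 / 2))
    have h4 := avg_exp_drawCount_le (n := n) hρ (1 / 2)
    rw [← hμ] at h3 h4
    have h5 : Real.exp (μ / 4) * Real.exp (μ * (Real.exp (-(1 / 2)) - 1)) ≤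
        Real.exp (-(μ / 16)) := by
      rw [← Real.exp_add]
      apply Real.exp_le_exp.2
      nlinarith [exp_neg_half_le]
    have h6 : Real.exp (-μ) * Real.exp (μ * (Real.exp (1 / 2) - 1)) ≤ Real.exp (-(μ / 16)) := by
      rw [← Real.exp_add]
      apply Real.exp_le_exp.2
      nlinarith [exp_half_le]
    have h7 := mul_le_mul_of_nonneg_left h3 (Real.exp_pos (μ / 4)).le
    have h8 := mul_le_mul_of_nonneg_left h4 (Real.exp_pos (-μ)).le
    linarith
  refine (Finset.sum_le_sum h2).trans (le_of_eq ?_)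
  rw [Finset.sum_const, card_range, nsmul_eq_mul]
  ring

end Counts

/-! ### Stages with random roles -/

section Roles

variable {n : ℕ} {d : ℕ → ℕ} {N : ℕ} {cd : CDModel}

theorem card_cands {d' : ℕ} (x : Fin n → ℕ) {j : ℕ} (hj : j < numRounds d') :
    (cands j fun v => decodeDuty d' (x v)).card = drawCount x j := by
  classical
  rw [cands, drawCount]
  congr 1
  refine Finset.filter_congr fun v _ => ?_
  show decodeDuty d' (x v) = .cand j ↔ x v = j
  unfold decodeDuty
  split_ifs with h
  · simp
  · simp
    omega

theorem numRounds_le_numRoles (d : ℕ) : numRounds d ≤ numRoles d := Nat.le_add_right _ _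

/-- Balance makes the count of every role positive. Without relays for every slot and column,
`Alive` could hold vacuously, with nobody informed. -/
theorem exists_relay {d' : ℕ} (hn : 0 < n) {x : Fin n → ℕ} (hx : Balanced (numRoles d') x)
    (hd : 0 < d') {j l w : ℕ} (hj : j < numRounds d') (hl : l < blockLen d')
    (hw : w < attempts d') : ∃ v, decodeDuty d' (x v) = .relay j l w := by
  have hlt : numRounds d' + ((j * blockLen d' + l) * attempts d' + w) < numRoles d' := by
    have h1 : j * blockLen d' + l + 1 ≤ numRounds d' * blockLen d' := by
      have : (j + 1) * blockLen d' ≤ numRounds d' * blockLen d' := Nat.mul_le_mul_right _ hj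
      rw [add_mul, one_mul] at this
      omega
    have h2 := Nat.mul_le_mul_right (attempts d') h1
    rw [add_mul, one_mul] at h2
    rw [numRoles]
    omega
  obtain ⟨h1, _⟩ := hx _ hlt
  have h2 : drawCount x (numRounds d' + ((j * blockLen d' + l) * attempts d' + w)) ≠ 0 := by
    intro h0
    rw [h0] at h1
    have h3 : (0 : ℝ) < n := by exact_mod_cast hn
    have h4 : (0 : ℝ) < numRoles d' := by exact_mod_cast numRoles_pos hd
    have : (0 : ℝ) < (n / numRoles d') / 2 := by positivity
    push_cast at h1
    linarith
  rw [drawCount, Finset.card_ne_zero] at h2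
  obtain ⟨v, hv⟩ := h2
  refine ⟨v, ?_⟩
  rw [mem_filter] at hv
  rw [decodeDuty, hv.2, if_neg (by omega), Nat.add_sub_cancel_left]
  have e1 : ((j * blockLen d' + l) * attempts d' + w) / attempts d' = j * blockLen d' + l := by
    rw [mul_comm, Nat.mul_add_div (attempts_pos hd), Nat.div_eq_of_lt hw, add_zero]
  have e2 : ((j * blockLen d' + l) * attempts d' + w) % attempts d' = w := by
    rw [mul_comm, Nat.mul_add_mod, Nat.mod_eq_of_lt hw]
  rw [e1, e2, mul_comm j, Nat.mul_add_div (blockLen_pos hd), Nat.div_eq_of_lt hl, add_zero,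
    Nat.mul_add_mod, Nat.mod_eq_of_lt hl]

/-- A stage continues with the next one, or fails with small probability. -/
theorem pick_fail_of_next {i e T T' E : ℕ} {C F y : ℝ} (hd : 0 < d i) (hE : e + 5 ≤ E)
    (hy : 0 < y) (hF : 0 ≤ F)
    (hfar : ∀ k ≤ d i, StageFar (d i) C n k → ∀ M : ℕ, (n / numRoles (d i) : ℝ) / 2 ≤ M →
      (M : ℝ) ≤ 2 * (n / numRoles (d i)) → singleProb M k ≤ y / (4 * (128 : ℕ)))
    (hnext : ∀ (D : Fin n → Device (protocol d N cd).alg) (T : ℕ),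
      Conf d N cd (.pick (i + 1)) (e + 5) D → T' ≤ T →
      FailLE (protocol d N cd) cd (goodSet (protocol d N cd) n C E) D T F)
    (hT : numRounds (d i) * (blockLen (d i) + 2) + 2 + T' ≤ T)
    (D : Fin n → Device (protocol d N cd).alg) (h : Conf d N cd (.pick i) e D) :
    FailLE (protocol d N cd) cd (goodSet (protocol d N cd) n C E) D T
      (2 * numRoles (d i) * Real.exp (-(n / numRoles (d i) / 16)) +
        ((d i + 1) * y ^ threshold (d i) + F)) := by
  classical
  have hR := numRoles_pos hd
  have hc : 0 ≤ (d i + 1) * y ^ threshold (d i) + F := by positivity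
  refine (h.fail_pick hd (by omega) (fun x => (if Balanced (numRoles (d i)) x then 0 else 1) +
    ((d i + 1) * y ^ threshold (d i) + F)) (fun x => ?_) fun x D' hD' => ?_).mono ?_
  · split_ifs <;> linarith
  · by_cases hx : Balanced (numRoles (d i)) x
    · rw [if_pos hx, zero_add]
      refine stage_fail_of_next hd (rolesOK_decodeDuty hd x) hE hy hF (fun j hj hf => ?_) hnext
        (by omega) D' hD'
      obtain ⟨h1, h2⟩ := hx j (hj.trans_le (numRounds_le_numRoles _))
      rw [card_cands x hj]
      exact hfar _ (Nat.sub_le _ _) hf _ h1 h2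
    · rw [if_neg hx]
      exact FailLE.of_one_le (by linarith)
  · rw [avg_add, avg_const fun _ => hR]
    linarith [avg_not_balanced_le (n := n) hR]

/-- A stage whose parameter matches the network size succeeds with high probability. -/
theorem pick_fail_of_le {i e T E k₀ : ℕ} {C y : ℝ} (hd : 0 < d i) (hE : e + 5 ≤ E)
    (hy : 0 < y) (hn0 : 0 < n)
    (hfar : ∀ k ≤ d i, StageFar (d i) C n k → ∀ M : ℕ, (n / numRoles (d i) : ℝ) / 2 ≤ M →
      (M : ℝ) ≤ 2 * (n / numRoles (d i)) → singleProb M k ≤ y / (4 * (128 : ℕ)))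
    (hn : n ≤ 2 ^ d i) (hk₀ : k₀ ≤ d i)
    (hnear : ∀ M : ℕ, (n / numRoles (d i) : ℝ) / 2 ≤ M →
      (M : ℝ) ≤ 2 * (n / numRoles (d i)) → 1 / 32 ≤ singleProb M k₀)
    (hT : numRounds (d i) * (blockLen (d i) + 2) + 2 ≤ T)
    (D : Fin n → Device (protocol d N cd).alg) (h : Conf d N cd (.pick i) e D) :
    FailLE (protocol d N cd) cd (goodSet (protocol d N cd) n C E) D T
      (2 * numRoles (d i) * Real.exp (-(n / numRoles (d i) / 16)) +
        ((d i + 1) * y ^ threshold (d i) + (numRounds (d i) * (7 / 8) ^ attempts (d i) +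
        ((1 / 2) ^ threshold (d i) +
          missProb (d i) ^ (scaleRounds (d i) - countRounds (d i)))))) := by
  classical
  have hR := numRoles_pos hd
  have hmp := missProb_nonneg hd
  have hc : 0 ≤ (d i + 1) * y ^ threshold (d i) + (numRounds (d i) * (7 / 8) ^ attempts (d i) +
        ((1 / 2) ^ threshold (d i) +
          missProb (d i) ^ (scaleRounds (d i) - countRounds (d i)))) := by positivity
  refine (h.fail_pick hd (by omega) (fun x => (if Balanced (numRoles (d i)) x then 0 else 1) +
    ((d i + 1) * y ^ threshold (d i) + (numRounds (d i) * (7 / 8) ^ attempts (d i) +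
        ((1 / 2) ^ threshold (d i) +
          missProb (d i) ^ (scaleRounds (d i) - countRounds (d i))))))
    (fun x => ?_) fun x D' hD' => ?_).mono ?_
  · split_ifs <;> linarith
  · by_cases hx : Balanced (numRoles (d i)) x
    · rw [if_pos hx, zero_add]
      have hb := fun j (hj : j < numRounds (d i)) =>
        hx j (hj.trans_le (numRounds_le_numRoles _))
      -- Scales are visited in decreasing order, so scale `k₀` has index `d i - k₀`.
      refine stage_fail_of_le (s := d i - k₀) hd (rolesOK_decodeDuty hd x) hE hy
        (fun j hj hf => ?_) hn (Nat.sub_le _ _)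
        (fun j hj w hw l hl => exists_relay hn0 hx hd hj hl hw) (fun j hj hs => ?_)
        (by omega) D' hD'
      · rw [card_cands x hj]
        exact hfar _ (Nat.sub_le _ _) hf _ (hb j hj).1 (hb j hj).2
      · rw [card_cands x hj, hs, Nat.sub_sub_self hk₀]
        exact hnear _ (hb j hj).1 (hb j hj).2
    · rw [if_neg hx]
      exact FailLE.of_one_le (by linarith)
  · rw [avg_add, avg_const fun _ => hR]
    linarith [avg_not_balanced_le (n := n) hR]

end Roles

/-! ### Estimates for the probabilities of single transmissions -/

section Estimates

theorem singleProb_le (M k : ℕ) : singleProb M k ≤ M / 2 ^ k := by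
  have h1 : (0 : ℝ) ≤ 1 - 1 / 2 ^ k := by
    rw [sub_nonneg, div_le_one (by positivity)]
    exact one_le_pow₀ one_le_two
  have h2 : (1 - 1 / 2 ^ k : ℝ) ^ (M - 1) ≤ 1 :=
    pow_le_one₀ h1 (by rw [sub_le_self_iff]; positivity)
  rw [singleProb, show (M : ℝ) / 2 ^ k = M * (1 / 2 ^ k) by ring]
  refine mul_le_mul_of_nonneg_left ?_ (Nat.cast_nonneg _)
  have : (0 : ℝ) ≤ 1 / 2 ^ k := by positivity
  nlinarith

theorem self_mul_exp_neg_le (z : ℝ) : z * Real.exp (-z) ≤ 2 * Real.exp (-(z / 2)) := by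
  have h1 : Real.exp (-z) = Real.exp (-(z / 2)) * Real.exp (-(z / 2)) := by
    rw [← Real.exp_add]; congr 1; ring
  have h2 := Real.exp_pos (-(z / 2))
  have h3 : z / 2 * Real.exp (-(z / 2)) ≤ 1 := by
    have := Real.add_one_le_exp (z / 2)
    have h4 : Real.exp (z / 2) * Real.exp (-(z / 2)) = 1 := by
      rw [← Real.exp_add]; simp
    nlinarith
  rw [h1]
  nlinarith

/-- With `z = M / 2 ^ k` the probability is at most `3 * z * exp (-z)`, where `3` bounds `exp (1 / 2
^ k)`, and `z * exp (-z) ≤ 2 * exp (-z / 2)`. -/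
theorem singleProb_le_exp (M k : ℕ) :
    singleProb M k ≤ 6 * Real.exp (-(M / 2 ^ k / 2)) := by
  rcases M with _ | M
  · simp [singleProb]
  set p : ℝ := 1 / 2 ^ k with hp
  have hp0 : 0 < p := by positivity
  have hp1 : p ≤ 1 := by
    rw [hp, div_le_one (by positivity)]
    exact one_le_pow₀ one_le_two
  have h1 : (1 - p) ^ M ≤ Real.exp (-(p * M)) := by
    calc (1 - p) ^ M ≤ (Real.exp (-p)) ^ M := by
          refine pow_le_pow_left₀ (by linarith) ?_ M
          linarith [Real.add_one_le_exp (-p)]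
      _ = Real.exp (-(p * M)) := by rw [← Real.exp_nat_mul]; congr 1; ring
  have h2 : Real.exp (-(p * M)) ≤ 3 * Real.exp (-(p * (M + 1))) := by
    have : Real.exp (-(p * M)) = Real.exp p * Real.exp (-(p * (M + 1))) := by
      rw [← Real.exp_add]; congr 1; ring
    rw [this]
    refine mul_le_mul_of_nonneg_right ?_ (Real.exp_pos _).le
    have := Real.exp_le_exp.2 hp1
    linarith [Real.exp_one_lt_d9]
  have h3 := self_mul_exp_neg_le (p * (M + 1))
  have h4 : ((M + 1 : ℕ) : ℝ) / 2 ^ k = p * (M + 1) := by rw [hp]; push_cast; ring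
  rw [singleProb, h4, Nat.add_sub_cancel]
  push_cast
  have h5 : 0 ≤ ((M : ℝ) + 1) * p := by positivity
  calc ((M : ℝ) + 1) * (p * (1 - p) ^ M) = ((M + 1) * p) * (1 - p) ^ M := by ring
    _ ≤ ((M + 1) * p) * (3 * Real.exp (-(p * (M + 1)))) :=
        mul_le_mul_of_nonneg_left (h1.trans h2) h5
    _ ≤ 6 * Real.exp (-(p * (M + 1) / 2)) := by nlinarith

theorem exp_neg_le_of_256 {z : ℝ} (hz : 256 ≤ z) : Real.exp (-z) ≤ 1 / 2 ^ 16 := by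
  have h1 : (257 : ℝ) ≤ Real.exp 256 := by linarith [Real.add_one_le_exp (256 : ℝ)]
  have h2 : (129 : ℝ) ≤ Real.exp 128 := by linarith [Real.add_one_le_exp (128 : ℝ)]
  have h3 : (65 : ℝ) ≤ Real.exp 64 := by linarith [Real.add_one_le_exp (64 : ℝ)]
  have h4 : Real.exp 256 = Real.exp 64 * Real.exp 64 * Real.exp 128 := by
    rw [← Real.exp_add, ← Real.exp_add]; norm_num
  have h5 : (2 : ℝ) ^ 16 ≤ Real.exp 256 := by
    rw [h4]
    have : (65 : ℝ) * 65 ≤ Real.exp 64 * Real.exp 64 := by nlinarith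
    nlinarith
  have h6 : Real.exp 256 ≤ Real.exp z := Real.exp_le_exp.2 hz
  rw [Real.exp_neg, one_div]
  exact inv_anti₀ (by norm_num) (h5.trans h6)

theorem stageFar_iff {d n k : ℕ} (hd : 0 < d) {C : ℝ} : StageFar d C n k ↔
    C * 2 ^ k < n / numRoles d ∨ C * (n / numRoles d) < 2 ^ k := by
  have hR : (0 : ℝ) < numRoles d := by exact_mod_cast numRoles_pos hd
  rw [StageFar, not_and_or, not_le, not_le, lt_div_iff₀ hR]
  push_cast
  refine or_congr ?_ ?_
  · rw [show C * ((numRoles d : ℝ) * 2 ^ k) = C * 2 ^ k * numRoles d by ring]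
  · rw [← mul_div_assoc, div_lt_iff₀ hR, mul_comm (2 ^ k : ℝ)]

/-- Counting at a wrong scale. -/
theorem singleProb_le_of_far {d n k M : ℕ} (hd : 0 < d) (hn : 0 < n)
    (hf : StageFar d 2048 n k) (h1 : (n / numRoles d : ℝ) / 2 ≤ M)
    (h2 : (M : ℝ) ≤ 2 * (n / numRoles d)) : singleProb M k ≤ (1 / 2) / (4 * (128 : ℕ)) := by
  have hR : (0 : ℝ) < numRoles d := by exact_mod_cast numRoles_pos hd
  have hn' : (0 : ℝ) < n := by exact_mod_cast hn
  have hμ : (0 : ℝ) < n / numRoles d := by positivity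
  have hp : (0 : ℝ) < 2 ^ k := by positivity
  -- The factor `2048` enters here. The imbalance of the roles costs a factor `2`, which leaves `M /
  -- 2 ^ k` above `1024` or below `1 / 1024`; the latter is exactly the required bound.
  rcases (stageFar_iff hd).1 hf with h | h
  · refine (singleProb_le_exp M k).trans ?_
    have h3 : (1024 : ℝ) ≤ M / 2 ^ k := by
      rw [le_div_iff₀ hp]
      linarith
    have := exp_neg_le_of_256 (z := M / 2 ^ k / 2) (by linarith)
    norm_num at this ⊢
    linarith
  · refine (singleProb_le M k).trans ?_
    rw [div_le_iff₀ hp]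
    norm_num
    nlinarith

/-- Counting at a scale that is much too low. -/
theorem singleProb_le_of_giant {d n k M : ℕ} (hk : k ≤ d)
    (h1 : (n / numRoles d : ℝ) / 2 ≤ M) :
    singleProb M k ≤
      (3072 * Real.exp (-(n / numRoles d / 2 ^ (d + 2)))) / (4 * (128 : ℕ)) := by
  refine (singleProb_le_exp M k).trans ?_
  have h2 : (2 : ℝ) ^ k ≤ 2 ^ d := pow_le_pow_right₀ one_le_two hk
  have h3 : (n / numRoles d : ℝ) / 2 ^ (d + 2) ≤ M / 2 ^ k / 2 := by
    calc (n / numRoles d : ℝ) / 2 ^ (d + 2) = (n / numRoles d : ℝ) / 2 / 2 ^ d / 2 := by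
          rw [pow_add]; field_simp
      _ ≤ M / 2 ^ k / 2 := by gcongr
  have := Real.exp_le_exp.2 (neg_le_neg h3)
  norm_num
  linarith

/-- There is a scale at which single candidates are likely. -/
theorem exists_near_scale {d n : ℕ} (hd : 0 < d) (hR : 4 ≤ numRoles d) (hRn : numRoles d ≤ n)
    (hn : n ≤ 2 ^ d) : ∃ k ≤ d, ∀ M : ℕ, (n / numRoles d : ℝ) / 2 ≤ M →
      (M : ℝ) ≤ 2 * (n / numRoles d) → 1 / 32 ≤ singleProb M k := by
  have hR0 : (0 : ℝ) < numRoles d := by exact_mod_cast numRoles_pos hd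
  set μ : ℝ := n / numRoles d with hμ
  have hμ1 : 1 ≤ μ := by
    rw [hμ, one_le_div hR0]
    exact_mod_cast hRn
  -- The least `k` with `4 * μ ≤ 2 ^ k` has `2 ^ k ≤ 8 * μ`, so `M / 2 ^ k` lies in `[1 / 16, 1 /
  -- 2]` for all admitted `M`. It does not exceed `d` because there are at least four roles.
  have hex : ∃ k : ℕ, 4 * μ ≤ 2 ^ k := by
    refine ⟨d, ?_⟩
    have h1 : (4 : ℝ) ≤ numRoles d := by exact_mod_cast hR
    have h2 : (n : ℝ) ≤ 2 ^ d := by exact_mod_cast hn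
    have h3 : μ * numRoles d = n := by rw [hμ]; field_simp
    nlinarith
  classical
  have hk := Nat.find_spec hex
  set k := Nat.find hex with hkdef
  have hkd : k ≤ d := Nat.find_le (by
    have h1 : (4 : ℝ) ≤ numRoles d := by exact_mod_cast hR
    have h2 : (n : ℝ) ≤ 2 ^ d := by exact_mod_cast hn
    have h3 : μ * numRoles d = n := by rw [hμ]; field_simp
    nlinarith)
  have hk0 : k ≠ 0 := by
    intro h0
    rw [h0, pow_zero] at hk
    linarith
  obtain ⟨t, ht⟩ := Nat.exists_eq_succ_of_ne_zero hk0
  have hlt : (2 : ℝ) ^ t < 4 * μ := by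
    have := Nat.find_min hex (m := t) (by omega)
    push Not at this
    exact this
  have hk8 : (2 : ℝ) ^ k ≤ 8 * μ := by
    rw [ht, pow_succ]
    linarith
  have hp : (0 : ℝ) < 2 ^ k := by positivity
  refine ⟨k, hkd, fun M h1 h2 => ?_⟩
  have h3 : (1 / 16 : ℝ) ≤ M * (1 / 2 ^ k) := by
    rw [mul_one_div, le_div_iff₀ hp]
    linarith
  have h4 : (M : ℝ) * (1 / 2 ^ k) ≤ 1 / 2 := by
    rw [mul_one_div, div_le_iff₀ hp]
    linarith
  have := half_le_unique (by positivity)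
    (by rw [div_le_one hp]; exact one_le_pow₀ one_le_two) h3 h4
  rw [singleProb]
  linarith

theorem pairProb_le_sq {n M : ℕ} (hM : 2 ≤ M) (hn : 1 ≤ n) : pairProb n M ≤ ((n : ℝ) / M) ^ 2 := by
  have hM' : (2 : ℝ) ≤ M := by exact_mod_cast hM
  have hn' : (1 : ℝ) ≤ n := by exact_mod_cast hn
  have h0 : (0 : ℝ) ≤ 1 - 2 / M := by
    rw [sub_nonneg, div_le_one (by linarith)]
    exact hM'
  have h1 : (1 - 2 / M : ℝ) ^ (n - 2) ≤ 1 :=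
    pow_le_one₀ h0 (by rw [sub_le_self_iff]; positivity)
  rw [pairProb_eq hM]
  have h2 : (n : ℝ) * (n - 1) ≤ n * n := by nlinarith
  have h3 : (0 : ℝ) ≤ n * (n - 1) := by nlinarith
  calc (n : ℝ) * (n - 1) * ((1 / M) ^ 2 * (1 - 2 / M) ^ (n - 2))
      ≤ ((n : ℝ) * n) * ((1 / M) ^ 2 * 1) := by gcongr
    _ = ((n : ℝ) / M) ^ 2 := by ring

/-- With `z = n / M` the probability is at most `2 * z ^ 2 * exp (-2 * z)`, where `2` bounds `exp (4
/ M)`, and `z ^ 2 / 2 ≤ exp z`. -/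
theorem pairProb_le_exp {n M : ℕ} (hM : 8 ≤ M) (hn : 2 ≤ n) :
    pairProb n M ≤ 4 * Real.exp (-(n / M)) := by
  have hM' : (8 : ℝ) ≤ M := by exact_mod_cast hM
  have hM0 : (0 : ℝ) < M := by linarith
  have hn' : (2 : ℝ) ≤ n := by exact_mod_cast hn
  set p : ℝ := 1 / M with hp
  have hp0 : 0 < p := by positivity
  have hp8 : p ≤ 1 / 8 := by
    rw [hp]
    exact one_div_le_one_div_of_le (by norm_num) hM'
  have h2p : (2 : ℝ) / M = 2 * p := by rw [hp]; ring
  have hz : (n : ℝ) / M = n * p := by rw [hp]; ring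
  have h1 : (1 - 2 * p) ^ (n - 2) ≤ 2 * Real.exp (-(2 * (n * p))) := by
    calc (1 - 2 * p) ^ (n - 2) ≤ (Real.exp (-(2 * p))) ^ (n - 2) := by
          refine pow_le_pow_left₀ (by linarith) ?_ _
          linarith [Real.add_one_le_exp (-(2 * p))]
      _ = Real.exp (4 * p) * Real.exp (-(2 * (n * p))) := by
          rw [← Real.exp_nat_mul, ← Real.exp_add, Nat.cast_sub hn]
          congr 1
          push_cast
          ring
      _ ≤ 2 * Real.exp (-(2 * (n * p))) := by
          refine mul_le_mul_of_nonneg_right ?_ (Real.exp_pos _).le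
          have := Real.exp_le_exp.2 (show 4 * p ≤ 1 / 2 by linarith)
          linarith [exp_half_le]
  rw [pairProb_eq (by omega), h2p, hz]
  set z : ℝ := n * p with hzdef
  have hz0 : 0 ≤ z := by positivity
  have h2 : (n : ℝ) * (n - 1) * p ^ 2 ≤ z ^ 2 := by
    rw [hzdef]
    have : 0 < p ^ 2 := by positivity
    nlinarith
  have h3 : z ^ 2 * Real.exp (-(2 * z)) ≤ 2 * Real.exp (-z) := by
    have e1 : Real.exp (-(2 * z)) = Real.exp (-z) * Real.exp (-z) := by
      rw [← Real.exp_add]; congr 1; ring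
    have e2 := Real.quadratic_le_exp_of_nonneg hz0
    have e3 : Real.exp z * Real.exp (-z) = 1 := by rw [← Real.exp_add]; simp
    have e4 := Real.exp_pos (-z)
    have e5 : z ^ 2 * Real.exp (-z) ≤ 2 := by nlinarith
    rw [e1]
    nlinarith
  have h4 : (0 : ℝ) ≤ (1 - 2 * p) ^ (n - 2) := pow_nonneg (by linarith) _
  calc (n : ℝ) * (n - 1) * (p ^ 2 * (1 - 2 * p) ^ (n - 2))
      = (n * (n - 1) * p ^ 2) * (1 - 2 * p) ^ (n - 2) := by ring
    _ ≤ z ^ 2 * (2 * Real.exp (-(2 * z))) := by gcongr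
    _ ≤ 4 * Real.exp (-z) := by linarith

theorem far_iff {n k : ℕ} {C : ℝ} : Far C n k ↔ C * 2 ^ k < n ∨ C * n < 2 ^ k := by
  rw [Far, not_and_or, not_le, not_le]
  push_cast
  rfl

theorem eight_le_two_pow (k : ℕ) : 8 ≤ 2 ^ (k + 3) := by
  have := Nat.one_le_two_pow (n := k)
  rw [pow_add]
  omega

theorem pairProb_le_of_far {n k : ℕ} (hn : 2 ≤ n) (hf : Far 2048 n k) :
    pairProb n (2 ^ (k + 3)) ≤ (1 / 2) / (4 * (1024 : ℕ)) := by
  have hp : (0 : ℝ) < 2 ^ k := by positivity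
  have hM : ((2 ^ (k + 3) : ℕ) : ℝ) = 8 * 2 ^ k := by push_cast; rw [pow_add]; ring
  rcases far_iff.1 hf with h | h
  · refine (pairProb_le_exp (eight_le_two_pow k) hn).trans ?_
    have h3 : (256 : ℝ) ≤ n / (2 ^ (k + 3) : ℕ) := by
      rw [hM, le_div_iff₀ (by positivity)]
      linarith
    have := exp_neg_le_of_256 h3
    norm_num at this ⊢
    linarith
  · refine (pairProb_le_sq (by linarith [eight_le_two_pow k]) (by omega)).trans ?_
    have h3 : (n : ℝ) / (2 ^ (k + 3) : ℕ) ≤ 1 / 16384 := by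
      rw [hM, div_le_iff₀ (by positivity)]
      linarith
    have h4 : (0 : ℝ) ≤ n / (2 ^ (k + 3) : ℕ) := by positivity
    norm_num at h3 h4 ⊢
    nlinarith

theorem pairProb_le_of_giant {n k d : ℕ} (hn : 2 ≤ n) (hk : k ≤ d) :
    pairProb n (2 ^ (k + 3)) ≤
      (2 ^ 14 * Real.exp (-(n / 2 ^ (d + 3)))) / (4 * (1024 : ℕ)) := by
  refine (pairProb_le_exp (eight_le_two_pow k) hn).trans ?_
  have h3 : (n : ℝ) / 2 ^ (d + 3) ≤ n / (2 ^ (k + 3) : ℕ) := by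
    push_cast
    exact div_le_div_of_nonneg_left (by positivity) (by positivity)
      (pow_le_pow_right₀ one_le_two (by omega))
  have := Real.exp_le_exp.2 (neg_le_neg h3)
  rw [show (2 ^ 14 * Real.exp (-(n / 2 ^ (d + 3))) : ℝ) / (4 * (1024 : ℕ)) =
    4 * Real.exp (-(n / 2 ^ (d + 3))) by norm_num; ring]
  linarith

/-- For `k = Nat.log 2 n` the expected number of devices drawing `0` lies between `1 / 8` and `1 /
4`. The choice of the pair then contributes at least `1 / 128`, and the absence of interference at
least `1 / 2`. -/
theorem exists_near_pair {n d : ℕ} (hn : 2 ≤ n) (hnd : n ≤ 2 ^ d) :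
    ∃ k ≤ d, 1 / 256 ≤ pairProb n (2 ^ (k + 3)) := by
  have h3 := Nat.pow_log_le_self 2 (show n ≠ 0 by omega)
  have h4 := Nat.lt_pow_succ_log_self one_lt_two n
  set t := Nat.log 2 n
  have h5 : t ≤ d := by
    by_contra hcon
    have : 2 ^ (d + 1) ≤ 2 ^ t := Nat.pow_le_pow_right two_pos (by omega)
    have h0 := Nat.two_pow_pos d
    rw [pow_succ] at this
    omega
  refine ⟨t, h5, ?_⟩
  have h8 := eight_le_two_pow t
  rw [pairProb_eq (by omega)]
  have hM : ((2 ^ (t + 3) : ℕ) : ℝ) = 8 * 2 ^ t := by push_cast; rw [pow_add]; ring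
  rw [hM]
  have hp : (0 : ℝ) < 2 ^ t := by positivity
  have h3' : (2 : ℝ) ^ t ≤ n := by exact_mod_cast h3
  have h4' : (n : ℝ) ≤ 2 ^ t * 2 := by
    rw [← pow_succ]; exact_mod_cast h4.le
  have hn' : (2 : ℝ) ≤ n := by exact_mod_cast hn
  have ht1 : (1 : ℝ) ≤ 2 ^ t := one_le_pow₀ one_le_two
  set p : ℝ := 1 / (8 * 2 ^ t) with hpdef
  have hp0 : 0 < p := by positivity
  have e1 : (2 : ℝ) / (8 * 2 ^ t) = 2 * p := by rw [hpdef]; ring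
  have hp8 : p ≤ 1 / 8 := by
    rw [hpdef]
    exact one_div_le_one_div_of_le (by norm_num) (by linarith)
  have e2 : (1 / 8 : ℝ) ≤ n * p := by
    rw [hpdef, mul_one_div, le_div_iff₀ (by positivity)]
    linarith
  have e3 : (n : ℝ) * p ≤ 1 / 4 := by
    rw [hpdef, mul_one_div, div_le_iff₀ (by positivity)]
    linarith
  have e4 : (1 / 2 : ℝ) ≤ (1 - 2 * p) ^ (n - 2) := by
    have := one_add_mul_le_pow (a := -(2 * p)) (by linarith) (n - 2)
    have h6 : ((n - 2 : ℕ) : ℝ) ≤ n := by exact_mod_cast Nat.sub_le _ _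
    have h7 : 1 + -(2 * p) = 1 - 2 * p := by ring
    rw [h7] at this
    nlinarith
  rw [e1]
  have e5 : (1 / 128 : ℝ) ≤ n * (n - 1) * p ^ 2 := by
    have : (n : ℝ) * (n - 1) ≥ n * n / 2 := by nlinarith
    have hp2 : 0 < p ^ 2 := by positivity
    nlinarith
  calc (1 / 256 : ℝ) = 1 / 128 * (1 / 2) := by norm_num
    _ ≤ (n * (n - 1) * p ^ 2) * (1 - 2 * p) ^ (n - 2) := by
        refine mul_le_mul e5 e4 (by norm_num) ?_
        linarith
    _ = n * (n - 1) * (p ^ 2 * (1 - 2 * p) ^ (n - 2)) := by ring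

end Estimates

/-! ### Failure probabilities in terms of the network size -/

section Sizes

variable {d : ℕ}

theorem blockLen_le (hd : 0 < d) : blockLen d ≤ 16 * d ^ 3 := by
  unfold blockLen attempts
  calc (d + 1) * (8 * d ^ 2) ≤ (d + d) * (8 * d ^ 2) := by gcongr; omega
    _ = 16 * d ^ 3 := by ring

theorem numRounds_le (hd : 0 < d) : numRounds d ≤ 2 ^ 14 * d ^ 6 := by
  have h1 : scaleRounds d ≤ 2 ^ 13 * d ^ 5 := by
    unfold scaleRounds countRounds
    have h2 : d ^ 2 ≤ d ^ 5 := Nat.pow_le_pow_right hd (by norm_num)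
    calc 128 * d ^ 2 + 256 * blockLen d * d ^ 2
        ≤ 128 * d ^ 5 + 256 * (16 * d ^ 3) * d ^ 2 := by gcongr; exact blockLen_le hd
      _ = 4224 * d ^ 5 := by ring
      _ ≤ 2 ^ 13 * d ^ 5 := by gcongr; norm_num
  unfold numRounds
  calc (d + 1) * scaleRounds d ≤ (d + d) * (2 ^ 13 * d ^ 5) := by gcongr; omega
    _ = 2 ^ 14 * d ^ 6 := by ring

/-- The order is `d ^ 11`, and two further powers of `d ≥ 2 ^ 11` absorb the constants. The exponent
`13` is the reason for the condition `d ^ 52 ≤ n` in later estimates: it gives `numRoles d ≤ n ^ (1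
/ 4)`. -/
theorem numRoles_le (hd : 2 ^ 11 ≤ d) : numRoles d ≤ d ^ 13 := by
  have h0 : 0 < d := by omega
  have h2 : d ^ 6 ≤ d ^ 11 := Nat.pow_le_pow_right h0 (by norm_num)
  have h3 : (2 ^ 11) ^ 2 ≤ d ^ 2 := Nat.pow_le_pow_left hd 2
  unfold numRoles
  calc numRounds d + numRounds d * blockLen d * attempts d
      ≤ 2 ^ 14 * d ^ 6 + 2 ^ 14 * d ^ 6 * (16 * d ^ 3) * (8 * d ^ 2) := by
        gcongr
        · exact numRounds_le h0
        · exact numRounds_le h0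
        · exact blockLen_le h0
        · exact le_rfl
    _ = 2 ^ 14 * d ^ 6 + 2 ^ 21 * d ^ 11 := by ring
    _ ≤ (2 ^ 11) ^ 2 * d ^ 11 := by omega
    _ ≤ d ^ 2 * d ^ 11 := by gcongr
    _ = d ^ 13 := by ring

/-- The number of slots of a stage. -/
def stageLen (d : ℕ) : ℕ := numRounds d * (blockLen d + 2) + 2

theorem stageLen_le (hd : 2 ^ 11 ≤ d) : stageLen d ≤ d ^ 13 := by
  have h0 : 0 < d := by omega
  have h1 : 1 ≤ d ^ 3 := Nat.one_le_pow _ _ h0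
  have h2 : 1 ≤ d ^ 9 := Nat.one_le_pow _ _ h0
  have h3 : (2 ^ 11) ^ 4 ≤ d ^ 4 := Nat.pow_le_pow_left hd 4
  unfold stageLen
  calc numRounds d * (blockLen d + 2) + 2
      ≤ 2 ^ 14 * d ^ 6 * (16 * d ^ 3 + 2 * d ^ 3) + 2 := by
        gcongr
        · exact numRounds_le h0
        · exact blockLen_le h0
        · omega
    _ = 2 ^ 14 * 18 * d ^ 9 + 2 := by ring
    _ ≤ (2 ^ 11) ^ 4 * d ^ 9 := by omega
    _ ≤ d ^ 4 * d ^ 9 := by gcongr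
    _ = d ^ 13 := by ring

theorem four_le_numRoles (hd : 0 < d) : 4 ≤ numRoles d := by
  have h1 : 1 ≤ d ^ 2 := Nat.one_le_pow _ _ hd
  have h2 : 4 ≤ scaleRounds d := by
    unfold scaleRounds countRounds
    have : 0 ≤ 256 * blockLen d * d ^ 2 := Nat.zero_le _
    omega
  have h3 : scaleRounds d ≤ numRounds d := by
    unfold numRounds
    nlinarith
  exact (h2.trans h3).trans (numRounds_le_numRoles d)

end Sizes

/-! ### Bounds by inverse powers of the network size -/

section Negligible

variable {n a d : ℕ}

/-- For the fourth root `x` of `n`, the inequality `x ≤ exp x` gives `n ^ a = x ^ (4 * a) ≤ exp (4 *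
a * x)`. -/
theorem exp_neg_le_inv_pow {x z : ℝ} (hx : 0 < x) (hxn : x ^ 4 = n) (hz : 4 * a * x ≤ z) :
    Real.exp (-z) ≤ 1 / (n : ℝ) ^ a := by
  rw [Real.exp_neg, ← one_div]
  have hn : (0 : ℝ) < n := by rw [← hxn]; positivity
  refine one_div_le_one_div_of_le (by positivity) ?_
  rw [← hxn, ← pow_mul]
  calc x ^ (4 * a) ≤ Real.exp x ^ (4 * a) := by
        gcongr
        linarith [Real.add_one_le_exp x]
    _ = Real.exp ((4 * a : ℕ) * x) := (Real.exp_nat_mul _ _).symm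
    _ ≤ Real.exp z := Real.exp_le_exp.2 (by push_cast; exact hz)

theorem exists_fourth_root (n : ℕ) (hn : 0 < n) : ∃ x : ℝ, 0 < x ∧ x ^ 4 = n := by
  have h : (0 : ℝ) < n := by exact_mod_cast hn
  refine ⟨√√n, by positivity, ?_⟩
  rw [show (4 : ℕ) = 2 * 2 by norm_num, pow_mul, Real.sq_sqrt (by positivity),
    Real.sq_sqrt h.le]

theorem pow_le_fourth_root {x : ℝ} {y : ℕ} {k : ℕ} (hx : 0 < x) (hxn : x ^ 4 = n)
    (h : y ^ (k * 4) ≤ n) : (y : ℝ) ^ k ≤ x := by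
  refine le_of_pow_le_pow_left₀ (n := 4) (by norm_num) hx.le ?_
  rw [hxn, ← pow_mul]
  exact_mod_cast h

/-- `2^{-d²}` is negligible for networks of size `2^{O(d)}`. -/
theorem half_pow_sq_le {b s : ℕ} (hn : 0 < n) (hnd : n ≤ 2 ^ (b * d)) (h : a * b ≤ s) :
    (1 / 2 : ℝ) ^ (s * d) ≤ 1 / (n : ℝ) ^ a := by
  rw [one_div_pow]
  have h1 : (0 : ℝ) < n := by exact_mod_cast hn
  refine one_div_le_one_div_of_le (by positivity) ?_
  have h2 : (n : ℝ) ≤ 2 ^ (b * d) := by exact_mod_cast hnd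
  calc (n : ℝ) ^ a ≤ (2 ^ (b * d)) ^ a := by gcongr
    _ = 2 ^ (a * b * d) := by rw [← pow_mul]; ring
    _ ≤ 2 ^ (s * d) := pow_le_pow_right₀ one_le_two (Nat.mul_le_mul_right _ h)

/-- Of the exponent `d ^ 2 = (d - 1) * d + d` the last summand absorbs the factor `d + 1`, and the
rest beats `n ^ a ≤ 2 ^ (4 * a * d)`. -/
theorem succ_mul_half_pow_le (hn : 0 < n) (hnd : n ≤ 2 ^ (4 * d)) (ha : 4 * a + 1 ≤ d) :
    ((d : ℝ) + 1) * (1 / 2) ^ threshold d ≤ 1 / (n : ℝ) ^ a := by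
  obtain ⟨s, rfl⟩ : ∃ s, d = s + 1 := ⟨d - 1, by omega⟩
  have h1 : (((s + 1 : ℕ) : ℝ) + 1) ≤ 2 ^ (s + 1) := by
    exact_mod_cast Nat.lt_two_pow_self (n := s + 1)
  have h2 := half_pow_sq_le (a := a) (s := s) hn hnd (by omega)
  have h3 : threshold (s + 1) = s * (s + 1) + (s + 1) := by unfold threshold; ring
  rw [h3, pow_add]
  have h4 : ((2 : ℝ) ^ (s + 1)) * (1 / 2) ^ (s + 1) = 1 := by rw [← mul_pow]; norm_num
  calc (((s + 1 : ℕ) : ℝ) + 1) * ((1 / 2) ^ (s * (s + 1)) * (1 / 2) ^ (s + 1))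
      ≤ 2 ^ (s + 1) * ((1 / 2) ^ (s * (s + 1)) * (1 / 2) ^ (s + 1)) := by gcongr
    _ = (1 / 2) ^ (s * (s + 1)) := by
        rw [mul_comm, mul_assoc, mul_comm ((1 / 2 : ℝ) ^ (s + 1)), h4, mul_one]
    _ ≤ _ := h2

/-- The base is at most `1`, so the power may be dropped. The bound for `exp (-z)` has one factor `1
/ n` to spare, which absorbs `(d + 1) * A`. -/
theorem succ_mul_pow_le_of_giant {A z x : ℝ} (hx : 0 < x) (hxn : x ^ 4 = n) (hd : 0 < d)
    (hA0 : 0 < A) (hA : ((d : ℝ) + 1) * A ≤ n) (hz : 4 * (a + 1 : ℕ) * x ≤ z) :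
    ((d : ℝ) + 1) * (A * Real.exp (-z)) ^ threshold d ≤ 1 / (n : ℝ) ^ a := by
  have hn : (0 : ℝ) < n := by rw [← hxn]; positivity
  have h1 := exp_neg_le_inv_pow hx hxn hz
  have hd' : (1 : ℝ) ≤ d := by exact_mod_cast hd
  have hAn : A ≤ n := by nlinarith
  have hn1 : (1 : ℝ) ≤ n := by
    have : 0 < n := by exact_mod_cast hn
    exact_mod_cast this
  have h2 : A * Real.exp (-z) ≤ 1 := by
    calc A * Real.exp (-z) ≤ n * (1 / (n : ℝ) ^ (a + 1)) := by gcongr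
      _ = 1 / (n : ℝ) ^ a := by rw [pow_succ]; field_simp
      _ ≤ 1 := by
        rw [div_le_one (by positivity)]
        exact one_le_pow₀ hn1
  have h3 : (A * Real.exp (-z)) ^ threshold d ≤ A * Real.exp (-z) :=
    pow_le_of_le_one (by positivity) h2 (by unfold threshold; positivity)
  calc ((d : ℝ) + 1) * (A * Real.exp (-z)) ^ threshold d
      ≤ (d + 1) * (A * Real.exp (-z)) := by gcongr
    _ = (d + 1) * A * Real.exp (-z) := by ring
    _ ≤ n * (1 / (n : ℝ) ^ (a + 1)) := by gcongr
    _ = 1 / (n : ℝ) ^ a := by rw [pow_succ]; field_simp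

/-- Wrong estimates in the routine for small networks are unlikely. -/
theorem exists_far_small (hn : 2 ≤ n) (hd : 2 ^ 11 ≤ d) (ha : 64 * (a + 1) ≤ d) :
    ∃ y : ℝ, 0 < y ∧ (∀ k ≤ d, Far 2048 n k → pairProb n (2 ^ (k + 3)) ≤ y / (4 * (1024 : ℕ))) ∧
      ((d : ℝ) + 1) * y ^ threshold d ≤ 1 / (n : ℝ) ^ a := by
  -- In this range the threshold of `d ^ 2` successes makes a wrong estimate negligible. A larger
  -- network exceeds all scales by so much that a single success already has probability
  -- exponentially small in a power of `n`.
  by_cases h : n ≤ 2 ^ (4 * d)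
  · exact ⟨1 / 2, by norm_num, fun k _ hf => pairProb_le_of_far hn hf,
      succ_mul_half_pow_le (by omega) h (by omega)⟩
  · push Not at h
    obtain ⟨x, hx, hxn⟩ := exists_fourth_root n (by omega)
    have h1 : (2 : ℝ) ^ d ≤ x := by
      have := pow_le_fourth_root (y := 2) (k := d) hx hxn (by rw [mul_comm]; exact h.le)
      exact_mod_cast this
    have h2 : (d : ℝ) + 1 ≤ 2 ^ d := by exact_mod_cast Nat.lt_two_pow_self (n := d)
    have h3 : (2 ^ 11 : ℝ) ≤ d := by exact_mod_cast hd
    have h4 : (64 * (a + 1) : ℝ) ≤ d := by exact_mod_cast ha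
    refine ⟨2 ^ 14 * Real.exp (-(n / 2 ^ (d + 3))), by positivity,
      fun k hk _ => pairProb_le_of_giant hn hk,
      succ_mul_pow_le_of_giant hx hxn (by omega) (by norm_num) ?_ ?_⟩
    · rw [← hxn]
      have h5 : (2 ^ 11 : ℝ) ≤ x := by linarith
      calc ((d : ℝ) + 1) * 2 ^ 14 ≤ x * (2 ^ 11) ^ 3 := by
            gcongr
            · linarith
            · norm_num
        _ ≤ x * x ^ 3 := by gcongr
        _ = x ^ 4 := by ring
    · rw [le_div_iff₀ (by positivity), ← hxn, pow_add]
      push_cast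
      have h5 : (64 * (a + 1) : ℝ) ≤ x := by linarith
      have h6 : (1 : ℝ) ≤ x := by linarith
      calc 4 * ((a : ℝ) + 1) * x * (2 ^ d * 2 ^ 3) = (32 * (a + 1)) * x * 2 ^ d := by ring
        _ ≤ x * x * x := by
            gcongr
            linarith
        _ ≤ x ^ 4 := by nlinarith [pow_pos hx 3]

/-- Wrong estimates in a stage are unlikely. -/
theorem exists_far_stage (hd : 2 ^ 11 ≤ d) (ha : 64 * (a + 1) ≤ d) (hdn : d ^ 52 ≤ n) :
    ∃ y : ℝ, 0 < y ∧ (∀ k ≤ d, StageFar d 2048 n k → ∀ M : ℕ, (n / numRoles d : ℝ) / 2 ≤ M →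
      (M : ℝ) ≤ 2 * (n / numRoles d) → singleProb M k ≤ y / (4 * (128 : ℕ))) ∧
      ((d : ℝ) + 1) * y ^ threshold d ≤ 1 / (n : ℝ) ^ a := by
  have hn : 0 < n := lt_of_lt_of_le (Nat.pow_pos (by omega)) hdn
  by_cases h : n ≤ 2 ^ (4 * d)
  · exact ⟨1 / 2, by norm_num, fun k _ hf M h1 h2 =>
      singleProb_le_of_far (by omega) hn hf h1 h2,
      succ_mul_half_pow_le (by omega) h (by omega)⟩
  · push Not at h
    obtain ⟨x, hx, hxn⟩ := exists_fourth_root n (by omega)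
    have h1 : (2 : ℝ) ^ d ≤ x := by
      have := pow_le_fourth_root (y := 2) (k := d) hx hxn (by rw [mul_comm]; exact h.le)
      exact_mod_cast this
    have h2 : (d : ℝ) + 1 ≤ 2 ^ d := by exact_mod_cast Nat.lt_two_pow_self (n := d)
    have h3 : (2 ^ 11 : ℝ) ≤ d := by exact_mod_cast hd
    have h4 : (64 * (a + 1) : ℝ) ≤ d := by exact_mod_cast ha
    have hR : (numRoles d : ℝ) ≤ x := by
      have h5 := pow_le_fourth_root (y := d) (k := 13) hx hxn hdn
      have h6 : (numRoles d : ℝ) ≤ (d : ℝ) ^ 13 := by exact_mod_cast numRoles_le hd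
      linarith
    have hR0 : (0 : ℝ) < numRoles d := by exact_mod_cast numRoles_pos (by omega)
    refine ⟨3072 * Real.exp (-(n / numRoles d / 2 ^ (d + 2))), by positivity,
      fun k hk _ M hM _ => singleProb_le_of_giant hk hM,
      succ_mul_pow_le_of_giant hx hxn (by omega) (by norm_num) ?_ ?_⟩
    · rw [← hxn]
      have h5 : (2 ^ 11 : ℝ) ≤ x := by linarith
      calc ((d : ℝ) + 1) * 3072 ≤ x * (2 ^ 11) ^ 3 := by
            gcongr
            · linarith
            · norm_num
        _ ≤ x * x ^ 3 := by gcongr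
        _ = x ^ 4 := by ring
    · rw [le_div_iff₀ (by positivity), le_div_iff₀ hR0, ← hxn, pow_add]
      push_cast
      have h5 : (64 * (a + 1) : ℝ) ≤ x := by linarith
      calc 4 * ((a : ℝ) + 1) * x * (2 ^ d * 2 ^ 2) * numRoles d
          = (16 * (a + 1)) * x * 2 ^ d * numRoles d := by ring
        _ ≤ x * x * x * x := by
            gcongr
            linarith
        _ = x ^ 4 := by ring

/-- Unbalanced roles are unlikely. -/
theorem roles_fail_le (hd : 2 ^ 11 ≤ d) (ha : 64 * (a + 1) ≤ d) (hdn : d ^ 52 ≤ n) :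
    2 * numRoles d * Real.exp (-(n / numRoles d / 16)) ≤ 1 / (n : ℝ) ^ a := by
  have hn : 0 < n := lt_of_lt_of_le (Nat.pow_pos (by omega)) hdn
  obtain ⟨x, hx, hxn⟩ := exists_fourth_root n hn
  have hn' : (0 : ℝ) < n := by exact_mod_cast hn
  have h3 : (2 ^ 11 : ℝ) ≤ d := by exact_mod_cast hd
  have h4 : (64 * (a + 1) : ℝ) ≤ d := by exact_mod_cast ha
  have h5 := pow_le_fourth_root (y := d) (k := 13) hx hxn hdn
  have hdx : (d : ℝ) ≤ x := (le_self_pow₀ (by linarith) (by norm_num)).trans h5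
  have hR : (numRoles d : ℝ) ≤ x := by
    have h6 : (numRoles d : ℝ) ≤ (d : ℝ) ^ 13 := by exact_mod_cast numRoles_le hd
    linarith
  have hR0 : (0 : ℝ) < numRoles d := by exact_mod_cast numRoles_pos (by omega)
  have h7 : 4 * (a + 1 : ℕ) * x ≤ n / numRoles d / 16 := by
    rw [le_div_iff₀ (by norm_num), le_div_iff₀ hR0, ← hxn]
    push_cast
    calc 4 * ((a : ℝ) + 1) * x * 16 * numRoles d = 64 * (a + 1) * x * numRoles d := by ring
      _ ≤ x * x * x := by
          gcongr
          linarith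
      _ ≤ x ^ 4 := by nlinarith [pow_pos hx 3]
  calc 2 * numRoles d * Real.exp (-(n / numRoles d / 16)) ≤ n * (1 / (n : ℝ) ^ (a + 1)) := by
        gcongr
        · rw [← hxn]
          calc 2 * (numRoles d : ℝ) ≤ x ^ 3 * x := by
                gcongr
                calc (2 : ℝ) ≤ (2 ^ 11) ^ 3 := by norm_num
                  _ ≤ x ^ 3 := by
                    gcongr
                    linarith
            _ = x ^ 4 := by ring
        · exact exp_neg_le_inv_pow hx hxn h7
    _ = 1 / (n : ℝ) ^ a := by rw [pow_succ]; field_simp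

/-- There are `256 * blockLen d * d ^ 2` election rounds per scale, and each group of `256 *
blockLen d` of them reduces the failure probability by a factor of at least `e`. -/
theorem missProb_pow_le (hd : 0 < d) :
    missProb d ^ (scaleRounds d - countRounds d) ≤ (1 / 2) ^ (d * d) := by
  have hb : (0 : ℝ) < blockLen d := by exact_mod_cast blockLen_pos hd
  have h1 : scaleRounds d - countRounds d = 256 * blockLen d * (d * d) := by
    unfold scaleRounds
    rw [Nat.add_sub_cancel_left, pow_two]
  rw [h1, pow_mul]
  refine pow_le_pow_left₀ (pow_nonneg (missProb_nonneg hd) _) ?_ _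
  calc missProb d ^ (256 * blockLen d)
      ≤ Real.exp (-(1 / (256 * blockLen d))) ^ (256 * blockLen d) := by
        refine pow_le_pow_left₀ (missProb_nonneg hd) ?_ _
        rw [missProb]
        exact Real.one_sub_le_exp_neg _
    _ = Real.exp (-1) := by
        rw [← Real.exp_nat_mul]
        congr 1
        push_cast
        field_simp
    _ ≤ 1 / 2 := by
        rw [Real.exp_neg, ← one_div]
        exact one_div_le_one_div_of_le two_pos (by linarith [Real.add_one_le_exp 1])

/-- A stage whose parameter matches the network size rarely lacks a leader. -/
theorem stage_miss_le (hd : 2 ^ 11 ≤ d) (ha : 64 * (a + 1) ≤ d) (hdn : d ^ 52 ≤ n)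
    (hn : n ≤ 2 ^ d) :
    numRounds d * (7 / 8 : ℝ) ^ attempts d + ((1 / 2) ^ threshold d +
      missProb d ^ (scaleRounds d - countRounds d)) ≤ 3 * (1 / (n : ℝ) ^ a) := by
  have hn0 : 0 < n := lt_of_lt_of_le (Nat.pow_pos (by omega)) hdn
  have hn' : (0 : ℝ) < n := by exact_mod_cast hn0
  have h1 : n ≤ 2 ^ (1 * d) := by rwa [one_mul]
  have h2 := half_pow_sq_le (a := a) (s := d) hn0 h1 (by omega)
  have h3 := half_pow_sq_le (a := a + 1) (s := d) hn0 h1 (by omega)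
  have h4 : threshold d = d * d := by unfold threshold; ring
  have h5 := missProb_pow_le (show 0 < d by omega)
  have h6 : (7 / 8 : ℝ) ^ attempts d ≤ (1 / 2) ^ (d * d) := by
    unfold attempts
    rw [pow_mul, pow_two]
    exact pow_le_pow_left₀ (by norm_num) (by norm_num) _
  have h7 : (numRounds d : ℝ) ≤ n := by
    have : numRounds d ≤ n := (numRounds_le_numRoles d).trans <| (numRoles_le hd).trans <|
      (Nat.pow_le_pow_right (by omega) (by norm_num)).trans hdn
    exact_mod_cast this
  have h8 : numRounds d * (7 / 8 : ℝ) ^ attempts d ≤ 1 / (n : ℝ) ^ a := by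
    calc numRounds d * (7 / 8 : ℝ) ^ attempts d ≤ n * (1 / (n : ℝ) ^ (a + 1)) := by
          gcongr
          exact h6.trans h3
      _ = 1 / (n : ℝ) ^ a := by rw [pow_succ]; field_simp
  rw [h4]
  linarith

end Negligible

/-! ### The failure probability of the protocol -/

section Total

variable {n a I : ℕ} {d : ℕ → ℕ} {N : ℕ} {cd : CDModel}

/-- The parameters `d` suit networks of size `n`, and `I` is the stage that elects a leader. -/
structure Suitable (d : ℕ → ℕ) (a n I : ℕ) : Prop where
  large : ∀ i, 2 ^ 11 ≤ d i
  ample : ∀ i, 64 * (a + 1) ≤ d i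
  pow_le : ∀ i ≤ I, d i ^ 52 ≤ n
  le_two_pow : n ≤ 2 ^ d I
  low : ∀ m, m + 2 ≤ I → 2 ^ d m * 2 ^ d m ≤ n
  high : ∀ m, I + 1 ≤ m → (a + 1) * d I ≤ d m

/-- From stage `i` on, the stages up to `I` elect a leader. -/
theorem chain_fail (hs : Suitable d a n I) {E : ℕ} (r : ℕ) : ∀ i e T : ℕ, i + r = I →
    e + 5 * (r + 1) ≤ E → ∑ k ∈ range (r + 1), stageLen (d (i + k)) ≤ T →
    ∀ (D : Fin n → Device (protocol d N cd).alg), Conf d N cd (.pick i) e D →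
      FailLE (protocol d N cd) cd (goodSet (protocol d N cd) n 2048 E) D T
        ((r + 1) * (5 * (1 / (n : ℝ) ^ a))) := by
  have hpos : ∀ i, 0 < d i := fun i => lt_of_lt_of_le (by norm_num) (hs.large i)
  have hn0 : 0 < n := lt_of_lt_of_le (Nat.pow_pos (hpos I)) (hs.pow_le I le_rfl)
  have hδ : (0 : ℝ) ≤ 1 / (n : ℝ) ^ a := by positivity
  induction r with
  | zero =>
    intro i e T hi hE hT D h
    rw [add_zero] at hi
    subst hi
    rw [zero_add, Finset.sum_range_one, add_zero] at hT
    have hdn := hs.pow_le i le_rfl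
    obtain ⟨y, hy, hfar, hyb⟩ := exists_far_stage (hs.large i) (hs.ample i) hdn
    have hRn : numRoles (d i) ≤ n := (numRoles_le (hs.large i)).trans <|
      (Nat.pow_le_pow_right (hpos i) (by norm_num)).trans hdn
    obtain ⟨k₀, hk₀, hnear⟩ := exists_near_scale (hpos i) (four_le_numRoles (hpos i)) hRn
      hs.le_two_pow
    -- The factor `5` collects one term for unbalanced roles, one for wrong scales, and three from
    -- `stage_miss_le`.
    refine (pick_fail_of_le (hpos i) (by omega) hy hn0 hfar hs.le_two_pow hk₀ hnear hT D h).mono ?_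
    have h1 := roles_fail_le (hs.large i) (hs.ample i) hdn
    have h2 := stage_miss_le (hs.large i) (hs.ample i) hdn hs.le_two_pow
    push_cast
    linarith
  | succ r ih =>
    intro i e T hi hE hT D h
    have hdn := hs.pow_le i (by omega)
    obtain ⟨y, hy, hfar, hyb⟩ := exists_far_stage (hs.large i) (hs.ample i) hdn
    rw [Finset.sum_range_succ', add_zero] at hT
    refine (pick_fail_of_next (hpos i) (by omega) hy
      (F := (r + 1) * (5 * (1 / (n : ℝ) ^ a)))
      (T' := ∑ k ∈ range (r + 1), stageLen (d (i + (k + 1)))) (by positivity) hfar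
      (fun D' T' hD' hT' => ih (i + 1) (e + 5) T' (by omega) (by omega)
        (le_trans (le_of_eq (Finset.sum_congr rfl fun k _ => by
          rw [show i + 1 + k = i + (k + 1) by omega])) hT') D' hD')
      (by unfold stageLen at hT ⊢; omega) D h).mono ?_
    have h1 := roles_fail_le (hs.large i) (hs.ample i) hdn
    push_cast
    linarith

/-- The time that suffices for all stages up to `I`. -/
def stagesLen (d : ℕ → ℕ) (I : ℕ) : ℕ := ∑ k ∈ range (I + 1), stageLen (d k)

theorem sum_shift_le {f : ℕ → ℕ} {i r I : ℕ} (h : i + r = I) :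
    ∑ k ∈ range (r + 1), f (i + k) ≤ ∑ k ∈ range (I + 1), f k := by
  rw [← h, show i + r + 1 = i + (r + 1) by omega, Finset.sum_range_add f i (r + 1)]
  exact Nat.le_add_left _ _

/-- The left-hand side, the probability of silence, is at most `exp (-n / 2 ^ d m) ≤ exp (-√n)`,
since `2 ^ d m ≤ √n`. -/
theorem probe_low (hs : Suitable d a n I) {m : ℕ} (hm : m + 2 ≤ I) :
    (1 - 1 / 2 ^ d m : ℝ) ^ n ≤ 1 / (n : ℝ) ^ a := by
  have hp : (0 : ℝ) < 2 ^ d m := by positivity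
  have hpos : ∀ i, 0 < d i := fun i => lt_of_lt_of_le (by norm_num) (hs.large i)
  have hn0 : 0 < n := lt_of_lt_of_le (Nat.pow_pos (hpos I)) (hs.pow_le I le_rfl)
  obtain ⟨x, hx, hxn⟩ := exists_fourth_root n hn0
  have h0 : (0 : ℝ) ≤ 1 - 1 / 2 ^ d m := by
    rw [sub_nonneg, div_le_one hp]
    exact one_le_pow₀ one_le_two
  have h1 : (2 ^ d m : ℝ) ≤ x ^ 2 := by
    have h2 : (2 ^ d m * 2 ^ d m : ℝ) ≤ n := by exact_mod_cast hs.low m hm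
    refine le_of_sq_le_sq (by rw [← pow_mul x, hxn, pow_two]; exact h2) (by positivity)
  have h3 : (4 * a : ℝ) ≤ x := by
    have h4 := pow_le_fourth_root (y := d I) (k := 13) hx hxn (hs.pow_le I le_rfl)
    have h5 : (64 * (a + 1) : ℝ) ≤ d I := by exact_mod_cast hs.ample I
    have h6 : (1 : ℝ) ≤ d I := by exact_mod_cast hpos I
    have h7 := le_self_pow₀ h6 (show 13 ≠ 0 by norm_num)
    have h8 : (0 : ℝ) ≤ a := Nat.cast_nonneg a
    linarith
  calc (1 - 1 / 2 ^ d m : ℝ) ^ n ≤ Real.exp (-(1 / 2 ^ d m)) ^ n :=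
        pow_le_pow_left₀ h0 (Real.one_sub_le_exp_neg _) _
    _ = Real.exp (-(n / 2 ^ d m)) := by
        rw [← Real.exp_nat_mul]
        congr 1
        ring
    _ ≤ 1 / (n : ℝ) ^ a := by
        refine exp_neg_le_inv_pow hx hxn ?_
        rw [le_div_iff₀ hp, ← hxn]
        calc 4 * a * x * 2 ^ d m ≤ x * x * x ^ 2 := by gcongr
          _ = x ^ 4 := by ring

/-- `2 ^ d m ≥ (2 ^ d I) ^ (a + 1) ≥ n ^ (a + 1)`. -/
theorem probe_high (hs : Suitable d a n I) {m : ℕ} (hm : I + 1 ≤ m) :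
    (n : ℝ) / 2 ^ d m ≤ 1 / (n : ℝ) ^ a := by
  have hpos : ∀ i, 0 < d i := fun i => lt_of_lt_of_le (by norm_num) (hs.large i)
  have hn0 : 0 < n := lt_of_lt_of_le (Nat.pow_pos (hpos I)) (hs.pow_le I le_rfl)
  have hn : (0 : ℝ) < n := by exact_mod_cast hn0
  rw [div_le_div_iff₀ (by positivity) (by positivity), one_mul, ← pow_succ']
  have h1 : (n : ℝ) ≤ 2 ^ d I := by exact_mod_cast hs.le_two_pow
  calc (n : ℝ) ^ (a + 1) ≤ (2 ^ d I) ^ (a + 1) := by gcongr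
    _ = 2 ^ ((a + 1) * d I) := by rw [← pow_mul, mul_comm]
    _ ≤ 2 ^ d m := pow_le_pow_right₀ one_le_two (hs.high m hm)

/-- Without collision detection for receivers, all stages are tried. -/
theorem afterSmall_fail_of_not_receiver (hcd : ¬ HasReceiverCD cd) (hs : Suitable d a n I)
    {E T e : ℕ} (hE : e + 5 * (I + 1) ≤ E) (hT : stagesLen d I ≤ T)
    (D : Fin n → Device (protocol d N cd).alg) (h : Conf d N cd (afterSmall cd) e D) :
    FailLE (protocol d N cd) cd (goodSet (protocol d N cd) n 2048 E) D T
      ((I + 1) * (5 * (1 / (n : ℝ) ^ a))) := by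
  refine chain_fail hs I 0 e T (by omega) hE (by simpa [stagesLen] using hT) D ?_
  cases cd
  · exact absurd (.inl rfl) hcd
  · exact h
  · exact absurd (.inr rfl) hcd
  · exact h

/-- With collision detection for receivers, at most three stages are tried. -/
theorem afterSmall_fail_of_receiver (hcd : HasReceiverCD cd) (hs : Suitable d a n I)
    {K E T e : ℕ} (hK : I + 2 ≤ 2 ^ K) (hE : e + 2 * K + 15 ≤ E)
    (hT : 2 * K + stagesLen d I ≤ T)
    (D : Fin n → Device (protocol d N cd).alg) (h : Conf d N cd (afterSmall cd) e D) :
    FailLE (protocol d N cd) cd (goodSet (protocol d N cd) n 2048 E) D T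
      ((2 * K + 15) * (1 / (n : ℝ) ^ a)) := by
  have hδ : (0 : ℝ) ≤ 1 / (n : ℝ) ^ a := by positivity
  have h' : Conf d N cd (.search (2 ^ 0 - 1) 0) e D := by
    rcases hcd with rfl | rfl <;> exact h
  refine (doubling_search hcd (I := I) (e' := e + 2 * K) (T' := stagesLen d I)
    (F := 15 * (1 / (n : ℝ) ^ a)) (by positivity) hδ (fun m hm => probe_low hs hm)
    (fun m hm => probe_high hs hm) (fun i e₁ h1 h2 he D' T' hD' hT' => ?_) hK K 0 e T (by omega)
    (by omega) (by omega) (by omega) D h').mono (by linarith)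
  have h3 : ((I - i : ℕ) : ℝ) ≤ 2 := by exact_mod_cast (by omega : I - i ≤ 2)
  refine (chain_fail hs (I - i) i e₁ T' (by omega) (by omega)
    ((sum_shift_le (f := fun k => stageLen (d k)) (by omega)).trans hT') D' hD').mono ?_
  nlinarith

/-- The energy and the time spent before the stages begin. -/
def setup (d : ℕ → ℕ) : ℕ := 3 * ((d 0 + 1) * smallTrials (d 0))

/-- The routine for small networks and everything after it. -/
theorem small_fail_total {E T T' e : ℕ} {F : ℝ} (hF : 0 ≤ F) (hn : 2 ≤ n)
    (hd : 2 ^ 11 ≤ d 0) (ha : 64 * (a + 1) ≤ d 0) (hE : e + setup d ≤ E)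
    (hT : setup d + T' ≤ T)
    (hnext : 2 ^ d 0 < n → ∀ (D : Fin n → Device (protocol d N cd).alg) (T : ℕ),
      Conf d N cd (afterSmall cd) (e + setup d) D → T' ≤ T →
      FailLE (protocol d N cd) cd (goodSet (protocol d N cd) n 2048 E) D T F)
    (D : Fin n → Device (protocol d N cd).alg) (h : Conf d N cd (.small 0 0) e D) :
    FailLE (protocol d N cd) cd (goodSet (protocol d N cd) n 2048 E) D T
      (2 * (1 / (n : ℝ) ^ a) + F) := by
  have hδ : (0 : ℝ) ≤ 1 / (n : ℝ) ^ a := by positivity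
  have h0 : 0 < d 0 := by omega
  obtain ⟨y, hy, hfar, hyb⟩ := exists_far_small hn hd ha
  by_cases hnd : n ≤ 2 ^ d 0
  · obtain ⟨k, hk, hnear⟩ := exists_near_pair hn hnd
    refine (small_fail_of_le (s := d 0 - k) h0 hy hE hfar (Nat.sub_le _ _)
      (by rwa [Nat.sub_sub_self hk]) (by unfold setup at hT; omega) D h).mono ?_
    have h4 := half_pow_sq_le (a := a) (s := d 0) (b := 1) (d := d 0) (show 0 < n by omega)
      (by rwa [one_mul]) (by omega)
    rw [← pow_two, ← threshold] at h4
    linarith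
  · refine (small_fail_of_next h0 hy hF hE hfar (hnext (by omega)) hT D h).mono ?_
    linarith

/-- `n ≤ 2 ^ (n - 1)`. Hence the number of slots of the test may depend on the error exponent alone.
-/
theorem solo_miss_le (hn : 2 ≤ n) : (1 / (2 ^ a : ℕ) : ℝ) ^ (n - 1) ≤ 1 / (n : ℝ) ^ a := by
  have hn' : (0 : ℝ) < n := by exact_mod_cast (by omega : 0 < n)
  rw [one_div_pow]
  refine one_div_le_one_div_of_le (by positivity) ?_
  push_cast
  rw [← pow_mul, mul_comm, pow_mul]
  gcongr
  obtain ⟨m, rfl⟩ : ∃ m, n = m + 1 := ⟨n - 1, by omega⟩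
  exact_mod_cast Nat.lt_two_pow_self (n := m)

theorem conf_start (m : Mem) (h : (protocol d N cd).start = m) :
    Conf d N cd m 0 (fun _ : Fin n => ⟨.ready (protocol d N cd).start, 0, 0, .idle⟩) :=
  ⟨fun _ => congrArg _ h, fun _ _ => rfl, fun _ => le_rfl⟩

/-- The whole protocol in a network of at least two devices. -/
theorem protocol_fail {E T T' : ℕ} {F : ℝ} (hF : 0 ≤ F) (hn : 2 ≤ n)
    (hd : 2 ^ 11 ≤ d 0) (ha : 64 * (a + 1) ≤ d 0)
    (hnext : 2 ^ d 0 < n → ∀ e ≤ 2 ^ a + 1 + setup d,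
      ∀ (D : Fin n → Device (protocol d (2 ^ a) cd).alg) (T : ℕ),
      Conf d (2 ^ a) cd (afterSmall cd) e D → T' ≤ T →
      FailLE (protocol d (2 ^ a) cd) cd (goodSet (protocol d (2 ^ a) cd) n 2048 E) D T F)
    (hE : 2 ^ a + 1 + setup d ≤ E) (hT : 2 ^ a + 1 + setup d + T' ≤ T) :
    FailLE (protocol d (2 ^ a) cd) cd (goodSet (protocol d (2 ^ a) cd) n 2048 E)
      (fun _ => ⟨.ready (protocol d (2 ^ a) cd).start, 0, 0, .idle⟩) T
      (3 * (1 / (n : ℝ) ^ a) + F) := by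
  have hδ : (0 : ℝ) ≤ 1 / (n : ℝ) ^ a := by positivity
  have h2a := Nat.one_le_two_pow (n := a)
  have key : ∀ e ≤ 2 ^ a + 1, ∀ (D : Fin n → Device (protocol d (2 ^ a) cd).alg) (T : ℕ),
      Conf d (2 ^ a) cd (.small 0 0) e D → setup d + T' ≤ T →
      FailLE (protocol d (2 ^ a) cd) cd (goodSet (protocol d (2 ^ a) cd) n 2048 E) D T
        (2 * (1 / (n : ℝ) ^ a) + F) := fun e he D T h hT =>
    small_fail_total hF hn hd ha (by omega) hT
      (fun hlt D' T' hD' hT' => hnext hlt _ (by omega) D' T' hD' hT') D h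
  have hrec : HasReceiverCD cd → (protocol d (2 ^ a) cd).start = .solo →
      FailLE (protocol d (2 ^ a) cd) cd (goodSet (protocol d (2 ^ a) cd) n 2048 E)
        (fun _ => ⟨.ready (protocol d (2 ^ a) cd).start, 0, 0, .idle⟩) T
        (3 * (1 / (n : ℝ) ^ a) + F) := fun hcd hst => by
    refine (solo_receiver hcd hn (by omega) (F := 2 * (1 / (n : ℝ) ^ a) + F)
      (T' := setup d + T') (by positivity) (by omega) (fun D T h hT => key _ le_rfl D T h hT) _
      (conf_start _ hst)).mono ?_
    linarith [solo_miss_le (a := a) hn]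
  cases cd
  · exact hrec (.inl rfl) rfl
  · refine (solo_sender hn (F := 2 * (1 / (n : ℝ) ^ a) + F) (T' := setup d + T') (by positivity)
      (by omega) (fun D T h hT => key _ (by omega) D T h hT) _ (conf_start _ rfl)).mono ?_
    linarith
  · exact hrec (.inr rfl) rfl
  · refine (key 0 (by omega) _ T (conf_start _ rfl) (by omega)).mono ?_
    linarith

/-- The whole protocol in a network of one device. -/
theorem protocol_fail_one (hcd : cd ≠ .noCD) {E T : ℕ} (hE : 2 ^ a + 1 ≤ E) (hT : 2 ^ a + 1 ≤ T) :
    FailLE (protocol d (2 ^ a) cd) cd (goodSet (protocol d (2 ^ a) cd) 1 2048 E)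
      (fun _ => ⟨.ready (protocol d (2 ^ a) cd).start, 0, 0, .idle⟩) T 0 := by
  have h2a := Nat.one_le_two_pow (n := a)
  cases cd
  · exact solo_receiver_one (.inl rfl) (by norm_num) (by omega) hE hT _ (conf_start _ rfl) le_rfl
  · exact solo_sender_one (by norm_num) (by omega) (by omega) _ (conf_start _ rfl) 0 le_rfl
  · exact solo_receiver_one (.inr rfl) (by norm_num) (by omega) hE hT _ (conf_start _ rfl) le_rfl
  · exact absurd rfl hcd

end Total

/-! ### The stage parameters -/

section Parameters

/-- The exponents of the stage parameters. -/
def scaleExp (s : ℕ) : ℕ → ℕ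
  | 0 => s
  | i + 1 => 2 ^ (scaleExp s i - 1)

/-- The stage parameters. -/
def param (s i : ℕ) : ℕ := 4 ^ scaleExp s i

variable {s : ℕ}

theorem four_mul_le_two_pow {e : ℕ} (h : 6 ≤ e) : 4 * e ≤ 2 ^ e := by
  induction e, h using Nat.le_induction with
  | base => norm_num
  | succ e he ih => rw [pow_succ]; omega

theorem succ_le_two_pow_pred {e : ℕ} (h : 6 ≤ e) : e + 1 ≤ 2 ^ (e - 1) := by
  have h1 := four_mul_le_two_pow h
  obtain ⟨k, rfl⟩ : ∃ k, e = k + 1 := ⟨e - 1, by omega⟩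
  rw [pow_succ] at h1
  rw [Nat.add_sub_cancel]
  omega

theorem six_le_scaleExp (hs : 6 ≤ s) (i : ℕ) : 6 ≤ scaleExp s i := by
  induction i with
  | zero => exact hs
  | succ i ih =>
    have := succ_le_two_pow_pred ih
    rw [scaleExp]
    omega

theorem scaleExp_lt_succ (hs : 6 ≤ s) (i : ℕ) : scaleExp s i < scaleExp s (i + 1) :=
  succ_le_two_pow_pred (six_le_scaleExp hs i)

theorem scaleExp_strictMono (hs : 6 ≤ s) : StrictMono (scaleExp s) :=
  strictMono_nat_of_lt_succ (scaleExp_lt_succ hs)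

theorem add_le_scaleExp (hs : 6 ≤ s) (i : ℕ) : s + i ≤ scaleExp s i := by
  induction i with
  | zero => exact le_rfl
  | succ i ih =>
    have := scaleExp_lt_succ hs i
    omega

theorem param_strictMono (hs : 6 ≤ s) : StrictMono (param s) := fun _ _ h =>
  Nat.pow_lt_pow_right (by norm_num) (scaleExp_strictMono hs h)

theorem param_eq_sq (i : ℕ) : param s i = 2 ^ scaleExp s i * 2 ^ scaleExp s i := by
  rw [param, ← mul_pow]
  norm_num

/-- This says `d (i + 1) = 2 ^ √(d i)`; powers of `4` keep the square root integral. Because of the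
root, `d (i + 1)` is subexponential in `d i`, while iteration still grows like a tower. -/
theorem param_succ (hs : 6 ≤ s) (i : ℕ) : param s (i + 1) = 2 ^ 2 ^ scaleExp s i := by
  obtain ⟨k, hk⟩ : ∃ k, scaleExp s i = k + 1 := ⟨scaleExp s i - 1, by
    have := six_le_scaleExp hs i
    omega⟩
  rw [param, scaleExp, hk, Nat.add_sub_cancel, show 4 = 2 ^ 2 by norm_num, ← pow_mul, pow_succ 2 k,
    mul_comm 2]

theorem le_param (hs : 6 ≤ s) (i : ℕ) : s + i + 1 ≤ param s i := by
  have h1 := add_le_scaleExp hs i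
  have h2 : scaleExp s i < param s i := Nat.lt_pow_self (by norm_num)
  omega

theorem two_mul_param_le (hs : 6 ≤ s) {i j : ℕ} (h : i < j) : 2 * param s i ≤ param s j := by
  have h1 : 4 ^ (scaleExp s i + 1) ≤ param s j :=
    Nat.pow_le_pow_right (by norm_num) (scaleExp_strictMono hs h)
  have h2 : 4 ^ (scaleExp s i + 1) = 4 * param s i := by rw [pow_succ, mul_comm, param]
  omega

theorem exists_stage (hs : 6 ≤ s) (n : ℕ) : ∃ i, n ≤ 2 ^ param s i :=
  ⟨n, (Nat.lt_two_pow_self (n := n)).le.trans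
    (Nat.pow_le_pow_right two_pos (by have := le_param hs n; omega))⟩

open Classical in
/-- The stage that elects a leader among `n` devices. -/
noncomputable def finalStage (s n : ℕ) : ℕ :=
  if h : ∃ i, n ≤ 2 ^ param s i then Nat.find h else 0

theorem le_finalStage (hs : 6 ≤ s) (n : ℕ) : n ≤ 2 ^ param s (finalStage s n) := by
  classical
  rw [finalStage, dif_pos (exists_stage hs n)]
  exact Nat.find_spec (exists_stage hs n)

theorem lt_of_lt_finalStage (hs : 6 ≤ s) {n i : ℕ} (h : i < finalStage s n) :
    2 ^ param s i < n := by
  classical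
  rw [finalStage, dif_pos (exists_stage hs n)] at h
  exact not_le.1 (Nat.find_min (exists_stage hs n) h)

theorem lt_finalStage (hs : 6 ≤ s) {n i : ℕ} (h : 2 ^ param s i < n) : i < finalStage s n := by
  by_contra hcon
  have h1 : param s (finalStage s n) ≤ param s i := (param_strictMono hs).monotone (by omega)
  have h2 := Nat.pow_le_pow_right two_pos h1
  have := le_finalStage hs n
  omega

theorem finalStage_le (hs : 6 ≤ s) (n : ℕ) : finalStage s n ≤ n := by
  by_contra hcon
  have h1 := lt_of_lt_finalStage hs (not_le.1 hcon)
  have h2 := le_param hs n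
  have h3 := Nat.lt_two_pow_self (n := param s n)
  omega

theorem tendsto_finalStage (hs : 6 ≤ s) : Tendsto (finalStage s) atTop atTop := by
  refine tendsto_atTop.2 fun b => ?_
  filter_upwards [eventually_gt_atTop (2 ^ param s b)] with n hn
  exact (lt_finalStage hs hn).le

theorem large_param (hs : 6 ≤ s) (i : ℕ) : 2 ^ 11 ≤ param s i :=
  calc 2 ^ 11 ≤ 4 ^ 6 := by norm_num
    _ ≤ param s i := Nat.pow_le_pow_right (by norm_num) (six_le_scaleExp hs i)

theorem ample_param {a : ℕ} (hs : a + 6 ≤ s) (i : ℕ) : 64 * (a + 1) ≤ param s i := by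
  have h1 := add_le_scaleExp (show 6 ≤ s by omega) i
  have h2 : a + 1 ≤ 4 ^ a := Nat.lt_pow_self (by norm_num)
  calc 64 * (a + 1) ≤ 4 ^ 6 * 4 ^ a := Nat.mul_le_mul (by norm_num) h2
    _ = 4 ^ (a + 6) := by rw [pow_add, mul_comm]
    _ ≤ param s i := Nat.pow_le_pow_right (by norm_num) (by omega)

/-- With `I = j + 1` and `e = scaleExp s j`, `param_succ` gives `d I ^ 2 ^ e = 2 ^ d j < n`, and `2
^ e ≥ 64` covers the exponent `52`. With `e' = scaleExp s I`, the separation from later stages is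
`(a + 1) * 4 ^ e' ≤ 2 ^ (3 * e') ≤ 2 ^ 2 ^ e'`. -/
theorem suitable_param {a n : ℕ} (hs : a + 6 ≤ s) (h : 0 < finalStage s n) :
    Suitable (param s) a n (finalStage s n) := by
  have hs6 : 6 ≤ s := by omega
  obtain ⟨j, hj⟩ : ∃ j, finalStage s n = j + 1 := ⟨finalStage s n - 1, by omega⟩
  have hlt := lt_of_lt_finalStage hs6 (show j < finalStage s n by omega)
  have hexp : ∀ i, a + 6 ≤ scaleExp s i := fun i => by
    have := add_le_scaleExp hs6 i
    omega
  have ha : a + 1 ≤ 2 ^ a := Nat.lt_two_pow_self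
  refine ⟨large_param hs6, ample_param hs, fun i hi => ?_, le_finalStage hs6 n, fun m hm => ?_,
    fun m hm => ?_⟩
  · have h1 : param s i ≤ param s (j + 1) := (param_strictMono hs6).monotone (by omega)
    have h2 : 52 ≤ 2 ^ scaleExp s j :=
      le_trans (by norm_num : 52 ≤ 2 ^ 6) (Nat.pow_le_pow_right two_pos (six_le_scaleExp hs6 j))
    calc param s i ^ 52 ≤ param s (j + 1) ^ 52 := Nat.pow_le_pow_left h1 _
      _ ≤ param s (j + 1) ^ 2 ^ scaleExp s j :=
          Nat.pow_le_pow_right (by have := le_param hs6 (j + 1); omega) h2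
      _ = 2 ^ param s j := by rw [param_succ hs6, ← pow_mul, ← param_eq_sq]
      _ ≤ n := hlt.le
  · have h1 : 2 * param s m ≤ param s j := two_mul_param_le hs6 (by omega)
    rw [← pow_add]
    exact (Nat.pow_le_pow_right two_pos (by omega)).trans hlt.le
  · set I := finalStage s n
    have h1 : param s (I + 1) ≤ param s m := (param_strictMono hs6).monotone hm
    have h2 := four_mul_le_two_pow (six_le_scaleExp hs6 I)
    calc (a + 1) * param s I ≤ 2 ^ scaleExp s I * (2 ^ scaleExp s I * 2 ^ scaleExp s I) := by
          rw [param_eq_sq]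
          refine Nat.mul_le_mul_right _ (ha.trans (Nat.pow_le_pow_right two_pos ?_))
          have := hexp I
          omega
      _ = 2 ^ (3 * scaleExp s I) := by rw [← pow_add, ← pow_add]; congr 1; ring
      _ ≤ 2 ^ 2 ^ scaleExp s I := Nat.pow_le_pow_right two_pos (by omega)
      _ = param s (I + 1) := (param_succ hs6 I).symm
      _ ≤ param s m := h1

end Parameters

/-! ### The iterated logarithm -/

section LogStar

variable {s : ℕ}

theorem exists_iterate_logb_le (m : ℕ) : ∀ x : ℝ, x ≤ m → ∃ k, (Real.logb 2)^[k] x ≤ 1 := by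
  induction m with
  | zero => exact fun x hx => ⟨0, by simp at hx; simp; linarith⟩
  | succ m ih =>
    intro x hx
    by_cases h : x ≤ 1
    · exact ⟨0, h⟩
    · push Not at h
      obtain ⟨k, hk⟩ := ih (Real.logb 2 x) (by
        rw [Real.logb_le_iff_le_rpow one_lt_two (by linarith), Real.rpow_natCast]
        refine hx.trans ?_
        exact_mod_cast Nat.lt_two_pow_self (n := m))
      exact ⟨k + 1, by rwa [Function.iterate_succ_apply]⟩

theorem iterate_logb_logStar_le (n : ℕ) : (Real.logb 2)^[logStar n] (n : ℝ) ≤ 1 :=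
  Nat.sInf_mem (s := {k : ℕ | (Real.logb 2)^[k] (n : ℝ) ≤ 1}) (exists_iterate_logb_le n n le_rfl)

/-- An induction with slack `2`: for `e ≥ 6`, `2 ^ (e - 1) ≤ x + 2` implies `2 ^ (e - 2) ≤ x`, that
is, `e ≤ Real.logb 2 x + 2`. -/
theorem one_lt_iterate_logb (hs : 6 ≤ s) (i : ℕ) : ∀ x : ℝ, (scaleExp s i : ℝ) ≤ x + 2 →
    ∀ k ≤ i, 1 < (Real.logb 2)^[k] x := by
  have key : ∀ (j : ℕ) (x : ℝ), (scaleExp s j : ℝ) ≤ x + 2 → 1 < x := fun j x hx => by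
    have : (6 : ℝ) ≤ scaleExp s j := by exact_mod_cast six_le_scaleExp hs j
    linarith
  induction i with
  | zero =>
    intro x hx k hk
    obtain rfl := Nat.le_zero.1 hk
    exact key 0 x hx
  | succ i ih =>
    intro x hx k hk
    cases k with
    | zero => exact key _ x hx
    | succ k =>
      rw [Function.iterate_succ_apply]
      refine ih _ ?_ k (by omega)
      have hx1 := key _ x hx
      obtain ⟨u, hu⟩ : ∃ u, scaleExp s i = u + 2 := ⟨scaleExp s i - 2, by
        have := six_le_scaleExp hs i
        omega⟩
      have h6 := six_le_scaleExp hs i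
      rw [scaleExp, hu, show u + 2 - 1 = u + 1 by omega] at hx
      rw [hu]
      push_cast at hx ⊢
      have h1 : (2 : ℝ) ≤ 2 ^ u := le_self_pow₀ one_le_two (by omega)
      have h2 : (u : ℝ) ≤ Real.logb 2 x := by
        rw [Real.le_logb_iff_rpow_le one_lt_two (by linarith), Real.rpow_natCast]
        rw [pow_succ] at hx
        linarith
      linarith

theorem lt_logStar (hs : 6 ≤ s) {i n : ℕ} (h : scaleExp s i ≤ n) : i < logStar n := by
  by_contra hcon
  have h1 : (scaleExp s i : ℝ) ≤ n := by exact_mod_cast h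
  have := one_lt_iterate_logb hs i n (by linarith) (logStar n) (by omega)
  linarith [iterate_logb_logStar_le n]

/-- Since `n` exceeds `2 ^ d (I - 1)`, it exceeds the tower value `scaleExp s (I - 1)`, to which
`lt_logStar` applies. -/
theorem finalStage_le_logStar (hs : 6 ≤ s) (n : ℕ) : finalStage s n ≤ logStar n := by
  rcases Nat.eq_zero_or_pos (finalStage s n) with h | h
  · omega
  · have h1 := lt_of_lt_finalStage hs (show finalStage s n - 1 < finalStage s n by omega)
    have h2 : scaleExp s (finalStage s n - 1) < param s (finalStage s n - 1) :=
      Nat.lt_pow_self (by norm_num)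
    have h3 := Nat.lt_two_pow_self (n := param s (finalStage s n - 1))
    have := lt_logStar hs (i := finalStage s n - 1) (n := n) (by omega)
    omega

theorem eventually_three_le_logStar : ∀ᶠ n : ℕ in atTop, 3 ≤ logStar n := by
  filter_upwards [eventually_ge_atTop (scaleExp 6 2)] with n hn
  exact lt_logStar le_rfl hn

end LogStar

/-! ### Energy and time -/

section Budgets

variable {s : ℕ}

/-- The number of iterations of the search for the stage that elects a leader. -/
def searchLen (I : ℕ) : ℕ := Nat.clog 2 (I + 2)

theorem le_two_pow_searchLen (I : ℕ) : I + 2 ≤ 2 ^ searchLen I := Nat.le_pow_clog one_lt_two _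

theorem searchLen_le (I : ℕ) : searchLen I ≤ I + 2 :=
  Nat.clog_le_of_le_pow Nat.lt_two_pow_self.le

theorem isBigO_logStar (hs : 6 ≤ s) (e : ℕ) :
    (fun n : ℕ => ((e + 5 * (finalStage s n + 1) : ℕ) : ℝ)) =O[atTop]
      fun n : ℕ => (logStar n : ℝ) := by
  refine IsBigO.of_bound ((e + 10 : ℕ) : ℝ) ?_
  filter_upwards [eventually_three_le_logStar] with n hn
  rw [Real.norm_natCast, Real.norm_natCast]
  have h1 := finalStage_le_logStar hs n
  have : e + 5 * (finalStage s n + 1) ≤ (e + 10) * logStar n := by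
    have h2 : e * 1 ≤ e * logStar n := Nat.mul_le_mul_left e (by omega)
    rw [add_mul]
    omega
  exact_mod_cast this

/-- If the search length is `k + 1`, then `2 ^ k < I + 2 ≤ L ^ 2`, so it is at most `1 + 2 * log L /
log 2`. The constant `4` suffices because `log L ≥ 1`. -/
theorem searchLen_le_log {I L : ℕ} (hI : I ≤ L) (hL : 3 ≤ L) :
    (searchLen I : ℝ) ≤ 4 * Real.log L := by
  have hL' : (3 : ℝ) ≤ L := by exact_mod_cast hL
  have h1 : 1 ≤ Real.log L := by
    rw [Real.le_log_iff_exp_le (by linarith)]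
    linarith [Real.exp_one_lt_d9]
  obtain ⟨k, hk⟩ : ∃ k, searchLen I = k + 1 := ⟨searchLen I - 1, by
    have : 0 < searchLen I := Nat.clog_pos one_lt_two (by omega)
    omega⟩
  have h2 : 2 ^ k < I + 2 := by
    have := Nat.pow_pred_clog_lt_self one_lt_two (show 1 < I + 2 by omega)
    rwa [← searchLen, hk] at this
  have h3 : (2 : ℝ) ^ k ≤ (L : ℝ) ^ 2 := by
    have : 2 ^ k ≤ L ^ 2 := by nlinarith
    exact_mod_cast this
  have h4 := Real.log_le_log (by positivity) h3
  rw [Real.log_pow, Real.log_pow] at h4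
  push_cast at h4
  have h5 := Real.log_two_gt_d9
  have h6 : (0 : ℝ) ≤ k := Nat.cast_nonneg k
  rw [hk]
  push_cast
  nlinarith

theorem isBigO_log_logStar (hs : 6 ≤ s) (e : ℕ) :
    (fun n : ℕ => ((e + 2 * searchLen (finalStage s n) + 15 : ℕ) : ℝ)) =O[atTop]
      fun n : ℕ => Real.log (logStar n : ℝ) := by
  refine IsBigO.of_bound (e + 23 : ℝ) ?_
  filter_upwards [eventually_three_le_logStar] with n hn
  have hL' : (3 : ℝ) ≤ logStar n := by exact_mod_cast hn
  have h1 : 1 ≤ Real.log (logStar n) := by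
    rw [Real.le_log_iff_exp_le (by linarith)]
    linarith [Real.exp_one_lt_d9]
  rw [Real.norm_natCast, Real.norm_of_nonneg (by linarith)]
  have h2 := searchLen_le_log (finalStage_le_logStar hs n) hn
  have h3 : (0 : ℝ) ≤ e := Nat.cast_nonneg e
  push_cast
  nlinarith

theorem stagesLen_le (hs : 6 ≤ s) (I : ℕ) : stagesLen (param s) I ≤ param s I ^ 14 := by
  have h1 : ∀ k ∈ range (I + 1), stageLen (param s k) ≤ param s I ^ 13 := fun k hk => by
    refine (stageLen_le (large_param hs k)).trans (Nat.pow_le_pow_left ((param_strictMono hs).monotone ?_) _)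
    exact Nat.lt_succ_iff.1 (mem_range.1 hk)
  calc stagesLen (param s) I ≤ (range (I + 1)).card * param s I ^ 13 := by
        rw [← smul_eq_mul]
        exact Finset.sum_le_card_nsmul _ _ _ h1
    _ ≤ param s I * param s I ^ 13 := by
        rw [card_range]
        refine Nat.mul_le_mul_right _ ?_
        have := le_param hs I
        omega
    _ = param s I ^ 14 := by ring

/-- The time is eventually at most `d I ^ 16`. With `ρ = √(d (I - 1))` this equals `2 ^ (16 * ρ) =
(2 ^ d (I - 1)) ^ (16 / ρ) ≤ n ^ (16 / ρ)`, and `ρ` tends to infinity with `I`. -/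
theorem isSubpolynomial_time (hs : 6 ≤ s) (e : ℕ) :
    IsSubpolynomial fun n =>
      e + (2 * searchLen (finalStage s n) + stagesLen (param s) (finalStage s n)) := by
  refine ⟨fun n => 16 / 2 ^ scaleExp s (finalStage s n - 1), ?_, ?_⟩
  · have h1 : Tendsto (fun i : ℕ => (16 : ℝ) / 2 ^ scaleExp s (i - 1)) atTop (𝓝 0) := by
      refine squeeze_zero (fun i => by positivity) (fun i => ?_)
        ((tendsto_const_div_atTop_nhds_zero_nat 16).comp (tendsto_add_atTop_nat 1))
      have h2 : i + 1 ≤ 2 ^ scaleExp s (i - 1) := by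
        have h3 := add_le_scaleExp hs (i - 1)
        have h4 := Nat.lt_two_pow_self (n := scaleExp s (i - 1))
        omega
      have h3 : ((i + 1 : ℕ) : ℝ) ≤ 2 ^ scaleExp s (i - 1) := by exact_mod_cast h2
      have h4 : (0 : ℝ) < (i + 1 : ℕ) := by exact_mod_cast Nat.succ_pos i
      exact div_le_div_of_nonneg_left (by norm_num) h4 h3
    exact h1.comp (tendsto_finalStage hs)
  · filter_upwards [(tendsto_finalStage hs).eventually_ge_atTop (e + 1)] with n hn
    set I := finalStage s n
    obtain ⟨j, hj⟩ : ∃ j, I = j + 1 := ⟨I - 1, by omega⟩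
    have h1 := le_param hs I
    have h2 := searchLen_le I
    have h3 := stagesLen_le hs I
    have h4 : param s I ≤ param s I ^ 14 := Nat.le_self_pow (by norm_num) _
    have h5 : e + (2 * searchLen I + stagesLen (param s) I) ≤ param s I ^ 16 := by
      calc e + (2 * searchLen I + stagesLen (param s) I) ≤ 4 * param s I ^ 14 := by omega
        _ ≤ param s I ^ 2 * param s I ^ 14 := Nat.mul_le_mul_right _ (by nlinarith)
        _ = param s I ^ 16 := by ring
    have hlt : 2 ^ param s j < n := lt_of_lt_finalStage hs (show j < I by omega)
    rw [hj, param_succ hs] at h5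
    rw [hj, Nat.add_sub_cancel]
    have h6 : (2 : ℝ) ^ param s j ≤ n := by exact_mod_cast hlt.le
    have hr : (0 : ℝ) < 2 ^ scaleExp s j := by positivity
    calc ((e + (2 * searchLen (j + 1) + stagesLen (param s) (j + 1)) : ℕ) : ℝ)
        ≤ ((2 ^ 2 ^ scaleExp s j) ^ 16 : ℕ) := by rw [← hj] at h5 ⊢; exact_mod_cast h5
      _ = ((2 : ℝ) ^ param s j) ^ ((16 : ℝ) / 2 ^ scaleExp s j) := by
          push_cast
          rw [param_eq_sq, ← Real.rpow_natCast 2 (2 ^ scaleExp s j * _), ← Real.rpow_mul two_pos.le,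
            ← pow_mul, ← Real.rpow_natCast]
          congr 1
          push_cast
          field_simp
      _ ≤ (n : ℝ) ^ ((16 : ℝ) / 2 ^ scaleExp s j) :=
          Real.rpow_le_rpow (by positivity) h6 (by positivity)

/-- For `n ≥ 2` one has `n + 1 ≤ n ^ 2` and `5 * n + 20 ≤ n ^ 5`; hence `b ≥ 2 * c` and the surplus
`5` in the exponent. -/
theorem total_fail_le {n b : ℕ} {c : ℝ} (hn : 2 ≤ n) (hc : 0 ≤ c) (hb : 2 * c ≤ b) :
    (5 * n + 20) * (1 / (n : ℝ) ^ (b + 5)) ≤ 1 / ((n : ℝ) + 1) ^ c := by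
  have hn' : (2 : ℝ) ≤ n := by exact_mod_cast hn
  have h1 : ((n : ℝ) + 1) ^ c ≤ (n : ℝ) ^ b := by
    calc ((n : ℝ) + 1) ^ c ≤ ((n : ℝ) ^ (2 : ℝ)) ^ c := by
          refine Real.rpow_le_rpow (by linarith) ?_ hc
          rw [Real.rpow_two]
          nlinarith
      _ = (n : ℝ) ^ (2 * c) := (Real.rpow_mul (by linarith) _ _).symm
      _ ≤ (n : ℝ) ^ (b : ℝ) := Real.rpow_le_rpow_of_exponent_le (by linarith) hb
      _ = (n : ℝ) ^ b := Real.rpow_natCast _ _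
  have h2 : (5 * n + 20 : ℝ) ≤ (n : ℝ) ^ 5 := by
    have : (16 : ℝ) ≤ (n : ℝ) ^ 4 := by
      calc (16 : ℝ) = 2 ^ 4 := by norm_num
        _ ≤ (n : ℝ) ^ 4 := by gcongr
    have h3 : (n : ℝ) ^ 5 = (n : ℝ) ^ 4 * n := by ring
    nlinarith
  have h0 : (0 : ℝ) < ((n : ℝ) + 1) ^ c := by positivity
  calc (5 * n + 20) * (1 / (n : ℝ) ^ (b + 5)) ≤ (n : ℝ) ^ 5 * (1 / (n : ℝ) ^ (b + 5)) := by
        gcongr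
    _ = 1 / (n : ℝ) ^ b := by rw [pow_add]; field_simp
    _ ≤ _ := one_div_le_one_div_of_le h0 h1

/-- The protocol meets its energy and time budgets with high probability. -/
theorem protocol_successProb {cd : CDModel} {n b s E : ℕ} {c : ℝ} (hs : b + 11 ≤ s) (hc : 0 < c)
    (hb : 2 * c ≤ b) (hn : 1 ≤ n) (hcd : cd = .noCD → 1 < n)
    (hE₁ : ¬ HasReceiverCD cd → 2 ^ (b + 5) + 1 + setup (param s) + 5 * (finalStage s n + 1) ≤ E)
    (hE₂ : HasReceiverCD cd →
      2 ^ (b + 5) + 1 + setup (param s) + 2 * searchLen (finalStage s n) + 15 ≤ E) :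
    1 - 1 / ((n : ℝ) + 1) ^ c ≤
      successProb (protocol (param s) (2 ^ (b + 5)) cd).alg cd 2048 n
        (2 ^ (b + 5) + 1 + setup (param s) + (2 * searchLen (finalStage s n) +
          stagesLen (param s) (finalStage s n))) E := by
  have hs6 : 6 ≤ s := by omega
  have hE : 2 ^ (b + 5) + 1 + setup (param s) ≤ E := by
    by_cases h : HasReceiverCD cd
    · exact le_trans (by omega) (hE₂ h)
    · exact le_trans (by omega) (hE₁ h)
  refine successProb_ge ?_ (by positivity)
  rcases hn.eq_or_lt with rfl | hn
  -- For a single device bounds by powers of `1 / n` are void, but its test cannot err, so the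
  -- failure probability is `0`.
  · exact (protocol_fail_one (d := param s) (fun h => lt_irrefl _ (hcd h)) (by omega)
      (by omega)).mono (by positivity)
  · have hIn : (finalStage s n : ℝ) ≤ n := by exact_mod_cast finalStage_le hs6 n
    have hK : (searchLen (finalStage s n) : ℝ) ≤ finalStage s n + 2 := by
      exact_mod_cast searchLen_le _
    have hn' : (2 : ℝ) ≤ n := by exact_mod_cast hn
    have htot := total_fail_le hn hc.le hb
    have hδ : (0 : ℝ) ≤ 1 / (n : ℝ) ^ (b + 5) := by positivity
    have hbound₁ : ((finalStage s n : ℝ) + 1) * (5 * (1 / (n : ℝ) ^ (b + 5))) ≤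
        (5 * n + 17) * (1 / (n : ℝ) ^ (b + 5)) := by
      rw [← mul_assoc]
      exact mul_le_mul_of_nonneg_right (by linarith) hδ
    have hbound₂ : (2 * (searchLen (finalStage s n) : ℝ) + 15) * (1 / (n : ℝ) ^ (b + 5)) ≤
        (5 * n + 17) * (1 / (n : ℝ) ^ (b + 5)) :=
      mul_le_mul_of_nonneg_right (by linarith) hδ
    refine (protocol_fail (F := (5 * n + 17) * (1 / (n : ℝ) ^ (b + 5)))
      (T' := 2 * searchLen (finalStage s n) + stagesLen (param s) (finalStage s n)) (by positivity)
      hn (large_param hs6 0) (ample_param (by omega) 0) (fun hlt e he D T h hT => ?_) hE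
      le_rfl).mono ?_
    · have hsuit := suitable_param (a := b + 5) (by omega) (lt_finalStage hs6 hlt)
      by_cases hrec : HasReceiverCD cd
      · exact (afterSmall_fail_of_receiver hrec hsuit (le_two_pow_searchLen _)
          (le_trans (by omega) (hE₂ hrec)) hT D h).mono hbound₂
      · exact (afterSmall_fail_of_not_receiver hrec hsuit (le_trans (by omega) (hE₁ hrec))
          (le_trans (Nat.le_add_left _ _) hT) D h).mono hbound₁
    · refine le_trans (le_of_eq ?_) htot
      ring

end Budgets

end RadioNetwork

/-! ### The main theorem: choice of the parameters -/

theorem mainTheorem6 :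
    ∃ C : ℝ, ∀ (cd : RadioNetwork.CDModel) (c : ℝ), 0 < c →
      ∃ (A : RadioNetwork.Algorithm) (T E : ℕ → ℕ),
        RadioNetwork.IsSubpolynomial T ∧
        ((cd = .senderCD ∨ cd = .noCD) →
          (fun n : ℕ => (E n : ℝ)) =O[atTop] fun n : ℕ => (RadioNetwork.logStar n : ℝ)) ∧
        ((cd = .strongCD ∨ cd = .receiverCD) →
          (fun n : ℕ => (E n : ℝ)) =O[atTop]
            fun n : ℕ => Real.log (RadioNetwork.logStar n : ℝ)) ∧
        ∀ n : ℕ, 1 ≤ n → (cd = .noCD → 1 < n) →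
          1 - 1 / ((n : ℝ) + 1) ^ c ≤ RadioNetwork.successProb A cd C n (T n) (E n) := by
  open RadioNetwork in
  refine ⟨2048, fun cd c hc => ?_⟩
  -- The error exponent is `a = b + 5`, and `d 0 = 4 ^ (a + 6)` depends only on `c`. The test for a
  -- single device and the routine for small networks thus cost `O(1)`.
  obtain ⟨b, hb⟩ := exists_nat_ge (2 * c)
  have hs : 6 ≤ b + 11 := by omega
  by_cases hcd : HasReceiverCD cd
  · refine ⟨(protocol (param (b + 11)) (2 ^ (b + 5)) cd).alg, _, fun n => 2 ^ (b + 5) + 1 +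
      setup (param (b + 11)) + 2 * searchLen (finalStage (b + 11) n) + 15,
      isSubpolynomial_time hs (2 ^ (b + 5) + 1 + setup (param (b + 11))), fun h => ?_,
      fun _ => isBigO_log_logStar hs _, fun n hn hn' => ?_⟩
    · rcases hcd with rfl | rfl <;> simp at h
    · exact protocol_successProb le_rfl hc hb hn hn' (fun h => absurd hcd h) fun _ => le_rfl
  · refine ⟨(protocol (param (b + 11)) (2 ^ (b + 5)) cd).alg, _, fun n => 2 ^ (b + 5) + 1 +
      setup (param (b + 11)) + 5 * (finalStage (b + 11) n + 1),
      isSubpolynomial_time hs (2 ^ (b + 5) + 1 + setup (param (b + 11))),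
      fun _ => isBigO_logStar hs _, fun h => absurd h hcd, fun n hn hn' => ?_⟩
    exact protocol_successProb le_rfl hc hb hn hn' (fun _ => le_rfl) fun h => absurd h hcd
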